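/- Write $\mathbf{R}_+=(0,\infty)$ and $e(x)=e^{2\pi i x}$. Define the polynomials \begin{align*} \xi_{\alpha\beta\alpha,1}&=(x_1^2+1)^2+(x_1x_4+x_2)^2, & \xi_{\alpha\beta\alpha,2}&=x_1^2+x_2^2+x_4^2+1,\\ \zeta_{\alpha\beta\alpha,1}&=x_1x_2-x_4, & \zeta_{\alpha\beta\alpha,2}&=x_1^2x_2-x_1^3x_4-x_1x_4^3-x_2x_4^2-2x_1x_4,\\ \xi_{\beta\alpha\beta,1}&=x_4^2+x_5^2+1, & \xi_{\beta\alpha\beta,2}&=(x_4^2-x_2x_5)^2+x_2^2+2x_4^2+x_5^2+1,\\ \zeta_{\beta\alpha\beta,1}&=x_4(x_2+x_5), & \zeta_{\beta\alpha\beta,2}&=x_4^2x_5-x_2x_5^2-x_2, \end{align*} \begin{align*} \xi_{w_0,1}&=(x_4^2+x_1x_4x_5-x_2x_5)^2+(x_1x_4-x_2)^2+2x_4^2+x_5^2+1,\\ \xi_{w_0,2}&=(x_1x_5+x_4)^2+x_1^2+x_2^2+1,\\ \zeta_{w_0,1}&=-(x_1x_5^2+x_2x_4+x_4x_5+x_1),\\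 \zeta_{w_0,2}&=x_1^3x_4x_5^2+2x_1^2x_4^2x_5-x_1^2x_2x_5^2+x_1^3x_4+x_1x_4^3-x_1^2x_2+x_2x_4^2-x_2^2x_5+2x_1x_4-x_5. \end{align*} For a function $F:\mathbf{R}_+^2\to\mathbf{C}$ of compact support and $A,A_1,A_2>0$ define \begin{align*} \mathcal J_{\alpha\beta\alpha,F}(A)&=A^{-4}\int_{\mathbf{R}_+^2}\int_{\mathbf{R}^3}e\Big(\tfrac{A\zeta_{\alpha\beta\alpha,1}}{\xi_{\alpha\beta\alpha,2}y_1y_2}\Big)e\Big(\tfrac{\zeta_{\alpha\beta\alpha,2}y_2}{\xi_{\alpha\beta\alpha,1}}\Big)e(-Ax_1y_1)\\ &\qquad\times F\Big(\tfrac{A\sqrt{\xi_{\alpha\beta\alpha,1}}}{\xi_{\alpha\beta\alpha,2}y_1y_2},\tfrac{\xi_{\alpha\beta\alpha,2}y_2}{\xi_{\alpha\beta\alpha,1}}\Big)\overline{F(Ay_1,y_2)}\,dx_1dx_2dx_4\frac{dy_1dy_2}{y_1y_2^2},\\ \mathcal J_{\beta\alpha\beta,F}(A)&=A^{-3}\int_{\mathbf{R}_+^2}\int_{\mathbf{R}^3}e\Big(\tfrac{\zeta_{\beta\alpha\beta,1}y_1}{\xi_{\beta\alpha\beta,1}}\Big)e\Big(\tfrac{\zeta_{\beta\alpha\beta,2}}{\xi_{\beta\alpha\beta,2}y_1^2y_2}\Big)e(-Ax_5y_2)\\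 &\qquad\times F\Big(\tfrac{\sqrt{\xi_{\beta\alpha\beta,2}}\,y_1}{\xi_{\beta\alpha\beta,1}},\tfrac{\xi_{\beta\alpha\beta,1}}{\xi_{\beta\alpha\beta,2}y_1^2y_2}\Big)\overline{F(y_1,Ay_2)}\,dx_2dx_4dx_5\frac{dy_1dy_2}{y_1^2y_2},\\ \mathcal J_{w_0,F}(A_1,A_2)&=A_1^{-4}A_2^{-3}\int_{\mathbf{R}_+^2}\int_{\mathbf{R}^4}e\Big(\tfrac{A_1\zeta_{w_0,1}}{\xi_{w_0,2}y_1}\Big)e\Big(\tfrac{A_2\zeta_{w_0,2}}{\xi_{w_0,1}y_2}\Big)e(-A_1x_1y_1-A_2x_5y_2)\\ &\qquad\times F\Big(\tfrac{A_1\sqrt{\xi_{w_0,1}}}{\xi_{w_0,2}y_1},\tfrac{A_2\xi_{w_0,2}}{\xi_{w_0,1}y_2}\Big)\overline{F(A_1y_1,A_2y_2)}\,dx_1dx_2dx_4dx_5\frac{dy_1dy_2}{y_1y_2}. \end{align*} Fix a smooth nonzero function $f:\mathbf{R}_+\to[0,1]$ with support in $[1,2]$ and a smooth function $g:\mathbf{R}_+\to\mathbf{R}$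 with compact support (in the open half-line), both extended by $0$ to $\mathbf{R}$. For $1\le R_1\le R_2$, $X_1,X_2\ge1$ and $\tau_1,\tau_2\in\mathbf{R}$ put $$\mathcal R=R_1R_2(R_1+R_2)(R_2-R_1+1),\qquad F(y_1,y_2)=F_{\tau_1,\tau_2}(y_1,y_2)=\mathcal R^{1/2}f(X_1y_1)f(X_2y_2)\,y_1^{i(\tau_1+\tau_2)}y_2^{i\tau_2}.$$ **Proposition.** There is a constant $R_0\ge1$ depending only on $f$ and $g$ such that for all real $C_1,C_2\ge0$ and $\varepsilon>0$ the following bounds hold for all $R_0\le R_1\le R_2$, all $X_1,X_2\ge1$ and all $A,A_1,A_2>0$, with implied constants depending only on $f,g,C_1,C_2,\varepsilon$: \begin{align*} \int_{\mathbf{R}^2}g\Big(\frac{\tau_1}{R_1}\Big)g\Big(\frac{\tau_2}{R_2}\Big)\mathcal J_{\alpha\beta\alpha,F}(A)\,d\tau_1d\tau_2&\ll\mathcal R\,(AR_1R_2)^{\varepsilon}(X_1^4X_2^3)^{1+\varepsilon}\Big(\frac{1+AX_2^{1/2}}{R_2}\Big)^{C_1},\\ \int_{\mathbf{R}^2}g\Big(\frac{\tau_1}{R_1}\Big)g\Big(\frac{\tau_2}{R_2}\Big)\mathcal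 J_{\beta\alpha\beta,F}(A)\,d\tau_1d\tau_2&\ll\mathcal R\,A^{-3/2+\varepsilon}(R_1R_2)^{\varepsilon}(X_1^4X_2^3)^{1+\varepsilon}\Big(\frac{1+A^{1/2}X_1}{R_2}\Big)^{C_2},\\ \int_{\mathbf{R}^2}g\Big(\frac{\tau_1}{R_1}\Big)g\Big(\frac{\tau_2}{R_2}\Big)\mathcal J_{w_0,F}(A_1,A_2)\,d\tau_1d\tau_2&\ll\mathcal R\,(A_1A_2R_1R_2)^{\varepsilon}(X_1^4X_2^3)^{1+\varepsilon}\\ &\qquad\times\Big(\frac{1+A_1^2A_2X_1X_2^2}{R_2}\Big)^{C_1}\Big(\frac{1+A_1^2A_2^2X_1^2X_2}{R_2}\Big)^{C_2}. \end{align*} -/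

import Mathlib

open MeasureTheory Set
open scoped ContDiff ComplexConjugate

noncomputable section

namespace GSp4

/-- The standard additive character `e(x) = exp(2πix)`. -/
def e (x : ℝ) : ℂ := Complex.exp (2 * Real.pi * Complex.I * x)

/-! The polynomials coming from the Iwasawa decomposition for `w = αβα`,
in the coordinates `x₁, x₂, x₄` of `U_w`. -/

def xiABA1 (x₁ x₂ x₄ : ℝ) : ℝ := (x₁ ^ 2 + 1) ^ 2 + (x₁ * x₄ + x₂) ^ 2

def xiABA2 (x₁ x₂ x₄ : ℝ) : ℝ := x₁ ^ 2 + x₂ ^ 2 + x₄ ^ 2 + 1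

def zetaABA1 (x₁ x₂ x₄ : ℝ) : ℝ := x₁ * x₂ - x₄

def zetaABA2 (x₁ x₂ x₄ : ℝ) : ℝ :=
  x₁ ^ 2 * x₂ - x₁ ^ 3 * x₄ - x₁ * x₄ ^ 3 - x₂ * x₄ ^ 2 - 2 * x₁ * x₄

/-! The polynomials for `w = βαβ`, in the coordinates `x₂, x₄, x₅` of `U_w`. -/

def xiBAB1 (_x₂ x₄ x₅ : ℝ) : ℝ := x₄ ^ 2 + x₅ ^ 2 + 1

def xiBAB2 (x₂ x₄ x₅ : ℝ) : ℝ :=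
  (x₄ ^ 2 - x₂ * x₅) ^ 2 + x₂ ^ 2 + 2 * x₄ ^ 2 + x₅ ^ 2 + 1

def zetaBAB1 (x₂ x₄ x₅ : ℝ) : ℝ := x₄ * (x₂ + x₅)

def zetaBAB2 (x₂ x₄ x₅ : ℝ) : ℝ := x₄ ^ 2 * x₅ - x₂ * x₅ ^ 2 - x₂

/-! The polynomials for the long Weyl element `w₀ = αβαβ`, in the coordinates
`x₁, x₂, x₄, x₅` of `U`. -/

def xiLong1 (x₁ x₂ x₄ x₅ : ℝ) : ℝ :=
  (x₄ ^ 2 + x₁ * x₄ * x₅ - x₂ * x₅) ^ 2 + (x₁ * x₄ - x₂) ^ 2 + 2 * x₄ ^ 2 + x₅ ^ 2 + 1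

def xiLong2 (x₁ x₂ x₄ x₅ : ℝ) : ℝ :=
  (x₁ * x₅ + x₄) ^ 2 + x₁ ^ 2 + x₂ ^ 2 + 1

def zetaLong1 (x₁ x₂ x₄ x₅ : ℝ) : ℝ :=
  -(x₁ * x₅ ^ 2 + x₂ * x₄ + x₄ * x₅ + x₁)

def zetaLong2 (x₁ x₂ x₄ x₅ : ℝ) : ℝ :=
  x₁ ^ 3 * x₄ * x₅ ^ 2 + 2 * x₁ ^ 2 * x₄ ^ 2 * x₅ - x₁ ^ 2 * x₂ * x₅ ^ 2 + x₁ ^ 3 * x₄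
    + x₁ * x₄ ^ 3 - x₁ ^ 2 * x₂ + x₂ * x₄ ^ 2 - x₂ ^ 2 * x₅ + 2 * x₁ * x₄ - x₅

/-- The open quadrant `ℝ₊²` over which `y = (y₁, y₂)` is integrated. -/
def posQuadrant : Set (ℝ × ℝ) := Ioi 0 ×ˢ Ioi 0

/-- The arithmetic transform `𝒥_{αβα,F}(A)`; here `x = (x₁, x₂, x₄)`. -/
def JABA (F : ℝ → ℝ → ℂ) (A : ℝ) : ℂ :=
  ((A ^ 4)⁻¹ : ℝ) * ∫ y in posQuadrant, ∫ x : ℝ × ℝ × ℝ,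
    e (A * zetaABA1 x.1 x.2.1 x.2.2 / (xiABA2 x.1 x.2.1 x.2.2 * y.1 * y.2))
    * e (zetaABA2 x.1 x.2.1 x.2.2 * y.2 / xiABA1 x.1 x.2.1 x.2.2)
    * e (-(A * x.1 * y.1))
    * F (A * √(xiABA1 x.1 x.2.1 x.2.2) / (xiABA2 x.1 x.2.1 x.2.2 * y.1 * y.2))
        (xiABA2 x.1 x.2.1 x.2.2 * y.2 / xiABA1 x.1 x.2.1 x.2.2)
    * conj (F (A * y.1) y.2)
    * ((1 / (y.1 * y.2 ^ 2) : ℝ) : ℂ)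

/-- The arithmetic transform `𝒥_{βαβ,F}(A)`; here `x = (x₂, x₄, x₅)`. -/
def JBAB (F : ℝ → ℝ → ℂ) (A : ℝ) : ℂ :=
  ((A ^ 3)⁻¹ : ℝ) * ∫ y in posQuadrant, ∫ x : ℝ × ℝ × ℝ,
    e (zetaBAB1 x.1 x.2.1 x.2.2 * y.1 / xiBAB1 x.1 x.2.1 x.2.2)
    * e (zetaBAB2 x.1 x.2.1 x.2.2 / (xiBAB2 x.1 x.2.1 x.2.2 * y.1 ^ 2 * y.2))
    * e (-(A * x.2.2 * y.2))
    * F (√(xiBAB2 x.1 x.2.1 x.2.2) * y.1 / xiBAB1 x.1 x.2.1 x.2.2)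
        (xiBAB1 x.1 x.2.1 x.2.2 / (xiBAB2 x.1 x.2.1 x.2.2 * y.1 ^ 2 * y.2))
    * conj (F y.1 (A * y.2))
    * ((1 / (y.1 ^ 2 * y.2) : ℝ) : ℂ)

/-- The arithmetic transform `𝒥_{w₀,F}(A₁, A₂)`; here `x = (x₁, x₂, x₄, x₅)`. -/
def JLong (F : ℝ → ℝ → ℂ) (A₁ A₂ : ℝ) : ℂ :=
  ((A₁ ^ 4 * A₂ ^ 3)⁻¹ : ℝ) * ∫ y in posQuadrant, ∫ x : ℝ × ℝ × ℝ × ℝ,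
    e (A₁ * zetaLong1 x.1 x.2.1 x.2.2.1 x.2.2.2
        / (xiLong2 x.1 x.2.1 x.2.2.1 x.2.2.2 * y.1))
    * e (A₂ * zetaLong2 x.1 x.2.1 x.2.2.1 x.2.2.2
        / (xiLong1 x.1 x.2.1 x.2.2.1 x.2.2.2 * y.2))
    * e (-(A₁ * x.1 * y.1) - A₂ * x.2.2.2 * y.2)
    * F (A₁ * √(xiLong1 x.1 x.2.1 x.2.2.1 x.2.2.2)
          / (xiLong2 x.1 x.2.1 x.2.2.1 x.2.2.2 * y.1))
        (A₂ * xiLong2 x.1 x.2.1 x.2.2.1 x.2.2.2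
          / (xiLong1 x.1 x.2.1 x.2.2.1 x.2.2.2 * y.2))
    * conj (F (A₁ * y.1) (A₂ * y.2))
    * ((1 / (y.1 * y.2) : ℝ) : ℂ)

/-- The normalising factor `ℛ = R₁R₂(R₁+R₂)(R₂-R₁+1)`. -/
def calR (R₁ R₂ : ℝ) : ℝ := R₁ * R₂ * (R₁ + R₂) * (R₂ - R₁ + 1)

/-- The test function
`F(y₁,y₂) = ℛ^{1/2} f(X₁y₁) f(X₂y₂) y₁^{i(τ₁+τ₂)} y₂^{iτ₂}`. -/
def testF (f : ℝ → ℝ) (τ₁ τ₂ X₁ X₂ R₁ R₂ : ℝ) (y₁ y₂ : ℝ) : ℂ :=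
  (√(calR R₁ R₂) : ℂ) * (f (X₁ * y₁) : ℂ) * (f (X₂ * y₂) : ℂ)
    * (y₁ : ℂ) ^ (Complex.I * ((τ₁ + τ₂ : ℝ) : ℂ)) * (y₂ : ℂ) ^ (Complex.I * (τ₂ : ℂ))

end GSp4

end

noncomputable section

namespace GSp4

open scoped ENNReal

/-! ### Fourier decay in one variable -/

/-! In each transform one variable `y` is singled out: `y₁` for αβα, `y₂` for βαβ, and each of the
two in turn for w₀. Once `testF` is inserted, the integrand takes the form `w(p) e(a/y + b y) f(X y)
f(c/y) / y` times `exp(i(τ₁(r - 2σ log y) + τ₂(s - 2 log y)))`, where `p` collects the other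
variables and `σ` is 0 or 1. `PhaseData` records this shape. Two estimates compete.

Decay (`PhaseData.exists_norm_integral_le_decay`): `g` is supported in the positive half-line and
away from 0, so `log y` carries a frequency `2(στ₁ + τ₂)` of size at least a constant times `R₂`.
The phase `a/y + b y` oscillates in `log y` only at scale `Y`. Integrating by parts `N` times gains
`((1 + Y)/R₂)^N`, against a trivial loss of `R₁R₂`.

Localisation (`PhaseData.exists_norm_integral_le_localised`): integrating over `τ` first
concentrates `r - 2σ log y` and `s - 2 log y` near 0 at scales `1/R₁` and `1/R₂`. The `y`-integral
uses up the second condition, and what remains is the concentration of `r - σs` at scale `1/R₁`.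
Nothing decays, but the factor `R₁R₂` disappears.

`exists_interpolation_exponent` merges the two: either some `(1 + Y)/R₂` is a negative power of `R₂`
and many integrations by parts win, or the required powers of it cost at most `R₂^ε`.

It remains to measure the set of `x` allowed by the supports of the bumps. For αβα and βαβ the
kernel in `r - σs` is replaced by `R₁^η |r - σs|^(-(1-η))`, and this singular weight is compared
with one in a polynomial of `x₂`. For αβα the polynomial is `ξ₂ - ξ₁`, affine in `x₂`; for βαβ it is
`ξ₂ - ξ₁²`, a quadratic with explicit roots (`lintegral_singWeight_ABA_le`,
`lintegral_singWeight_BAB_le`). For w₀ the remaining kernel still involves `log y₁`, so the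
`y₁`-integral absorbs it and only the volume of a region matters, which the shear `d = x₁x₄ - x₂`
makes accessible (`volume_longRegion_le`). Counting powers then gives `X₁⁴X₂³` times `A⁴`, `A^(3/2)`
and `A₁⁴A₂³` respectively, to be set against the normalisations `A⁻⁴`, `A⁻³` and `A₁⁻⁴A₂⁻³`. -/

lemma integral_Ioi_eq_integral_comp_exp (φ : ℝ → ℂ) :
    ∫ y in Ioi (0 : ℝ), φ y * ((1 / y : ℝ) : ℂ) = ∫ t : ℝ, φ (Real.exp t) := by
  have h := integral_image_eq_integral_abs_deriv_smul (s := univ) (f := Real.exp) (f' := Real.exp)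
    MeasurableSet.univ (fun x _ => (Real.hasDerivAt_exp x).hasDerivWithinAt)
    Real.exp_injective.injOn (fun y => φ y * ((1 / y : ℝ) : ℂ))
  rw [image_univ, Real.range_exp] at h
  rw [h, setIntegral_univ]
  refine integral_congr_ae (Filter.Eventually.of_forall fun t => ?_)
  have := Real.exp_pos t
  simp only [abs_of_pos this, one_div, Complex.real_smul, Complex.ofReal_inv]
  have h0 : (Real.exp t : ℂ) ≠ 0 := by exact_mod_cast this.ne'
  field_simp

lemma lintegral_Ioi_eq_lintegral_comp_exp (φ : ℝ → ℝ≥0∞) :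
    ∫⁻ y in Ioi (0 : ℝ), φ y * ENNReal.ofReal (1 / y) = ∫⁻ t : ℝ, φ (Real.exp t) := by
  have h := lintegral_image_eq_lintegral_abs_deriv_mul (s := univ) (f := Real.exp)
    (f' := Real.exp) MeasurableSet.univ (fun x _ => (Real.hasDerivAt_exp x).hasDerivWithinAt)
    Real.exp_injective.injOn (fun y => φ y * ENNReal.ofReal (1 / y))
  rw [image_univ, Real.range_exp] at h
  rw [h, setLIntegral_univ]
  refine lintegral_congr fun t => ?_
  have := Real.exp_pos t
  rw [abs_of_pos this, mul_comm, mul_assoc, ← ENNReal.ofReal_mul (by positivity)]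
  simp

lemma norm_cexp_I_mul (x : ℝ) : ‖Complex.exp (Complex.I * x)‖ = 1 := by
  rw [mul_comm]; exact Complex.norm_exp_ofReal_mul_I x

lemma integral_mul_cexp_deriv {h : ℝ → ℂ} (hh : ContDiff ℝ ∞ h) (hc : HasCompactSupport h)
    (l : ℝ) :
    (Complex.I * l) * ∫ t, h t * Complex.exp (Complex.I * ((l * t : ℝ) : ℂ))
      = - ∫ t, deriv h t * Complex.exp (Complex.I * ((l * t : ℝ) : ℂ)) := by
  have hE : ∀ t : ℝ, HasDerivAt (fun t : ℝ => Complex.exp (Complex.I * ((l * t : ℝ) : ℂ)))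
      ((Complex.I * l) * Complex.exp (Complex.I * ((l * t : ℝ) : ℂ))) t := by
    intro t
    have h1 : HasDerivAt (fun t : ℝ => Complex.I * ((l * t : ℝ) : ℂ)) (Complex.I * l) t := by
      have := ((hasDerivAt_id t).const_mul l).ofReal_comp.const_mul Complex.I
      simpa using this
    simpa [mul_comm] using h1.cexp
  have hEc : Continuous fun t : ℝ => Complex.exp (Complex.I * ((l * t : ℝ) : ℂ)) := by fun_prop
  have hd : Continuous (deriv h) := hh.continuous_deriv (by simp)
  have key := integral_mul_deriv_eq_deriv_mul_of_integrable (u := h) (u' := deriv h)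
    (v := fun t : ℝ => Complex.exp (Complex.I * ((l * t : ℝ) : ℂ)))
    (v' := fun t : ℝ => (Complex.I * l) * Complex.exp (Complex.I * ((l * t : ℝ) : ℂ)))
    (fun x _ => (hh.differentiable (by simp) x).hasDerivAt) (fun x _ => hE x)
    ((hh.continuous.mul (by fun_prop)).integrable_of_hasCompactSupport hc.mul_right)
    ((hd.mul hEc).integrable_of_hasCompactSupport hc.deriv.mul_right)
    ((hh.continuous.mul hEc).integrable_of_hasCompactSupport hc.mul_right)
  rw [← key, ← integral_const_mul]
  congr 1; ext t; ring

/-- Repeated integration by parts. -/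
lemma pow_mul_norm_integral_mul_cexp_le (N : ℕ) {h : ℝ → ℂ} (hh : ContDiff ℝ ∞ h)
    (hc : HasCompactSupport h) (l : ℝ) :
    |l| ^ N * ‖∫ t, h t * Complex.exp (Complex.I * ((l * t : ℝ) : ℂ))‖
      ≤ ∫ t, ‖iteratedDeriv N h t‖ := by
  induction N generalizing h with
  | zero =>
    simp only [pow_zero, one_mul, iteratedDeriv_zero]
    refine (norm_integral_le_integral_norm _).trans (le_of_eq ?_)
    congr 1; ext t
    rw [norm_mul, norm_cexp_I_mul, mul_one]
  | succ N ih =>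
    have hd : ContDiff ℝ ∞ (deriv h) := (contDiff_infty_iff_deriv.1 hh).2
    have h1 := ih hd hc.deriv
    rw [iteratedDeriv_succ']
    refine le_trans (le_of_eq ?_) h1
    have h2 := congrArg norm (integral_mul_cexp_deriv hh hc l)
    rw [norm_neg, norm_mul] at h2
    rw [← h2]
    simp [pow_succ, mul_assoc]

lemma exists_bound_iteratedDeriv {h : ℝ → ℂ} (hh : ContDiff ℝ ∞ h)
    (hc : HasCompactSupport h) (N : ℕ) :
    ∃ B : ℝ, 0 ≤ B ∧ ∀ n ≤ N, ∀ t, ‖iteratedDeriv n h t‖ ≤ B := by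
  have h1 : ∀ n : ℕ, ∃ B : ℝ, ∀ t, ‖iteratedDeriv n h t‖ ≤ B := by
    intro n
    obtain ⟨B, hB⟩ := (hc.iteratedFDeriv (𝕜 := ℝ) n).exists_bound_of_continuous
      (hh.continuous_iteratedFDeriv (m := n) (by exact_mod_cast le_top))
    refine ⟨B, fun t => ?_⟩
    rw [← norm_iteratedFDeriv_eq_norm_iteratedDeriv]; exact hB t
  choose B hB using h1
  refine ⟨∑ n ∈ Finset.range (N + 1), |B n|, by positivity, fun n hn t => ?_⟩
  refine (hB n t).trans ((le_abs_self _).trans ?_)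
  exact Finset.single_le_sum (f := fun n => |B n|) (fun i _ => abs_nonneg _)
    (Finset.mem_range.2 (by omega))

/-- Uniform decay of the Fourier integral of a dilated bump at scale `R`. -/
lemma exists_norm_integral_dilate_le {g : ℝ → ℝ} (hg : ContDiff ℝ ∞ g)
    (hgc : HasCompactSupport g) :
    ∃ C : ℝ, 0 ≤ C ∧ ∀ R v : ℝ, 0 < R →
      ‖∫ τ : ℝ, (g (τ / R) : ℂ) * Complex.exp (Complex.I * ((τ * v : ℝ) : ℂ))‖
        ≤ C * (R / (1 + R * |v|) ^ 4) := by
  set G : ℝ → ℂ := fun t => (g t : ℂ)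
  have hG : ContDiff ℝ ∞ G := Complex.ofRealCLM.contDiff.comp hg
  have hGc : HasCompactSupport G := hgc.comp_left (g := fun x : ℝ => (x : ℂ)) (by simp)
  refine ⟨8 * ((∫ t, ‖iteratedDeriv 0 G t‖) + ∫ t, ‖iteratedDeriv 4 G t‖), by positivity,
    fun R v hR => ?_⟩
  have h0 := pow_mul_norm_integral_mul_cexp_le 0 hG hGc (R * v)
  have h4 := pow_mul_norm_integral_mul_cexp_le 4 hG hGc (R * v)
  have hs : ∫ τ : ℝ, (g (τ / R) : ℂ) * Complex.exp (Complex.I * ((τ * v : ℝ) : ℂ))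
      = |R| • ∫ t, G t * Complex.exp (Complex.I * ((R * v * t : ℝ) : ℂ)) := by
    rw [← Measure.integral_comp_div
      (fun t => G t * Complex.exp (Complex.I * ((R * v * t : ℝ) : ℂ)))]
    congr 1; ext τ
    congr 4
    field_simp
  rw [hs, norm_smul, Real.norm_eq_abs, abs_abs, abs_of_pos hR]
  set I := ‖∫ t, G t * Complex.exp (Complex.I * ((R * v * t : ℝ) : ℂ))‖
  rw [abs_mul, abs_of_pos hR] at h0 h4
  set u := R * |v|
  have hu : 0 ≤ u := by positivity
  rw [← mul_div_assoc, le_div_iff₀ (by positivity)]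
  have hI : 0 ≤ I := norm_nonneg _
  -- Convexity of the fourth power. It merges the bounds for `N = 0` (small `u`) and `N = 4` (large
  -- `u`).
  have : (1 + u) ^ 4 ≤ 8 * (1 + u ^ 4) := by
    nlinarith [sq_nonneg (u - 1), sq_nonneg (u ^ 2 - 1), sq_nonneg (u ^ 2 - u),
      mul_nonneg hu (sq_nonneg (u - 1))]
  calc R * I * (1 + u) ^ 4 ≤ R * I * (8 * (1 + u ^ 4)) := by gcongr
    _ = R * (8 * (u ^ 0 * I + u ^ 4 * I)) := by ring
    _ ≤ R * (8 * ((∫ t, ‖iteratedDeriv 0 G t‖) + ∫ t, ‖iteratedDeriv 4 G t‖)) := by gcongr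
    _ = _ := by ring

lemma iteratedDeriv_mul_exp_neg_add_mul_exp (n : ℕ) (a b : ℝ) :
    iteratedDeriv n (fun s => a * Real.exp (-s) + b * Real.exp s)
      = fun s => (-1) ^ n * a * Real.exp (-s) + b * Real.exp s := by
  induction n with
  | zero => simp
  | succ n ih =>
    rw [iteratedDeriv_succ, ih]
    ext s
    have h1 : HasDerivAt (fun s => (-1) ^ n * a * Real.exp (-s) + b * Real.exp s)
        ((-1) ^ n * a * (Real.exp (-s) * (-1)) + b * Real.exp s) s :=
      (((hasDerivAt_neg s).exp).const_mul _).add ((Real.hasDerivAt_exp s).const_mul _)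
    rw [h1.deriv]; ring

lemma norm_iteratedFDeriv_cexp_I_mul (n : ℕ) (r : ℝ) :
    ‖iteratedFDeriv ℝ n (fun r : ℝ => Complex.exp (Complex.I * r)) r‖ = 1 := by
  rw [norm_iteratedFDeriv_eq_norm_iteratedDeriv]
  have : iteratedDeriv n (fun r : ℝ => Complex.exp (Complex.I * r))
      = fun r : ℝ => Complex.I ^ n * Complex.exp (Complex.I * r) := by
    induction n with
    | zero => simp
    | succ n ih =>
      rw [iteratedDeriv_succ, ih]
      ext s
      have h1 : HasDerivAt (fun s : ℝ => Complex.exp (Complex.I * s))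
          (Complex.exp (Complex.I * s) * (Complex.I * 1)) s :=
        (((hasDerivAt_id s).ofReal_comp).const_mul Complex.I).cexp
      rw [(h1.const_mul _).deriv]; ring
  rw [this, norm_mul, norm_cexp_I_mul]; simp

/-- Faà di Bruno in the form `norm_iteratedFDeriv_comp_le`. Every derivative of the inner phase on
`[0, 1]` is at most `28 (1 + Y)`, since `2π ≤ 7`, `exp(-s) ≤ 1` and `exp s ≤ 3`; as this base
exceeds 1, its powers bound the derivatives of each order. -/
lemma norm_iteratedFDeriv_cexp_phase_le (n : ℕ) {a b Y s : ℝ} (ha : |a| ≤ Y) (hb : |b| ≤ Y)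
    (hs : s ∈ Icc (0 : ℝ) 1) :
    ‖iteratedFDeriv ℝ n (fun s : ℝ => Complex.exp
      (Complex.I * ((2 * Real.pi * a * Real.exp (-s) + 2 * Real.pi * b * Real.exp s : ℝ) : ℂ))) s‖
      ≤ n.factorial * 1 * (28 * (1 + Y)) ^ n := by
  have hY : 0 ≤ Y := (abs_nonneg _).trans ha
  refine norm_iteratedFDeriv_comp_le (N := n)
    (g := fun r : ℝ => Complex.exp (Complex.I * r))
    (f := fun s => 2 * Real.pi * a * Real.exp (-s) + 2 * Real.pi * b * Real.exp s)
    ?_ (by fun_prop) le_rfl s (fun i _ => (norm_iteratedFDeriv_cexp_I_mul i _).le) ?_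
  · exact (contDiff_const.mul Complex.ofRealCLM.contDiff).cexp
  · intro i hi _
    rw [norm_iteratedFDeriv_eq_norm_iteratedDeriv, iteratedDeriv_mul_exp_neg_add_mul_exp]
    have h1 : Real.exp (-s) ≤ 1 := Real.exp_le_one_iff.2 (by linarith [hs.1])
    have h2 : Real.exp s ≤ 3 :=
      (Real.exp_le_exp.2 hs.2).trans (by linarith [Real.exp_one_lt_d9])
    have hpi : 2 * Real.pi ≤ 7 := by linarith [Real.pi_lt_d2]
    calc ‖(-1) ^ i * (2 * Real.pi * a) * Real.exp (-s) + 2 * Real.pi * b * Real.exp s‖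
        ≤ 2 * Real.pi * |a| * Real.exp (-s) + 2 * Real.pi * |b| * Real.exp s := by
          refine (norm_add_le _ _).trans (le_of_eq ?_)
          simp only [norm_mul, norm_pow, norm_neg, norm_one, one_pow, Real.norm_eq_abs,
            abs_of_pos Real.pi_pos, abs_of_pos (Real.exp_pos _), abs_two, one_mul]
      _ ≤ 7 * Y * 1 + 7 * Y * 3 := by gcongr
      _ ≤ 28 * (1 + Y) := by linarith
      _ ≤ (28 * (1 + Y)) ^ i := le_self_pow₀ (by linarith) (by omega)

lemma contDiff_comp_exp_ofReal {f : ℝ → ℝ} (hf : ContDiff ℝ ∞ f) :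
    ContDiff ℝ ∞ fun t : ℝ => (f (Real.exp t) : ℂ) :=
  Complex.ofRealCLM.contDiff.comp (hf.comp Real.contDiff_exp)

lemma support_comp_exp_subset {f : ℝ → ℝ} (hfs : Function.support f ⊆ Icc 1 2) :
    Function.support (fun t : ℝ => (f (Real.exp t) : ℂ)) ⊆ Icc 0 1 := by
  intro t ht
  have h1 : f (Real.exp t) ≠ 0 := by simpa using ht
  obtain ⟨h2, h3⟩ := hfs h1
  refine ⟨by simpa using h2, ?_⟩
  have : Real.exp t ≤ Real.exp 1 := h3.trans (by linarith [Real.exp_one_gt_d9])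
  exact Real.exp_le_exp.1 this

lemma hasCompactSupport_comp_exp {f : ℝ → ℝ} (hfs : Function.support f ⊆ Icc 1 2) :
    HasCompactSupport fun t : ℝ => (f (Real.exp t) : ℂ) :=
  HasCompactSupport.of_support_subset_isCompact isCompact_Icc (support_comp_exp_subset hfs)

/-- Decay of the Fourier integral of a bump against the phase `a e^{-s} + b e^s`. -/
lemma exists_norm_integral_phase_le {f : ℝ → ℝ} (hf : ContDiff ℝ ∞ f)
    (hfs : Function.support f ⊆ Icc 1 2) (N : ℕ) :
    ∃ C : ℝ, 0 ≤ C ∧ ∀ a b c l Y : ℝ, |a| ≤ Y → |b| ≤ Y → l ≠ 0 →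
      ‖∫ s : ℝ, (Complex.exp
          (Complex.I * ((2 * Real.pi * a * Real.exp (-s) + 2 * Real.pi * b * Real.exp s : ℝ) : ℂ))
          * ((f (Real.exp s) : ℂ) * (f (Real.exp (c - s)) : ℂ)))
          * Complex.exp (Complex.I * ((l * s : ℝ) : ℂ))‖
        ≤ C * ((1 + Y) / |l|) ^ N := by
  set F : ℝ → ℂ := fun t => (f (Real.exp t) : ℂ) with hFdef
  have hF : ContDiff ℝ ∞ F := contDiff_comp_exp_ofReal hf
  have hFc : HasCompactSupport F := hasCompactSupport_comp_exp hfs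
  obtain ⟨B, hB0, hB⟩ := exists_bound_iteratedDeriv hF hFc N
  -- The Leibniz rule applied twice. The same `B` bounds the derivatives of both bumps, since `s ↦ c
  -- - s` changes them only by a sign and a translation; hence `D` does not depend on `c`.
  set D : ℝ := ∑ i ∈ Finset.range (N + 1), (N.choose i : ℝ) * (i.factorial * 28 ^ i)
    * ∑ j ∈ Finset.range (N - i + 1), ((N - i).choose j : ℝ) * B * B with hD
  refine ⟨D, by positivity, fun a b c l Y ha hb hl => ?_⟩
  have hY : 0 ≤ Y := (abs_nonneg _).trans ha
  set ph : ℝ → ℂ := fun s => Complex.exp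
      (Complex.I * ((2 * Real.pi * a * Real.exp (-s) + 2 * Real.pi * b * Real.exp s : ℝ) : ℂ))
    with hph
  have hphs : ContDiff ℝ ∞ ph := by
    have h0 : ContDiff ℝ ∞ fun s : ℝ =>
        2 * Real.pi * a * Real.exp (-s) + 2 * Real.pi * b * Real.exp s := by fun_prop
    exact (contDiff_const.mul (Complex.ofRealCLM.contDiff.comp h0)).cexp
  set G : ℝ → ℂ := fun s => F (c - s) with hG
  have hGs : ContDiff ℝ ∞ G := hF.comp (by fun_prop)
  set h : ℝ → ℂ := fun s => ph s * (F s * G s) with hh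
  have hhs : ContDiff ℝ ∞ h := hphs.mul (hF.mul hGs)
  have hsupp : Function.support h ⊆ Icc 0 1 := fun s hs =>
    support_comp_exp_subset hfs (left_ne_zero_of_mul (right_ne_zero_of_mul hs))
  have htsupp : tsupport h ⊆ Icc 0 1 := closure_minimal hsupp isClosed_Icc
  have hhc : HasCompactSupport h := HasCompactSupport.of_support_subset_isCompact
    isCompact_Icc hsupp
  have hGB : ∀ n ≤ N, ∀ s, ‖iteratedFDeriv ℝ n G s‖ ≤ B := by
    intro n hn s
    rw [norm_iteratedFDeriv_eq_norm_iteratedDeriv, hG, iteratedDeriv_comp_const_sub]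
    simpa [norm_smul] using hB n hn (c - s)
  have hFB : ∀ n ≤ N, ∀ s, ‖iteratedFDeriv ℝ n F s‖ ≤ B := by
    intro n hn s
    rw [norm_iteratedFDeriv_eq_norm_iteratedDeriv]
    exact hB n hn s
  have hFG : ∀ n ≤ N, ∀ s, ‖iteratedFDeriv ℝ n (fun s => F s * G s) s‖
      ≤ ∑ j ∈ Finset.range (n + 1), (n.choose j : ℝ) * B * B := by
    intro n hn s
    refine (norm_iteratedFDeriv_mul_le hF hGs s (by exact_mod_cast le_top)).trans ?_
    refine Finset.sum_le_sum fun j hj => ?_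
    have hj' := Finset.mem_range.1 hj
    gcongr
    · exact hFB j (by omega) s
    · exact hGB (n - j) (by omega) s
  have hder : ∀ s ∈ Icc (0 : ℝ) 1, ‖iteratedDeriv N h s‖ ≤ D * (1 + Y) ^ N := by
    intro s hs
    rw [← norm_iteratedFDeriv_eq_norm_iteratedDeriv]
    refine (norm_iteratedFDeriv_mul_le hphs (hF.mul hGs) s (by exact_mod_cast le_top)).trans ?_
    rw [hD, Finset.sum_mul]
    refine Finset.sum_le_sum fun i hi => ?_
    have hi' := Finset.mem_range.1 hi
    have e1 := norm_iteratedFDeriv_cexp_phase_le i ha hb hs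
    have e2 := hFG (N - i) (by omega) s
    calc (N.choose i : ℝ) * ‖iteratedFDeriv ℝ i ph s‖
          * ‖iteratedFDeriv ℝ (N - i) (fun s => F s * G s) s‖
        ≤ (N.choose i : ℝ) * (i.factorial * 1 * (28 * (1 + Y)) ^ i)
          * ∑ j ∈ Finset.range (N - i + 1), ((N - i).choose j : ℝ) * B * B := by gcongr
      _ = ((N.choose i : ℝ) * (i.factorial * 28 ^ i)
          * ∑ j ∈ Finset.range (N - i + 1), ((N - i).choose j : ℝ) * B * B) * (1 + Y) ^ i := by
          rw [mul_pow]; ring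
      _ ≤ _ := by
          gcongr
          · linarith
          · omega
  have hint : ∫ s, ‖iteratedDeriv N h s‖ ≤ D * (1 + Y) ^ N := by
    have h0 : ∀ s, s ∉ Icc (0 : ℝ) 1 → ‖iteratedDeriv N h s‖ = 0 := by
      intro s hs
      rw [← norm_iteratedFDeriv_eq_norm_iteratedDeriv]
      by_contra hne
      exact hs (htsupp (support_iteratedFDeriv_subset N (𝕜 := ℝ) (norm_ne_zero_iff.1 hne)))
    rw [← setIntegral_eq_integral_of_forall_compl_eq_zero h0]
    have := norm_setIntegral_le_of_norm_le_const (μ := volume) (s := Icc (0 : ℝ) 1)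
      (f := fun s => ‖iteratedDeriv N h s‖) (C := D * (1 + Y) ^ N) (by simp)
      (fun s hs => by simpa using hder s hs)
    refine (le_abs_self _).trans (this.trans (le_of_eq ?_))
    simp
  have key := (pow_mul_norm_integral_mul_cexp_le N hhs hhc l).trans hint
  rw [div_pow, ← mul_div_assoc, le_div_iff₀ (by positivity), mul_comm]
  exact key

/-- The integral in the inner variable decays when the frequency exceeds the phase. -/
lemma exists_norm_integral_Ioi_phase_le {f : ℝ → ℝ} (hf : ContDiff ℝ ∞ f)
    (hfs : Function.support f ⊆ Icc 1 2) (N : ℕ) :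
    ∃ C : ℝ, 0 ≤ C ∧ ∀ X a b c l Y : ℝ, 0 < X → |a| * X ≤ Y → |b| ≤ Y * X → l ≠ 0 →
      ‖∫ y in Ioi (0 : ℝ), (e (a / y + b * y) * f (X * y) * f (c / y)
          * Complex.exp (Complex.I * ((l * Real.log y : ℝ) : ℂ))) * ((1 / y : ℝ) : ℂ)‖
        ≤ C * ((1 + Y) / |l|) ^ N := by
  obtain ⟨C, hC0, hC⟩ := exists_norm_integral_phase_le hf hfs N
  refine ⟨C, hC0, fun X a b c l Y hX ha hb hl => ?_⟩
  have hY : 0 ≤ Y := (by positivity : 0 ≤ |a| * X).trans ha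
  have hXne := hX.ne'
  -- The substitution `y = exp(s)/X` fixes the position of the first bump, replaces `a`, `b` by
  -- `aX`, `b/X`, and turns `dy/y` into `ds`.
  rw [integral_Ioi_eq_integral_comp_exp, ← integral_sub_right_eq_self _ (Real.log X)]
  have hex : ∀ s, Real.exp (s - Real.log X) = Real.exp s / X := by
    intro s; rw [Real.exp_sub, Real.exp_log hX]
  simp only [hex, Real.log_div (Real.exp_ne_zero _) hX.ne', Real.log_exp]
  -- For `c ≤ 0` the argument of the second bump is never in `[1, 2]`. For `c > 0` that bump is the
  -- first one reflected and shifted by `log (cX)`.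
  rcases le_or_gt c 0 with hc | hc
  · have : ∀ s, f (c / (Real.exp s / X)) = 0 := by
      intro s
      by_contra hne
      have h1 := (hfs hne).1
      have : c / (Real.exp s / X) ≤ 0 := div_nonpos_of_nonpos_of_nonneg hc (by positivity)
      linarith
    simp only [this]
    simp; positivity
  · have key := hC (a * X) (b / X) (Real.log (c * X)) l Y
      (by rwa [abs_mul, abs_of_pos hX])
      (by rw [abs_div, abs_of_pos hX]; exact (div_le_iff₀ hX).2 hb) hl
    refine le_trans (le_of_eq ?_) key
    rw [← one_mul ‖∫ s : ℝ, Complex.exp _ * _ * _‖,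
      ← norm_cexp_I_mul (-(l * Real.log X)), ← norm_mul, ← integral_const_mul]
    congr 2
    ext s
    have e1 : Real.exp (Real.log (c * X) - s) = c / (Real.exp s / X) := by
      rw [Real.exp_sub, Real.exp_log (by positivity)]; field_simp
    have e2 : X * (Real.exp s / X) = Real.exp s := by field_simp
    have e3 : Complex.exp (Complex.I * ((l * (s - Real.log X) : ℝ) : ℂ))
        = Complex.exp (Complex.I * ((-(l * Real.log X) : ℝ) : ℂ))
          * Complex.exp (Complex.I * ((l * s : ℝ) : ℂ)) := by
      rw [← Complex.exp_add]; congr 1; push_cast; ring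
    have e4 : e (a / (Real.exp s / X) + b * (Real.exp s / X))
        = Complex.exp (Complex.I * ((2 * Real.pi * (a * X) * Real.exp (-s)
          + 2 * Real.pi * (b / X) * Real.exp s : ℝ) : ℂ)) := by
      rw [e, Real.exp_neg]; congr 1; push_cast; field_simp
    rw [e1, e2, e3, e4]; ring

/-! ### Integrals with one distinguished oscillating variable -/

@[fun_prop]
lemma continuous_e : Continuous e := by unfold e; fun_prop

@[fun_prop]
lemma measurable_e : Measurable e := continuous_e.measurable

lemma norm_e (x : ℝ) : ‖e x‖ = 1 := by
  rw [e, ← norm_cexp_I_mul (2 * Real.pi * x)]; congr 2; push_cast; ring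

lemma e_add (x y : ℝ) : e (x + y) = e x * e y := by
  rw [e, e, e, ← Complex.exp_add]; congr 1; push_cast; ring

/-- The data of an integrand `w(p) e(a/y + b y) f(X y) f(c/y) exp(i(τ₁(r - 2σ log y) + τ₂(s - 2 log y)))`
in the distinguished variable `y > 0` and the remaining variables `p`. -/
structure PhaseData (P : Type) [MeasurableSpace P] where
  w : P → ℂ
  a : P → ℝ
  b : P → ℝ
  c : P → ℝ
  r : P → ℝ
  s : P → ℝ
  X : ℝ
  σ : ℝ
  measurable_w : Measurable w
  measurable_a : Measurable a
  measurable_b : Measurable b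
  measurable_c : Measurable c
  measurable_r : Measurable r
  measurable_s : Measurable s
  X_pos : 0 < X
  σ_nonneg : 0 ≤ σ
  σ_le_one : σ ≤ 1

namespace PhaseData

variable {P : Type} [MeasurableSpace P]

/-- The factor independent of `τ`. -/
def amplitude (D : PhaseData P) (f : ℝ → ℝ) (q : P × ℝ) : ℂ :=
  D.w q.1 * (e (D.a q.1 / q.2 + D.b q.1 * q.2) * f (D.X * q.2) * f (D.c q.1 / q.2)
    * ((1 / q.2 : ℝ) : ℂ))

/-- The factor depending on `τ`. -/
def twist (D : PhaseData P) (τ : ℝ × ℝ) (q : P × ℝ) : ℂ :=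
  Complex.exp (Complex.I * ((τ.1 * (D.r q.1 - 2 * D.σ * Real.log q.2)
    + τ.2 * (D.s q.1 - 2 * Real.log q.2) : ℝ) : ℂ))

lemma norm_twist (D : PhaseData P) (τ : ℝ × ℝ) (q : P × ℝ) : ‖D.twist τ q‖ = 1 :=
  norm_cexp_I_mul _

lemma measurable_amplitude (D : PhaseData P) {f : ℝ → ℝ} (hf : Measurable f) :
    Measurable (D.amplitude f) := by
  have := D.measurable_w
  have := D.measurable_a
  have := D.measurable_b
  have := D.measurable_c
  unfold amplitude
  fun_prop

lemma measurable_twist (D : PhaseData P) :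
    Measurable fun z : (ℝ × ℝ) × (P × ℝ) => D.twist z.1 z.2 := by
  have := D.measurable_r
  have := D.measurable_s
  unfold twist
  fun_prop

/-- On the support of `f(X y)` one has `1/y ≤ X`. The majorant is a product of a function of `p` and
a bounded, compactly supported function of `y`, so integrability of `w` alone gives integrability of
the whole integrand. -/
lemma norm_amplitude_le (D : PhaseData P) {f : ℝ → ℝ} (hf01 : ∀ x, f x ∈ Icc (0 : ℝ) 1)
    (hfs : Function.support f ⊆ Icc 1 2) (q : P × ℝ) :
    ‖D.amplitude f q‖ ≤ ‖D.w q.1‖ * (Icc (1 / D.X) (2 / D.X)).indicator (fun _ => D.X) q.2 := by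
  have hX := D.X_pos
  rw [amplitude, norm_mul]
  gcongr
  rw [norm_mul, norm_mul, norm_mul, norm_e, one_mul]
  by_cases h : D.X * q.2 ∈ Icc (1 : ℝ) 2
  · have h2 : 1 / D.X ≤ q.2 := by rw [div_le_iff₀ hX]; linarith [h.1]
    have h3 : q.2 ≤ 2 / D.X := by rw [le_div_iff₀ hX]; linarith [h.2]
    have hq : 0 < q.2 := lt_of_lt_of_le (by positivity) h2
    rw [indicator_of_mem (show q.2 ∈ Icc (1 / D.X) (2 / D.X) from ⟨h2, h3⟩)]
    have e1 : ‖(f (D.X * q.2) : ℂ)‖ ≤ 1 := by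
      rw [Complex.norm_real, Real.norm_eq_abs, abs_of_nonneg (hf01 _).1]; exact (hf01 _).2
    have e2 : ‖(f (D.c q.1 / q.2) : ℂ)‖ ≤ 1 := by
      rw [Complex.norm_real, Real.norm_eq_abs, abs_of_nonneg (hf01 _).1]; exact (hf01 _).2
    have e3 : ‖((1 / q.2 : ℝ) : ℂ)‖ ≤ D.X := by
      rw [Complex.norm_real, Real.norm_eq_abs, abs_of_pos (by positivity)]
      rw [div_le_iff₀ hq]; linarith [h.1]
    calc _ ≤ 1 * 1 * D.X := by gcongr
      _ = D.X := by ring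
  · have : f (D.X * q.2) = 0 := by
      by_contra hne; exact h (hfs hne)
    rw [this]
    simp only [Complex.ofReal_zero, norm_zero, zero_mul]
    exact indicator_nonneg (fun _ _ => hX.le) _

lemma integrable_amplitude (D : PhaseData P) {μ : Measure P} [SFinite μ] {f : ℝ → ℝ}
    (hf : Measurable f) (hf01 : ∀ x, f x ∈ Icc (0 : ℝ) 1)
    (hfs : Function.support f ⊆ Icc 1 2) (hw : Integrable D.w μ) :
    Integrable (D.amplitude f) (μ.prod (volume.restrict (Ioi 0))) := by
  have h1 : Integrable ((Icc (1 / D.X) (2 / D.X)).indicator (fun _ => D.X))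
      (volume.restrict (Ioi (0 : ℝ))) := by
    refine Integrable.mono_measure ?_ Measure.restrict_le_self
    rw [integrable_indicator_iff measurableSet_Icc]
    exact integrableOn_const (by simp)
  refine (hw.norm.mul_prod h1).mono' (D.measurable_amplitude hf).aestronglyMeasurable
    (Filter.Eventually.of_forall fun q => D.norm_amplitude_le hf01 hfs q)

lemma integrable_amplitude_mul_twist (D : PhaseData P) {μ : Measure P} [SFinite μ] {f : ℝ → ℝ}
    (hf : Measurable f) (hf01 : ∀ x, f x ∈ Icc (0 : ℝ) 1)
    (hfs : Function.support f ⊆ Icc 1 2) (hw : Integrable D.w μ) (τ : ℝ × ℝ) :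
    Integrable (fun q => D.amplitude f q * D.twist τ q) (μ.prod (volume.restrict (Ioi 0))) := by
  refine (D.integrable_amplitude hf hf01 hfs hw).mono ?_ ?_
  · exact ((D.measurable_amplitude hf).mul
      (D.measurable_twist.comp measurable_prodMk_left)).aestronglyMeasurable
  · exact Filter.Eventually.of_forall fun q => by rw [norm_mul, norm_twist, mul_one]

end PhaseData

/-- A compactly supported function with topological support in `(0, ∞)` vanishes below some
positive number. -/
lemma exists_pos_le_of_ne_zero {g : ℝ → ℝ} (hgc : HasCompactSupport g)
    (hgpos : tsupport g ⊆ Ioi 0) : ∃ δ : ℝ, 0 < δ ∧ ∀ x, g x ≠ 0 → δ ≤ x := by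
  rcases (tsupport g).eq_empty_or_nonempty with h | h
  · exact ⟨1, one_pos, fun x hx => absurd (subset_tsupport g hx) (by simp [h])⟩
  · obtain ⟨m, hm, hmin⟩ := hgc.isCompact.exists_isLeast h
    exact ⟨m, hgpos hm, fun x hx => hmin (subset_tsupport g hx)⟩

lemma integrable_dilate {g : ℝ → ℝ} (hg : Continuous g) (hgc : HasCompactSupport g) {R : ℝ}
    (hR : 0 < R) : Integrable fun τ : ℝ => g (τ / R) :=
  (hg.integrable_of_hasCompactSupport hgc).comp_div hR.ne'

lemma integral_norm_dilate (g : ℝ → ℝ) {R : ℝ} (hR : 0 < R) :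
    ∫ τ : ℝ, ‖g (τ / R)‖ = R * ∫ t, ‖g t‖ := by
  have := Measure.integral_comp_div (fun t => ‖g t‖) R
  rw [this, abs_of_pos hR, smul_eq_mul]

namespace PhaseData

/-- Repeated integration by parts in the distinguished variable. -/
lemma exists_norm_integral_le_decay {f : ℝ → ℝ} (hf : ContDiff ℝ ∞ f)
    (hf01 : ∀ x, f x ∈ Icc (0 : ℝ) 1) (hfs : Function.support f ⊆ Icc 1 2)
    {g : ℝ → ℝ} (hg : ContDiff ℝ ∞ g) (hgc : HasCompactSupport g) (hgpos : tsupport g ⊆ Ioi 0)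
    (N : ℕ) :
    ∃ C : ℝ, 0 ≤ C ∧ ∀ (P : Type) [MeasurableSpace P] (D : PhaseData P) (μ : Measure P)
      [SFinite μ] (R₁ R₂ Y : ℝ), 1 ≤ R₁ → 1 ≤ R₂ → 0 ≤ Y →
      (∀ p, D.w p ≠ 0 → |D.a p| * D.X ≤ Y ∧ |D.b p| ≤ Y * D.X) → Integrable D.w μ →
      ‖∫ τ : ℝ × ℝ, ((g (τ.1 / R₁) * g (τ.2 / R₂) : ℝ) : ℂ)
          * ∫ q, D.amplitude f q * D.twist τ q ∂(μ.prod (volume.restrict (Ioi 0)))‖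
        ≤ C * (R₁ * R₂ * ((1 + Y) / R₂) ^ N) * ∫ p, ‖D.w p‖ ∂μ := by
  obtain ⟨C, hC0, hC⟩ := exists_norm_integral_Ioi_phase_le hf hfs N
  obtain ⟨δ, hδ, hgδ⟩ := exists_pos_le_of_ne_zero hgc hgpos
  refine ⟨(∫ t, ‖g t‖) ^ 2 * (C * (1 / (2 * δ)) ^ N), by positivity,
    fun P _ D μ _ R₁ R₂ Y hR₁ hR₂ hY hab hw => ?_⟩
  have hR₁' : 0 < R₁ := by linarith
  have hR₂' : 0 < R₂ := by linarith
  set W := ∫ p, ‖D.w p‖ ∂μ with hW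
  have hWnn : 0 ≤ W := by positivity
  set B : ℝ := C * ((1 / (2 * δ)) * ((1 + Y) / R₂)) ^ N with hB
  have inner : ∀ τ : ℝ × ℝ, g (τ.1 / R₁) ≠ 0 → g (τ.2 / R₂) ≠ 0 →
      ‖∫ q, D.amplitude f q * D.twist τ q ∂(μ.prod (volume.restrict (Ioi 0)))‖ ≤ W * B := by
    intro τ h1 h2
    have hτ1 : 0 ≤ τ.1 := by
      have := hgδ _ h1
      rw [le_div_iff₀ hR₁'] at this
      exact (by positivity : 0 ≤ δ * R₁).trans this
    have hτ2 : δ * R₂ ≤ τ.2 := by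
      have := hgδ _ h2
      rwa [le_div_iff₀ hR₂'] at this
    rw [integral_prod _ (D.integrable_amplitude_mul_twist hf.continuous.measurable hf01 hfs hw τ),
      hW, ← integral_mul_const]
    refine norm_integral_le_of_norm_le (hw.norm.mul_const B)
      (Filter.Eventually.of_forall fun p => ?_)
    -- The total frequency of `log y`. Since `g` lives on positive arguments, `στ₁` and `τ₂` cannot
    -- cancel, and `τ₂ ≥ δR₂` gives `|l| ≥ 2δR₂` for every admissible `σ`.
    set l : ℝ := -(2 * (D.σ * τ.1 + τ.2)) with hl
    have hlow : 2 * (δ * R₂) ≤ |l| := by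
      have := mul_nonneg D.σ_nonneg hτ1
      rw [hl, abs_neg, abs_of_nonneg (by nlinarith [mul_pos hδ hR₂'])]
      linarith
    have hpos : 0 < |l| := lt_of_lt_of_le (by positivity) hlow
    have hsplit : ∀ y : ℝ, D.amplitude f (p, y) * D.twist τ (p, y)
        = D.w p * Complex.exp (Complex.I * ((τ.1 * D.r p + τ.2 * D.s p : ℝ) : ℂ))
          * ((e (D.a p / y + D.b p * y) * f (D.X * y) * f (D.c p / y)
          * Complex.exp (Complex.I * ((l * Real.log y : ℝ) : ℂ))) * ((1 / y : ℝ) : ℂ)) := by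
      intro y
      have : D.twist τ (p, y) = Complex.exp (Complex.I * ((τ.1 * D.r p + τ.2 * D.s p : ℝ) : ℂ))
          * Complex.exp (Complex.I * ((l * Real.log y : ℝ) : ℂ)) := by
        rw [twist, ← Complex.exp_add, hl]; congr 1; push_cast; ring
      rw [this, amplitude]; ring
    simp_rw [hsplit]
    rw [integral_const_mul, norm_mul, norm_mul, norm_cexp_I_mul, mul_one]
    by_cases hp : D.w p = 0
    · simp [hp]
    gcongr
    obtain ⟨ha, hb⟩ := hab p hp
    refine (hC D.X _ _ _ l Y D.X_pos ha hb (abs_pos.1 hpos)).trans ?_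
    rw [hB]
    gcongr
    calc (1 + Y) / |l| ≤ (1 + Y) / (2 * (δ * R₂)) := by gcongr
      _ = _ := by field_simp
  have hint : Integrable fun τ : ℝ × ℝ => ‖g (τ.1 / R₁)‖ * ‖g (τ.2 / R₂)‖ :=
    (integrable_dilate hg.continuous hgc hR₁').norm.mul_prod
      (integrable_dilate hg.continuous hgc hR₂').norm
  have hval : ∫ τ : ℝ × ℝ, ‖g (τ.1 / R₁)‖ * ‖g (τ.2 / R₂)‖
      = (R₁ * ∫ t, ‖g t‖) * (R₂ * ∫ t, ‖g t‖) := by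
    rw [← integral_norm_dilate g hR₁', ← integral_norm_dilate g hR₂']
    exact integral_prod_mul (fun t => ‖g (t / R₁)‖) (fun t => ‖g (t / R₂)‖)
  have := norm_integral_le_of_norm_le (hint.mul_const (W * B))
    (f := fun τ : ℝ × ℝ => ((g (τ.1 / R₁) * g (τ.2 / R₂) : ℝ) : ℂ)
          * ∫ q, D.amplitude f q * D.twist τ q ∂(μ.prod (volume.restrict (Ioi 0))))
    (Filter.Eventually.of_forall fun τ => by
      rw [norm_mul, Complex.norm_real, norm_mul]
      by_cases h1 : g (τ.1 / R₁) = 0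
      · simp [h1]
      by_cases h2 : g (τ.2 / R₂) = 0
      · simp [h2]
      exact mul_le_mul_of_nonneg_left (inner τ h1 h2) (by positivity))
  refine this.trans (le_of_eq ?_)
  rw [integral_mul_const, hval, hB, mul_pow]
  ring

lemma lintegral_inv_one_add_abs_sq_lt_top :
    ∫⁻ x : ℝ, ENNReal.ofReal (1 / (1 + |x|) ^ 2) < ⊤ := by
  have h := integrable_one_add_norm (μ := (volume : Measure ℝ)) (r := 2) (by simp)
  have h2 := h.lintegral_lt_top
  refine lt_of_le_of_lt (le_of_eq (lintegral_congr fun x => ?_)) h2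
  congr 1
  rw [Real.rpow_neg (by positivity), Real.norm_eq_abs, one_div]
  norm_cast

/-- The total mass of the localisation in the distinguished variable. -/
lemma lintegral_Ioi_log_le {R : ℝ} (hR : 0 < R) (s : ℝ) :
    ∫⁻ y in Ioi (0 : ℝ), ENNReal.ofReal (R / (1 + R * |s - 2 * Real.log y|) ^ 2)
        * ENNReal.ofReal (1 / y)
      ≤ ∫⁻ x : ℝ, ENNReal.ofReal (1 / (1 + |x|) ^ 2) := by
  rw [lintegral_Ioi_eq_lintegral_comp_exp
    (fun y => ENNReal.ofReal (R / (1 + R * |s - 2 * Real.log y|) ^ 2))]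
  simp only [Real.log_exp]
  have h1 : ∀ t : ℝ, ENNReal.ofReal (R / (1 + R * |s - 2 * t|) ^ 2)
      = ENNReal.ofReal R * ENNReal.ofReal (1 / (1 + |(2 * R) * t - R * s|) ^ 2) := by
    intro t
    rw [← ENNReal.ofReal_mul hR.le]
    congr 1
    have : |2 * R * t - R * s| = R * |s - 2 * t| := by
      rw [show 2 * R * t - R * s = -(R * (s - 2 * t)) by ring, abs_neg, abs_mul, abs_of_pos hR]
    rw [this]; ring
  simp_rw [h1]
  rw [lintegral_const_mul _ (by fun_prop)]
  have h2 := lintegral_sub_right_eq_self (μ := (volume : Measure ℝ))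
    (fun x => ENNReal.ofReal (1 / (1 + |x|) ^ 2)) (R * s)
  have h3 : ∫⁻ t : ℝ, ENNReal.ofReal (1 / (1 + |(2 * R) * t - R * s|) ^ 2)
      = ENNReal.ofReal |(2 * R)⁻¹| * ∫⁻ x : ℝ, ENNReal.ofReal (1 / (1 + |x - R * s|) ^ 2) := by
    rw [← lintegral_map (μ := volume) (g := fun t : ℝ => (2 * R) * t)
      (f := fun x : ℝ => ENNReal.ofReal (1 / (1 + |x - R * s|) ^ 2))
      (by fun_prop) (by fun_prop), Real.map_volume_mul_left (by positivity), lintegral_smul_measure,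
      smul_eq_mul]
  rw [h3, h2, ← mul_assoc, ← ENNReal.ofReal_mul hR.le]
  refine (mul_le_mul_left (?_ : _ ≤ (1 : ℝ≥0∞)) _).trans (by rw [one_mul])
  rw [ENNReal.ofReal_le_one, abs_of_pos (by positivity)]
  rw [mul_inv, ← mul_assoc, mul_comm R, mul_assoc, mul_inv_cancel₀ hR.ne']
  norm_num

end PhaseData

namespace PhaseData

/-- By the triangle inequality and `R₁ ≤ R₂`, `1 + R₁|A - σB| ≤ (1 + u)(1 + v)`. Two of the four
powers of `1 + v` pay for exchanging `A` with `A - σB`, and the other two stay to make the kernel in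
`B` integrable. This is why `exists_norm_integral_dilate_le` supplies a fourth power. -/
lemma localisation_le {R₁ R₂ A B σ : ℝ} (h1 : 1 ≤ R₁) (h12 : R₁ ≤ R₂) (hσ0 : 0 ≤ σ)
    (hσ1 : σ ≤ 1) :
    R₁ / (1 + R₁ * |A|) ^ 4 * (R₂ / (1 + R₂ * |B|) ^ 4)
      ≤ R₁ / (1 + R₁ * |A - σ * B|) ^ 2 * (R₂ / (1 + R₂ * |B|) ^ 2) := by
  have h1' : 0 < R₁ := by linarith
  have h2' : 0 < R₂ := by linarith
  set u := R₁ * |A| with hu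
  set v := R₂ * |B| with hv
  have hu0 : 0 ≤ u := by positivity
  have hv0 : 0 ≤ v := by positivity
  have h3 : R₁ * |A - σ * B| ≤ u + v := by
    have : |A - σ * B| ≤ |A| + |B| := by
      refine (abs_sub _ _).trans ?_
      rw [abs_mul, abs_of_nonneg hσ0]
      have := mul_le_mul_of_nonneg_right hσ1 (abs_nonneg B)
      linarith
    calc R₁ * |A - σ * B| ≤ R₁ * (|A| + |B|) := by gcongr
      _ = u + R₁ * |B| := by ring
      _ ≤ u + v := by rw [hv]; gcongr
  rw [div_mul_div_comm, div_mul_div_comm]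
  have h4 : 1 + R₁ * |A - σ * B| ≤ (1 + u) * (1 + v) := by nlinarith [mul_nonneg hu0 hv0]
  refine div_le_div_of_nonneg_left (by positivity) (by positivity) ?_
  calc (1 + R₁ * |A - σ * B|) ^ 2 * (1 + v) ^ 2 ≤ ((1 + u) * (1 + v)) ^ 2 * (1 + v) ^ 2 := by
        gcongr
    _ = (1 + u) ^ 2 * (1 + v) ^ 4 := by ring
    _ ≤ (1 + u) ^ 4 * (1 + v) ^ 4 := by gcongr <;> linarith

variable {P : Type} [MeasurableSpace P]

lemma integral_mul_twist (D : PhaseData P) (g : ℝ → ℝ) (R₁ R₂ : ℝ) (q : P × ℝ) :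
    ∫ τ : ℝ × ℝ, ((g (τ.1 / R₁) * g (τ.2 / R₂) : ℝ) : ℂ) * D.twist τ q
      = (∫ τ : ℝ, (g (τ / R₁) : ℂ) * Complex.exp (Complex.I *
            ((τ * (D.r q.1 - 2 * D.σ * Real.log q.2) : ℝ) : ℂ)))
        * ∫ τ : ℝ, (g (τ / R₂) : ℂ) * Complex.exp (Complex.I *
            ((τ * (D.s q.1 - 2 * Real.log q.2) : ℝ) : ℂ)) := by
  rw [← integral_prod_mul]
  congr 1; ext τ
  have : D.twist τ q = Complex.exp (Complex.I *
            ((τ.1 * (D.r q.1 - 2 * D.σ * Real.log q.2) : ℝ) : ℂ))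
        * Complex.exp (Complex.I * ((τ.2 * (D.s q.1 - 2 * Real.log q.2) : ℝ) : ℂ)) := by
    rw [twist, ← Complex.exp_add]; congr 1; push_cast; ring
  rw [this]; push_cast; ring

lemma enorm_amplitude_le (D : PhaseData P) {f : ℝ → ℝ} (hf01 : ∀ x, f x ∈ Icc (0 : ℝ) 1)
    {q : P × ℝ} (hq : 0 < q.2) :
    ‖D.amplitude f q‖ₑ ≤ ‖D.w q.1‖ₑ * ENNReal.ofReal (1 / q.2) := by
  have h1 : ∀ x, ‖(f x : ℂ)‖ₑ ≤ 1 := by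
    intro x
    rw [← ofReal_norm, ENNReal.ofReal_le_one, Complex.norm_real, Real.norm_eq_abs,
      abs_of_nonneg (hf01 x).1]
    exact (hf01 x).2
  have h2 : ∀ x, ‖e x‖ₑ = 1 := by
    intro x
    rw [← ofReal_norm, norm_e]; simp
  have h3 : ‖((1 / q.2 : ℝ) : ℂ)‖ₑ = ENNReal.ofReal (1 / q.2) := by
    rw [← ofReal_norm, Complex.norm_real, Real.norm_eq_abs, abs_of_pos (by positivity)]
  rw [amplitude, enorm_mul, enorm_mul, enorm_mul, enorm_mul, h2, h3, one_mul]
  gcongr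
  calc _ ≤ (1 * 1) * ENNReal.ofReal (1 / q.2) := by gcongr <;> exact h1 _
    _ = _ := by ring

/-- Localisation by the `τ`-integrals. -/
lemma exists_norm_integral_le_localised {f : ℝ → ℝ} (hf : ContDiff ℝ ∞ f)
    (hf01 : ∀ x, f x ∈ Icc (0 : ℝ) 1) (hfs : Function.support f ⊆ Icc 1 2)
    {g : ℝ → ℝ} (hg : ContDiff ℝ ∞ g) (hgc : HasCompactSupport g) :
    ∃ C : ℝ, 0 ≤ C ∧ ∀ (P : Type) [MeasurableSpace P] (D : PhaseData P) (μ : Measure P)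
      [SFinite μ] (R₁ R₂ V : ℝ), 1 ≤ R₁ → R₁ ≤ R₂ → 0 ≤ V → Integrable D.w μ →
      (∫⁻ p, ‖D.w p‖ₑ * ENNReal.ofReal (R₁ / (1 + R₁ * |D.r p - D.σ * D.s p|) ^ 2) ∂μ
        ≤ ENNReal.ofReal V) →
      ‖∫ τ : ℝ × ℝ, ((g (τ.1 / R₁) * g (τ.2 / R₂) : ℝ) : ℂ)
          * ∫ q, D.amplitude f q * D.twist τ q ∂(μ.prod (volume.restrict (Ioi 0)))‖
        ≤ C * V := by
  obtain ⟨C, hC0, hC⟩ := exists_norm_integral_dilate_le hg hgc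
  set T := ∫⁻ x : ℝ, ENNReal.ofReal (1 / (1 + |x|) ^ 2) with hT
  have hTt : T ≠ ⊤ := lintegral_inv_one_add_abs_sq_lt_top.ne
  refine ⟨C ^ 2 * T.toReal, by positivity, fun P _ D μ _ R₁ R₂ V hR₁ hR₁₂ hV hw hvol => ?_⟩
  have hR₁' : 0 < R₁ := by linarith
  have hR₂' : 0 < R₂ := by linarith
  set ν : Measure ℝ := volume.restrict (Ioi 0) with hν
  have hgint : Integrable fun τ : ℝ × ℝ => ((g (τ.1 / R₁) * g (τ.2 / R₂) : ℝ) : ℂ) :=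
    ((integrable_dilate hg.continuous hgc hR₁').mul_prod
      (integrable_dilate hg.continuous hgc hR₂')).ofReal
  have hamp := D.integrable_amplitude (μ := μ) hf.continuous.measurable hf01 hfs hw
  have hH : Integrable (Function.uncurry fun (τ : ℝ × ℝ) (q : P × ℝ) =>
      ((g (τ.1 / R₁) * g (τ.2 / R₂) : ℝ) : ℂ) * (D.amplitude f q * D.twist τ q))
      (volume.prod (μ.prod ν)) := by
    refine (hgint.mul_prod hamp).mono ?_ (Filter.Eventually.of_forall fun z => ?_)
    · have h1 := D.measurable_twist
      have h2 := D.measurable_amplitude hf.continuous.measurable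
      have h3 := hg.continuous.measurable
      refine Measurable.aestronglyMeasurable ?_
      refine Measurable.mul (by fun_prop) ((h2.comp measurable_snd).mul h1)
    · simp only [Function.uncurry, norm_mul, norm_twist, mul_one]
      exact le_rfl
  -- The twist is unimodular, so the joint integrand is dominated by a product of integrable
  -- functions and Fubini lets the `τ`-integral be done first.
  have hswap : ∫ τ : ℝ × ℝ, ((g (τ.1 / R₁) * g (τ.2 / R₂) : ℝ) : ℂ)
          * ∫ q, D.amplitude f q * D.twist τ q ∂(μ.prod ν)
      = ∫ q, D.amplitude f q * (∫ τ : ℝ × ℝ,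
          ((g (τ.1 / R₁) * g (τ.2 / R₂) : ℝ) : ℂ) * D.twist τ q) ∂(μ.prod ν) := by
    simp_rw [← integral_const_mul]
    rw [integral_integral_swap hH]
    refine integral_congr_ae (Filter.Eventually.of_forall fun q => ?_)
    dsimp only
    refine integral_congr_ae (Filter.Eventually.of_forall fun τ => ?_)
    dsimp only
    ring
  rw [hswap]
  have hle : ‖∫ q, D.amplitude f q * (∫ τ : ℝ × ℝ,
          ((g (τ.1 / R₁) * g (τ.2 / R₂) : ℝ) : ℂ) * D.twist τ q) ∂(μ.prod ν)‖ₑ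
      ≤ ENNReal.ofReal (C ^ 2 * T.toReal * V) := by
    refine (enorm_integral_le_lintegral_enorm _).trans ?_
    have hpt : ∀ᵐ q ∂(μ.prod ν), ‖D.amplitude f q * ∫ τ : ℝ × ℝ,
          ((g (τ.1 / R₁) * g (τ.2 / R₂) : ℝ) : ℂ) * D.twist τ q‖ₑ
        ≤ (ENNReal.ofReal (C ^ 2) * (‖D.w q.1‖ₑ
            * ENNReal.ofReal (R₁ / (1 + R₁ * |D.r q.1 - D.σ * D.s q.1|) ^ 2)))
          * (ENNReal.ofReal (R₂ / (1 + R₂ * |D.s q.1 - 2 * Real.log q.2|) ^ 2)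
            * ENNReal.ofReal (1 / q.2)) := by
      have hpos : ∀ᵐ q ∂(μ.prod ν), q.2 ∈ Ioi (0 : ℝ) :=
        Measure.quasiMeasurePreserving_snd.ae (ae_restrict_mem measurableSet_Ioi)
      filter_upwards [hpos] with q hq
      rw [enorm_mul, integral_mul_twist]
      have h1 := hC R₁ (D.r q.1 - 2 * D.σ * Real.log q.2) hR₁'
      have h2 := hC R₂ (D.s q.1 - 2 * Real.log q.2) hR₂'
      have h3 := localisation_le (A := D.r q.1 - 2 * D.σ * Real.log q.2)
        (B := D.s q.1 - 2 * Real.log q.2) hR₁ hR₁₂ D.σ_nonneg D.σ_le_one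
      -- In this combination `log y` cancels, so the first kernel depends on `p` alone and `y`
      -- survives only in the second.
      rw [show D.r q.1 - 2 * D.σ * Real.log q.2 - D.σ * (D.s q.1 - 2 * Real.log q.2)
        = D.r q.1 - D.σ * D.s q.1 by ring] at h3
      refine (mul_le_mul' (D.enorm_amplitude_le hf01 hq) (b := _)
        (d := ENNReal.ofReal (C ^ 2 * (R₁ / (1 + R₁ * |D.r q.1 - D.σ * D.s q.1|) ^ 2
          * (R₂ / (1 + R₂ * |D.s q.1 - 2 * Real.log q.2|) ^ 2)))) ?_).trans (le_of_eq ?_)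
      · rw [← ofReal_norm, norm_mul]
        refine ENNReal.ofReal_le_ofReal ?_
        refine (mul_le_mul h1 h2 (norm_nonneg _) (by positivity)).trans ?_
        calc _ = C ^ 2 * (R₁ / (1 + R₁ * |D.r q.1 - 2 * D.σ * Real.log q.2|) ^ 4
              * (R₂ / (1 + R₂ * |D.s q.1 - 2 * Real.log q.2|) ^ 4)) := by ring
          _ ≤ _ := by gcongr
      · rw [ENNReal.ofReal_mul (by positivity), ENNReal.ofReal_mul (by positivity)]
        ring
    refine (lintegral_mono_ae hpt).trans ?_
    have hmw := D.measurable_w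
    have hmr := D.measurable_r
    have hms := D.measurable_s
    rw [lintegral_prod _ (by fun_prop)]
    have hin : ∀ p : P, ∫⁻ y, (ENNReal.ofReal (C ^ 2) * (‖D.w p‖ₑ
            * ENNReal.ofReal (R₁ / (1 + R₁ * |D.r p - D.σ * D.s p|) ^ 2)))
          * (ENNReal.ofReal (R₂ / (1 + R₂ * |D.s p - 2 * Real.log y|) ^ 2)
            * ENNReal.ofReal (1 / y)) ∂ν
        ≤ ENNReal.ofReal (C ^ 2) * T * (‖D.w p‖ₑ
            * ENNReal.ofReal (R₁ / (1 + R₁ * |D.r p - D.σ * D.s p|) ^ 2)) := by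
      intro p
      rw [lintegral_const_mul _ (by fun_prop)]
      calc _ ≤ (ENNReal.ofReal (C ^ 2) * (‖D.w p‖ₑ
            * ENNReal.ofReal (R₁ / (1 + R₁ * |D.r p - D.σ * D.s p|) ^ 2))) * T := by
            gcongr
            exact lintegral_Ioi_log_le hR₂' _
        _ = _ := by ring
    refine (lintegral_mono hin).trans ?_
    rw [lintegral_const_mul _ (by fun_prop), ENNReal.ofReal_mul (by positivity),
      ENNReal.ofReal_mul (by positivity), ENNReal.ofReal_toReal hTt]
    gcongr
  rw [← ofReal_norm] at hle
  exact (ENNReal.ofReal_le_ofReal_iff (by positivity)).1 hle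

end PhaseData

/-! ### Singular weights -/

/-- The weight `|u|^(-(1-η))`, infinite at `u = 0`. -/
def singWeight (η u : ℝ) : ℝ≥0∞ := (ENNReal.ofReal |u| ^ (1 - η))⁻¹

@[fun_prop]
lemma measurable_singWeight (η : ℝ) : Measurable (singWeight η) := by
  unfold singWeight; fun_prop

/-- The weight takes values in `ℝ≥0∞`, never vanishes and is infinite at 0, so multiplicativity
holds without exception. Vanishing slopes or coinciding roots later make bounds trivially true
instead of needing almost-everywhere arguments. -/
lemma singWeight_mul {η : ℝ} (hη : η < 1) (u v : ℝ) :
    singWeight η (u * v) = singWeight η u * singWeight η v := by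
  have h : 0 ≤ 1 - η := by linarith
  unfold singWeight
  rw [abs_mul, ENNReal.ofReal_mul (abs_nonneg _), ENNReal.mul_rpow_of_nonneg _ _ h,
    ENNReal.mul_inv (Or.inr (ENNReal.rpow_ne_top_of_nonneg h ENNReal.ofReal_ne_top))
      (Or.inl (ENNReal.rpow_ne_top_of_nonneg h ENNReal.ofReal_ne_top))]

lemma singWeight_zero {η : ℝ} (hη : η < 1) : singWeight η 0 = ⊤ := by
  rw [singWeight, abs_zero, ENNReal.ofReal_zero, ENNReal.zero_rpow_of_pos (by linarith),
    ENNReal.inv_zero]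

lemma singWeight_of_ne_zero {η u : ℝ} (hu : u ≠ 0) :
    singWeight η u = ENNReal.ofReal (|u| ^ (-(1 - η))) := by
  have : 0 < |u| := abs_pos.2 hu
  rw [singWeight, ENNReal.ofReal_rpow_of_pos this, Real.rpow_neg this.le,
    ENNReal.ofReal_inv_of_pos (by positivity)]

lemma singWeight_anti {η u v : ℝ} (hη : η < 1) (h : |u| ≤ |v|) :
    singWeight η v ≤ singWeight η u := by
  unfold singWeight
  have : 0 ≤ 1 - η := by linarith
  gcongr

lemma one_le_singWeight {η u : ℝ} (hη : η < 1) (h : |u| ≤ 1) : 1 ≤ singWeight η u := by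
  refine le_trans (le_of_eq ?_) (singWeight_anti (v := 1) hη (by simpa using h))
  simp [singWeight]

lemma singWeight_le_one {η u : ℝ} (hη : η < 1) (h : 1 ≤ |u|) : singWeight η u ≤ 1 := by
  refine (singWeight_anti (u := 1) hη (by simpa using h)).trans (le_of_eq ?_)
  simp [singWeight]

lemma singWeight_neg (η u : ℝ) : singWeight η (-u) = singWeight η u := by
  simp [singWeight]

/-- Comparison of the localisation kernel with the singular weight. -/
lemma ofReal_localisation_le {η R : ℝ} (hη0 : 0 < η) (hη : η < 1) (hR : 1 ≤ R) (d : ℝ) :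
    ENNReal.ofReal (R / (1 + R * |d|) ^ 2) ≤ ENNReal.ofReal (R ^ η) * singWeight η d := by
  have hR0 : 0 < R := by linarith
  rcases eq_or_ne d 0 with rfl | hd
  · rw [singWeight_zero hη, ENNReal.mul_top]
    · exact le_top
    · simpa using Real.rpow_pos_of_pos hR0 η
  · have hd' : 0 < |d| := abs_pos.2 hd
    rw [singWeight_of_ne_zero hd, ← ENNReal.ofReal_mul (by positivity)]
    refine ENNReal.ofReal_le_ofReal ?_
    have hx : 0 < R * |d| := by positivity
    -- Weakening the quadratic decay to the exponent `1 - η` makes the kernel homogeneous in `d`, at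
    -- the cost of `R ^ η`.
    have h1 : (R * |d|) ^ (1 - η) ≤ 1 + R * |d| := by
      rcases le_total (R * |d|) 1 with h | h
      · have := Real.rpow_le_one hx.le h (by linarith : 0 ≤ 1 - η)
        linarith
      · have := Real.rpow_le_rpow_of_exponent_le h (by linarith : 1 - η ≤ 1)
        rw [Real.rpow_one] at this
        linarith
    have h2 : 1 + R * |d| ≤ (1 + R * |d|) ^ 2 := by nlinarith
    calc R / (1 + R * |d|) ^ 2 ≤ R / (R * |d|) ^ (1 - η) := by
          gcongr; exact h1.trans h2
      _ = R ^ η * |d| ^ (-(1 - η)) := by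
          rw [Real.mul_rpow hR0.le hd'.le, Real.rpow_neg hd'.le, Real.rpow_sub hR0, Real.rpow_one]
          have : R ^ η ≠ 0 := (Real.rpow_pos_of_pos hR0 η).ne'
          field_simp

lemma lintegral_Ioc_singWeight {η B : ℝ} (hη0 : 0 < η) (hB : 0 < B) :
    ∫⁻ u in Ioc 0 B, singWeight η u = ENNReal.ofReal (B ^ η / η) := by
  have h1 : ∫⁻ u in Ioc 0 B, singWeight η u
      = ∫⁻ u in Ioc 0 B, ENNReal.ofReal (u ^ (η - 1)) := by
    refine setLIntegral_congr_fun measurableSet_Ioc fun u hu => ?_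
    rw [singWeight_of_ne_zero hu.1.ne', abs_of_pos hu.1, neg_sub]
  have hii : IntervalIntegrable (fun u : ℝ => u ^ (η - 1)) volume 0 B :=
    intervalIntegral.intervalIntegrable_rpow' (by linarith)
  rw [h1, ← ofReal_integral_eq_lintegral_ofReal]
  · rw [← intervalIntegral.integral_of_le hB.le, integral_rpow (Or.inl (by linarith))]
    congr 1
    rw [sub_add_cancel, Real.zero_rpow hη0.ne', sub_zero]
  · exact (intervalIntegrable_iff_integrableOn_Ioc_of_le hB.le).1 hii
  · filter_upwards [ae_restrict_mem measurableSet_Ioc] with u hu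
    exact Real.rpow_nonneg hu.1.le _

lemma lintegral_Icc_singWeight_le {η B : ℝ} (hη0 : 0 < η) (hB : 0 < B) :
    ∫⁻ u in Icc (-B) B, singWeight η u ≤ ENNReal.ofReal (2 * B ^ η / η) := by
  have hsub : Icc (-B) B ⊆ Icc (-B) 0 ∪ Ioc 0 B := by
    intro u hu
    rcases le_or_gt u 0 with h | h
    · exact Or.inl ⟨hu.1, h⟩
    · exact Or.inr ⟨h, hu.2⟩
  have hneg : ∫⁻ u in Icc (-B) 0, singWeight η u = ∫⁻ u in Ioc 0 B, singWeight η u := by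
    rw [setLIntegral_congr (Ico_ae_eq_Icc (a := -B) (b := (0 : ℝ))).symm]
    rw [← lintegral_indicator measurableSet_Ico, ← lintegral_indicator measurableSet_Ioc,
      ← lintegral_neg_eq_self]
    refine lintegral_congr fun u => ?_
    by_cases hu : u ∈ Ioc 0 B
    · rw [indicator_of_mem hu, indicator_of_mem (by constructor <;> linarith [hu.1, hu.2]),
        singWeight_neg]
    · rw [indicator_of_notMem hu, indicator_of_notMem]
      exact fun h => hu ⟨by linarith [h.2], by linarith [h.1]⟩
  calc _ ≤ ∫⁻ u in Icc (-B) 0 ∪ Ioc 0 B, singWeight η u := lintegral_mono_set hsub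
    _ ≤ _ := lintegral_union_le _ _ _
    _ = ENNReal.ofReal (B ^ η / η) + ENNReal.ofReal (B ^ η / η) := by
      rw [hneg, lintegral_Ioc_singWeight hη0 hB]
    _ = _ := by rw [← ENNReal.ofReal_add (by positivity) (by positivity)]; congr 1; ring

/-- The mass of the translated singular weight on an interval of length `2B`. -/
def singMass (η B : ℝ) : ℝ := (2 / η + 2) * B ^ η

lemma singMass_pos {η B : ℝ} (hη0 : 0 < η) (hB : 0 < B) : 0 < singMass η B := by
  unfold singMass; positivity

/-- Where `|u + c| ≤ B`, translation invariance gives at most the centred mass; elsewhere the weight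
is at most its value at `B`, over a length `2B`. These are the two terms of `singMass`, and the
bound is uniform in `c`. -/
lemma lintegral_singWeight_add_le {η B : ℝ} (hη0 : 0 < η) (hη : η < 1) (hB : 0 < B) (c : ℝ) :
    ∫⁻ u in Icc (-B) B, singWeight η (u + c) ≤ ENNReal.ofReal (singMass η B) := by
  have hpt : ∀ u, singWeight η (u + c)
      ≤ (Icc (-B) B).indicator (singWeight η) (u + c) + singWeight η B := by
    intro u
    by_cases h : u + c ∈ Icc (-B) B
    · rw [indicator_of_mem h]; exact le_self_add
    · refine le_add_left (singWeight_anti hη ?_)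
      rw [abs_of_pos hB]
      by_contra hlt
      exact h (abs_le.1 (not_le.1 hlt).le)
  calc _ ≤ ∫⁻ u in Icc (-B) B, ((Icc (-B) B).indicator (singWeight η) (u + c)
        + singWeight η B) := lintegral_mono hpt
    _ = (∫⁻ u in Icc (-B) B, (Icc (-B) B).indicator (singWeight η) (u + c))
        + singWeight η B * ENNReal.ofReal (2 * B) := by
      rw [lintegral_add_right _ measurable_const, lintegral_const]
      congr 2
      rw [Measure.restrict_apply_univ, Real.volume_Icc]; congr 1; ring
    _ ≤ (∫⁻ u, (Icc (-B) B).indicator (singWeight η) (u + c))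
        + singWeight η B * ENNReal.ofReal (2 * B) := by
      gcongr; exact Measure.restrict_le_self
    _ = (∫⁻ u in Icc (-B) B, singWeight η u) + singWeight η B * ENNReal.ofReal (2 * B) := by
      rw [lintegral_add_right_eq_self (fun u => (Icc (-B) B).indicator (singWeight η) u),
        lintegral_indicator measurableSet_Icc]
    _ ≤ ENNReal.ofReal (2 * B ^ η / η) + ENNReal.ofReal (2 * B ^ η) := by
      gcongr
      · exact lintegral_Icc_singWeight_le hη0 hB
      · rw [singWeight_of_ne_zero hB.ne', abs_of_pos hB, ← ENNReal.ofReal_mul (by positivity)]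
        refine ENNReal.ofReal_le_ofReal (le_of_eq ?_)
        have : B ^ η = B ^ (-(1 - η)) * B := by
          rw [← Real.rpow_add_one hB.ne']; congr 1; ring
        rw [this]; ring
    _ = _ := by
      rw [← ENNReal.ofReal_add (by positivity) (by positivity), singMass]; congr 1; ring

lemma lintegral_singWeight_linear_le {η B : ℝ} (hη0 : 0 < η) (hη : η < 1) (hB : 0 < B)
    (m c : ℝ) :
    ∫⁻ u in Icc (-B) B, singWeight η (m * u + c)
      ≤ singWeight η m * ENNReal.ofReal (singMass η B) := by
  rcases eq_or_ne m 0 with rfl | hm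
  · rw [singWeight_zero hη, ENNReal.top_mul]
    · exact le_top
    · simpa using singMass_pos hη0 hB
  · have : ∀ u, singWeight η (m * u + c) = singWeight η m * singWeight η (u + c / m) := by
      intro u
      rw [← singWeight_mul hη]; congr 1; field_simp
    simp_rw [this]
    rw [lintegral_const_mul _ (by fun_prop)]
    gcongr
    exact lintegral_singWeight_add_le hη0 hη hB _

/-- At each `u` the larger of the two factors is at least half the distance between the roots. Its
weight is therefore bounded by a constant, and a single translated weight is left to integrate. -/
lemma lintegral_singWeight_quadratic_le {η B : ℝ} (hη0 : 0 < η) (hη : η < 1) (hB : 0 < B)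
    (r t : ℝ) :
    ∫⁻ u in Icc (-B) B, singWeight η ((u + r) * (u + t))
      ≤ singWeight η ((r - t) / 2) * ENNReal.ofReal (2 * singMass η B) := by
  have hpt : ∀ u, singWeight η ((u + r) * (u + t))
      ≤ singWeight η ((r - t) / 2) * (singWeight η (u + r) + singWeight η (u + t)) := by
    intro u
    rw [singWeight_mul hη]
    have htri : |r - t| ≤ |u + r| + |u + t| := by
      rw [show r - t = (u + r) - (u + t) by ring]; exact abs_sub _ _
    have h2 : |(r - t) / 2| = |r - t| / 2 := by rw [abs_div, abs_two]
    rcases le_total |u + r| |u + t| with h | h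
    · have h1 : singWeight η (u + t) ≤ singWeight η ((r - t) / 2) :=
        singWeight_anti hη (by rw [h2]; linarith)
      rw [mul_comm]
      exact mul_le_mul' h1 le_self_add
    · have h1 : singWeight η (u + r) ≤ singWeight η ((r - t) / 2) :=
        singWeight_anti hη (by rw [h2]; linarith)
      exact mul_le_mul' h1 le_add_self
  have hm := singMass_pos hη0 hB
  refine (lintegral_mono hpt).trans ?_
  rw [lintegral_const_mul _ (by fun_prop), lintegral_add_left (by fun_prop), two_mul,
    ENNReal.ofReal_add hm.le hm.le]
  gcongr <;> exact lintegral_singWeight_add_le hη0 hη hB _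

/-- The length of `{u : |u| ≤ A, |m u + c| ≤ A}`. -/
lemma volume_two_constraints_le {η A : ℝ} (hη0 : 0 < η) (hη : η < 1) (hA : 0 < A) (m c : ℝ) :
    volume {u : ℝ | |u| ≤ A ∧ |m * u + c| ≤ A} ≤ ENNReal.ofReal (2 * A) * singWeight η m := by
  have h1 : volume {u : ℝ | |u| ≤ A ∧ |m * u + c| ≤ A} ≤ ENNReal.ofReal (2 * A) := by
    refine (measure_mono (t := Icc (-A) A) fun u hu => abs_le.1 hu.1).trans ?_
    rw [Real.volume_Icc]; apply le_of_eq; congr 1; ring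
  -- The length is at most `2A` times `min(1, 1/|m|)`, and this minimum is at most `|m|^(-(1-η))`.
  -- Using the weight keeps the bound multiplicative and integrable in `m` over bounded intervals.
  rcases le_or_gt |m| 1 with h | h
  · refine h1.trans ?_
    conv_lhs => rw [← mul_one (ENNReal.ofReal (2 * A))]
    gcongr
    exact one_le_singWeight hη h
  · have hm : m ≠ 0 := by rintro rfl; simp at h; linarith
    have hm' : 0 < |m| := abs_pos.2 hm
    rw [singWeight_of_ne_zero hm, ← ENNReal.ofReal_mul (by positivity)]
    refine (measure_mono (t := Icc (-(c / m) - A / |m|) (-(c / m) + A / |m|)) ?_).trans ?_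
    · intro u hu
      have h3 : |u + c / m| ≤ A / |m| := by
        rw [le_div_iff₀ hm', ← abs_mul]
        have : (u + c / m) * m = m * u + c := by field_simp
        rw [this]; exact hu.2
      have := abs_le.1 h3
      constructor <;> linarith [this.1, this.2]
    · rw [Real.volume_Icc]
      refine ENNReal.ofReal_le_ofReal ?_
      have h4 : |m|⁻¹ ≤ |m| ^ (-(1 - η)) := by
        rw [← Real.rpow_neg_one]
        exact Real.rpow_le_rpow_of_exponent_le h.le (by linarith)
      calc _ = 2 * A * |m|⁻¹ := by ring
        _ ≤ _ := by gcongr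

/-! ### Volume estimates -/

lemma restrict_box₃ (s t u : Set ℝ) :
    (volume : Measure (ℝ × ℝ × ℝ)).restrict (s ×ˢ t ×ˢ u)
      = (volume.restrict s).prod ((volume.restrict t).prod (volume.restrict u)) := by
  rw [Measure.prod_restrict, Measure.prod_restrict]; rfl

/-- The difference is affine in `x₂` with slope `-2x₁x₄`. Integrating over `x₂` leaves the weight of
the slope, which splits into a weight in `x₁` and one in `x₄`, so three one-dimensional masses
result. -/
lemma lintegral_singWeight_ABA_le {η B : ℝ} (hη0 : 0 < η) (hη : η < 1) (hB : 0 < B) :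
    ∫⁻ x in Icc (-B) B ×ˢ Icc (-B) B ×ˢ Icc (-B) B,
        singWeight η (xiABA2 x.1 x.2.1 x.2.2 - xiABA1 x.1 x.2.1 x.2.2)
      ≤ ENNReal.ofReal (singMass η B ^ 3) := by
  have hm := singMass_pos hη0 hB
  set κ : Measure ℝ := volume.restrict (Icc (-B) B) with hκ
  set T : ℝ≥0∞ := ENNReal.ofReal (singMass η B) with hT
  have hmeas : Measurable fun x : ℝ × ℝ × ℝ =>
      singWeight η (xiABA2 x.1 x.2.1 x.2.2 - xiABA1 x.1 x.2.1 x.2.2) := by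
    unfold xiABA2 xiABA1; fun_prop
  have h0 : ∀ v : ℝ, ∫⁻ u, singWeight η u ∂κ ≤ T := fun _ => by
    simpa using lintegral_singWeight_add_le hη0 hη hB 0
  have h1 : ∀ x₁ x₄ : ℝ, ∫⁻ x₂, singWeight η (xiABA2 x₁ x₂ x₄ - xiABA1 x₁ x₂ x₄) ∂κ
      ≤ singWeight η x₁ * singWeight η x₄ * T := by
    intro x₁ x₄
    have heq : ∀ x₂, xiABA2 x₁ x₂ x₄ - xiABA1 x₁ x₂ x₄
        = (-2 * (x₁ * x₄)) * x₂ + (x₄ ^ 2 * (1 - x₁ ^ 2) - x₁ ^ 2 * (1 + x₁ ^ 2)) := by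
      intro x₂; unfold xiABA2 xiABA1; ring
    simp_rw [heq]
    refine (lintegral_singWeight_linear_le hη0 hη hB _ _).trans ?_
    rw [singWeight_mul hη, singWeight_mul hη]
    refine mul_le_mul_left ?_ T
    calc _ ≤ 1 * (singWeight η x₁ * singWeight η x₄) :=
          mul_le_mul_left (singWeight_le_one hη (by norm_num)) _
      _ = _ := one_mul _
  rw [restrict_box₃, lintegral_prod _ hmeas.aemeasurable]
  calc _ ≤ ∫⁻ x₁, singWeight η x₁ * (T * T) ∂κ := by
        refine lintegral_mono fun x₁ => ?_
        refine (lintegral_prod_symm _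
          (hmeas.comp (measurable_prodMk_left (x := x₁))).aemeasurable).le.trans ?_
        calc _ ≤ ∫⁻ x₄, singWeight η x₄ * (singWeight η x₁ * T) ∂κ := by
              refine lintegral_mono fun x₄ => (h1 x₁ x₄).trans (le_of_eq (by ring))
          _ ≤ T * (singWeight η x₁ * T) := by
              rw [lintegral_mul_const _ (by fun_prop)]; gcongr; exact h0 0
          _ = _ := by ring
    _ ≤ T * (T * T) := by
        rw [lintegral_mul_const _ (by fun_prop)]; gcongr; exact h0 0
    _ = _ := by rw [hT, ← ENNReal.ofReal_mul hm.le, ← ENNReal.ofReal_mul hm.le]; congr 1; ring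

/-- As a polynomial in `x₂`, `ξ₂ - ξ₁²` has leading coefficient `x₅² + 1` and the root `-x₅`, hence
an explicit second root. The leading coefficient times half the distance of the roots is `x₅ ξ₁`;
the cutoff `ξ₁ ≥ m` then leaves only a weight in `x₅`, and `x₄` contributes just its length. -/
lemma lintegral_singWeight_BAB_le {η B B' m : ℝ} (hη0 : 0 < η) (hη : η < 1) (hB : 0 < B)
    (hB' : 0 < B') (hm : 0 < m) :
    ∫⁻ x in Icc (-B') B' ×ˢ Icc (-B) B ×ˢ Icc (-B) B,
        {x : ℝ × ℝ × ℝ | m ≤ xiBAB1 x.1 x.2.1 x.2.2}.indicator (fun x =>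
          singWeight η (xiBAB2 x.1 x.2.1 x.2.2 - xiBAB1 x.1 x.2.1 x.2.2 ^ 2)) x
      ≤ ENNReal.ofReal (4 * singMass η B' * m ^ (-(1 - η)) * B * singMass η B) := by
  have hMB := singMass_pos hη0 hB
  have hMB' := singMass_pos hη0 hB'
  set κ : Measure ℝ := volume.restrict (Icc (-B) B) with hκ
  set κ' : Measure ℝ := volume.restrict (Icc (-B') B') with hκ'
  set T : ℝ≥0∞ := ENNReal.ofReal (singMass η B) with hT
  set T' : ℝ≥0∞ := ENNReal.ofReal (2 * singMass η B') with hT'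
  have hmeas : Measurable ({x : ℝ × ℝ × ℝ | m ≤ xiBAB1 x.1 x.2.1 x.2.2}.indicator (fun x =>
          singWeight η (xiBAB2 x.1 x.2.1 x.2.2 - xiBAB1 x.1 x.2.1 x.2.2 ^ 2))) := by
    refine Measurable.indicator ?_ (measurableSet_le measurable_const ?_) <;>
    · unfold xiBAB1; try unfold xiBAB2
      fun_prop
  have h0 : ∫⁻ u, singWeight η u ∂κ ≤ T := by
    simpa using lintegral_singWeight_add_le hη0 hη hB 0
  have h1 : ∀ x₄ x₅ : ℝ, ∫⁻ x₂, {x : ℝ × ℝ × ℝ | m ≤ xiBAB1 x.1 x.2.1 x.2.2}.indicator (fun x =>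
          singWeight η (xiBAB2 x.1 x.2.1 x.2.2 - xiBAB1 x.1 x.2.1 x.2.2 ^ 2)) (x₂, x₄, x₅) ∂κ'
      ≤ singWeight η x₅ * (singWeight η m * T') := by
    intro x₄ x₅
    by_cases hx : m ≤ x₄ ^ 2 + x₅ ^ 2 + 1
    · have hb : 0 < x₅ ^ 2 + 1 := by positivity
      have heq : ∀ x₂, {x : ℝ × ℝ × ℝ | m ≤ xiBAB1 x.1 x.2.1 x.2.2}.indicator (fun x =>
          singWeight η (xiBAB2 x.1 x.2.1 x.2.2 - xiBAB1 x.1 x.2.1 x.2.2 ^ 2)) (x₂, x₄, x₅)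
          = singWeight η (x₅ ^ 2 + 1) * singWeight η
            ((x₂ + x₅) * (x₂ + (-x₅ - 2 * x₄ ^ 2 * x₅ / (x₅ ^ 2 + 1)))) := by
        intro x₂
        rw [indicator_of_mem (by simpa [xiBAB1] using hx), ← singWeight_mul hη]
        congr 1
        unfold xiBAB1 xiBAB2
        field_simp
        ring
      simp_rw [heq]
      rw [lintegral_const_mul _ (by fun_prop)]
      refine (mul_le_mul_right (lintegral_singWeight_quadratic_le hη0 hη hB' _ _) _).trans ?_
      rw [← mul_assoc, ← singWeight_mul hη, ← mul_assoc]
      gcongr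
      have : (x₅ ^ 2 + 1) * ((x₅ - (-x₅ - 2 * x₄ ^ 2 * x₅ / (x₅ ^ 2 + 1))) / 2)
          = x₅ * (x₄ ^ 2 + x₅ ^ 2 + 1) := by
        field_simp; ring
      rw [this, singWeight_mul hη]
      gcongr
      refine singWeight_anti hη ?_
      rwa [abs_of_pos hm, abs_of_pos (by positivity)]
    · have : ∀ x₂, {x : ℝ × ℝ × ℝ | m ≤ xiBAB1 x.1 x.2.1 x.2.2}.indicator (fun x =>
          singWeight η (xiBAB2 x.1 x.2.1 x.2.2 - xiBAB1 x.1 x.2.1 x.2.2 ^ 2)) (x₂, x₄, x₅)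
          = 0 := fun x₂ => indicator_of_notMem (by simpa [xiBAB1] using hx) _
      simp_rw [this]
      simp
  rw [restrict_box₃, lintegral_prod_symm _ hmeas.aemeasurable]
  calc _ ≤ ∫⁻ z, singWeight η z.2 * (singWeight η m * T') ∂(κ.prod κ) :=
        lintegral_mono fun z => h1 z.1 z.2
    _ = (∫⁻ z, singWeight η z.2 ∂(κ.prod κ)) * (singWeight η m * T') :=
        lintegral_mul_const _ (by fun_prop)
    _ ≤ (T * ENNReal.ofReal (2 * B)) * (singWeight η m * T') := by
        gcongr
        rw [lintegral_prod _ (by fun_prop)]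
        simp only [lintegral_const]
        gcongr
        rw [hκ, Measure.restrict_apply_univ, Real.volume_Icc]
        apply le_of_eq; congr 1; ring
    _ = _ := by
        rw [hT, hT', singWeight_of_ne_zero hm.ne', abs_of_pos hm, ← ENNReal.ofReal_mul hMB.le,
          ← ENNReal.ofReal_mul (by positivity), ← ENNReal.ofReal_mul (by positivity)]
        congr 1; ring

/-- Here `z = (x₄, x₅)` and `d = x₁x₄ - x₂` replaces `x₂`. In these coordinates the conditions of
`longRegion` are affine in `x₁` for fixed `d` and `z`, and those free of `x₁` are affine in `d`. -/
lemma lintegral_shear₄ {T : ℝ × ℝ × ℝ × ℝ → ℝ≥0∞} (hT : Measurable T) :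
    ∫⁻ x, T x = ∫⁻ z : ℝ × ℝ, ∫⁻ d : ℝ, ∫⁻ x₁ : ℝ, T (x₁, x₁ * z.1 - d, z) := by
  calc ∫⁻ x, T x = ∫⁻ x₁ : ℝ, ∫⁻ y : ℝ × ℝ × ℝ, T (x₁, y) := lintegral_prod _ hT.aemeasurable
    _ = ∫⁻ x₁ : ℝ, ∫⁻ z : ℝ × ℝ, ∫⁻ x₂ : ℝ, T (x₁, x₂, z) := by
        refine lintegral_congr fun x₁ => ?_
        exact lintegral_prod_symm (fun y => T (x₁, y)) (by fun_prop)
    _ = ∫⁻ x₁ : ℝ, ∫⁻ z : ℝ × ℝ, ∫⁻ d : ℝ, T (x₁, x₁ * z.1 - d, z) := by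
        refine lintegral_congr fun x₁ => lintegral_congr fun z => ?_
        exact (lintegral_sub_left_eq_self (fun x₂ => T (x₁, x₂, z)) (x₁ * z.1)).symm
    _ = ∫⁻ z : ℝ × ℝ, ∫⁻ x₁ : ℝ, ∫⁻ d : ℝ, T (x₁, x₁ * z.1 - d, z) := by
        refine lintegral_lintegral_swap ?_
        refine Measurable.aemeasurable ?_
        refine Measurable.lintegral_prod_right'
          (f := fun q : (ℝ × ℝ × ℝ) × ℝ => T (q.1.1, q.1.1 * q.1.2.1 - q.2, q.1.2)) ?_
        fun_prop
    _ = _ := by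
        refine lintegral_congr fun z => ?_
        refine lintegral_lintegral_swap ?_
        exact Measurable.aemeasurable (by fun_prop)

/-- The region carrying the long Weyl element integrand. -/
def longRegion (X Y : ℝ) : Set (ℝ × ℝ × ℝ × ℝ) :=
  {x | |x.2.2.1| ≤ X ∧ |x.2.2.2| ≤ X ∧ |x.1| ≤ Y ∧ |x.2.1| ≤ Y ∧ |x.1 * x.2.2.1 - x.2.1| ≤ X ∧
    |x.2.2.1 ^ 2 + (x.1 * x.2.2.1 - x.2.1) * x.2.2.2| ≤ X}

lemma measurableSet_longRegion (X Y : ℝ) : MeasurableSet (longRegion X Y) := by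
  unfold longRegion
  measurability

lemma volume_longRegion_le {η X Y : ℝ} (hη0 : 0 < η) (hη : η < 1) (hX : 0 < X) (hY : 0 < Y) :
    volume (longRegion X Y) ≤ ENNReal.ofReal (4 * X * Y * singMass η X ^ 2) := by
  have hM := singMass_pos hη0 hX
  set κ : Measure ℝ := volume.restrict (Icc (-X) X) with hκ
  set T : ℝ≥0∞ := ENNReal.ofReal (singMass η X) with hT
  have h0 : ∫⁻ u, singWeight η u ∂κ ≤ T := by
    simpa using lintegral_singWeight_add_le hη0 hη hX 0
  have hS := measurableSet_longRegion X Y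
  rw [← lintegral_indicator_one hS, lintegral_shear₄ (measurable_one.indicator hS)]
  -- For fixed `d` and `z`, the variable `x₁` is constrained by `|x₁| ≤ Y` and `|x₂| = |x₁x₄ - d| ≤
  -- Y`, which yields a weight in `x₄`.
  have hx1 : ∀ (z : ℝ × ℝ) (d : ℝ),
      ∫⁻ x₁ : ℝ, (longRegion X Y).indicator 1 (x₁, x₁ * z.1 - d, z)
        ≤ (Icc (-X) X ×ˢ Icc (-X) X).indicator (fun z => ENNReal.ofReal (2 * Y)
            * singWeight η z.1) z
          * {d : ℝ | |d| ≤ X ∧ |z.2 * d + z.1 ^ 2| ≤ X}.indicator 1 d := by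
    intro z d
    by_cases hz : z ∈ Icc (-X) X ×ˢ Icc (-X) X
    · by_cases hd : |d| ≤ X ∧ |z.2 * d + z.1 ^ 2| ≤ X
      · rw [indicator_of_mem hz, indicator_of_mem (by exact hd), Pi.one_apply, mul_one]
        refine le_trans ?_ (volume_two_constraints_le hη0 hη hY z.1 (-d))
        have hms : MeasurableSet {u : ℝ | |u| ≤ Y ∧ |z.1 * u + -d| ≤ Y} := by measurability
        rw [← lintegral_indicator_one hms]
        refine lintegral_mono fun x₁ => ?_
        by_cases hx : (x₁, x₁ * z.1 - d, z) ∈ longRegion X Y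
        · rw [indicator_of_mem hx, indicator_of_mem]
          · rfl
          · exact ⟨hx.2.2.1, by rw [mul_comm, ← sub_eq_add_neg]; exact hx.2.2.2.1⟩
        · rw [indicator_of_notMem hx]; exact zero_le
      · refine le_trans (le_of_eq ?_) zero_le
        rw [← lintegral_zero (μ := (volume : Measure ℝ))]
        refine lintegral_congr fun x₁ => indicator_of_notMem (fun hx => hd ?_) _
        have h5 := hx.2.2.2.2.1
        have h6 := hx.2.2.2.2.2
        simp only [sub_sub_cancel] at h5 h6
        exact ⟨h5, by rwa [add_comm, mul_comm]⟩
    · refine le_trans (le_of_eq ?_) zero_le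
      rw [← lintegral_zero (μ := (volume : Measure ℝ))]
      refine lintegral_congr fun x₁ => indicator_of_notMem (fun hx => hz ?_) _
      exact ⟨abs_le.1 hx.1, abs_le.1 hx.2.1⟩
  -- The two conditions `|d| ≤ X` and `|x₅ d + x₄²| ≤ X` yield in the same way a weight in `x₅`.
  -- Both weights are integrable over `[-X, X]`.
  have hd1 : ∀ z : ℝ × ℝ, ∫⁻ d : ℝ, ∫⁻ x₁ : ℝ, (longRegion X Y).indicator 1 (x₁, x₁ * z.1 - d, z)
      ≤ (Icc (-X) X ×ˢ Icc (-X) X).indicator (fun z => (ENNReal.ofReal (2 * Y)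
            * ENNReal.ofReal (2 * X)) * (singWeight η z.1 * singWeight η z.2)) z := by
    intro z
    have hms : MeasurableSet {d : ℝ | |d| ≤ X ∧ |z.2 * d + z.1 ^ 2| ≤ X} := by measurability
    refine (lintegral_mono (hx1 z)).trans ?_
    rw [lintegral_const_mul _ (measurable_one.indicator hms), lintegral_indicator_one hms]
    by_cases hz : z ∈ Icc (-X) X ×ˢ Icc (-X) X
    · rw [indicator_of_mem hz, indicator_of_mem hz]
      refine (mul_le_mul_right (volume_two_constraints_le hη0 hη hX z.2 (z.1 ^ 2)) _).trans
        (le_of_eq ?_)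
      ring
    · rw [indicator_of_notMem hz, indicator_of_notMem hz, zero_mul]
  refine (lintegral_mono hd1).trans ?_
  rw [lintegral_indicator (measurableSet_Icc.prod measurableSet_Icc),
    lintegral_const_mul _ (by fun_prop), Measure.volume_eq_prod, ← Measure.prod_restrict,
    lintegral_prod_mul (by fun_prop) (by fun_prop)]
  calc _ ≤ ENNReal.ofReal (2 * Y) * ENNReal.ofReal (2 * X) * (T * T) := by gcongr
    _ = _ := by
      rw [hT, ← ENNReal.ofReal_mul (by positivity), ← ENNReal.ofReal_mul (by positivity),
        ← ENNReal.ofReal_mul (by positivity)]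
      congr 1; ring

/-! ### Reordering of the integrals -/

/-- Fubini with the distinguished variable `y₁` moved last. Agreement of `G` with `H` is needed only
at positive `y`, where powers and logarithms obey their usual rules. -/
lemma setIntegral_posQuadrant_eq_left {E : Type} [MeasureSpace E] [SFinite (volume : Measure E)]
    {H : (ℝ × E) × ℝ → ℂ} {G : ℝ × ℝ → E → ℂ}
    (hH : Integrable H (((volume.restrict (Ioi 0)).prod volume).prod (volume.restrict (Ioi 0))))
    (hG : ∀ y₁ y₂ x, 0 < y₁ → 0 < y₂ → G (y₁, y₂) x = H ((y₂, x), y₁)) :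
    ∫ y in posQuadrant, ∫ x, G y x
      = ∫ q, H q ∂(((volume.restrict (Ioi 0)).prod volume).prod (volume.restrict (Ioi 0))) := by
  set ν : Measure ℝ := volume.restrict (Ioi 0) with hν
  have hmp : MeasurePreserving (fun z : (ℝ × ℝ) × E => ((z.1.2, z.2), z.1.1))
      ((ν.prod ν).prod volume) ((ν.prod volume).prod ν) :=
    (Measure.measurePreserving_swap (μ := ν) (ν := ν.prod volume)).comp
      (measurePreserving_prodAssoc ν ν volume)
  have hHz := hmp.integrable_comp_of_integrable hH
  have hrestr : (volume : Measure (ℝ × ℝ)).restrict posQuadrant = ν.prod ν := by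
    rw [posQuadrant, hν, Measure.prod_restrict]; rfl
  have h1 : ∫ y in posQuadrant, ∫ x, G y x = ∫ y in posQuadrant, ∫ x, H ((y.2, x), y.1) := by
    refine setIntegral_congr_fun (measurableSet_Ioi.prod measurableSet_Ioi) fun y hy => ?_
    exact integral_congr_ae (Filter.Eventually.of_forall fun x => hG y.1 y.2 x hy.1 hy.2)
  rw [h1, hrestr, ← hmp.map_eq, integral_map hmp.aemeasurable
    (by rw [hmp.map_eq]; exact hH.aestronglyMeasurable)]
  exact (integral_prod _ hHz).symm

lemma setIntegral_posQuadrant_eq_right {E : Type} [MeasureSpace E] [SFinite (volume : Measure E)]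
    {H : (ℝ × E) × ℝ → ℂ} {G : ℝ × ℝ → E → ℂ}
    (hH : Integrable H (((volume.restrict (Ioi 0)).prod volume).prod (volume.restrict (Ioi 0))))
    (hG : ∀ y₁ y₂ x, 0 < y₁ → 0 < y₂ → G (y₁, y₂) x = H ((y₁, x), y₂)) :
    ∫ y in posQuadrant, ∫ x, G y x
      = ∫ q, H q ∂(((volume.restrict (Ioi 0)).prod volume).prod (volume.restrict (Ioi 0))) := by
  rw [← setIntegral_posQuadrant_eq_left (G := fun y x => G y.swap x) hH
    (fun y₁ y₂ x h₁ h₂ => hG y₂ y₁ x h₂ h₁)]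
  set ν : Measure ℝ := volume.restrict (Ioi 0) with hν
  have hrestr : (volume : Measure (ℝ × ℝ)).restrict posQuadrant = ν.prod ν := by
    rw [posQuadrant, hν, Measure.prod_restrict]; rfl
  rw [hrestr]
  exact (integral_prod_swap (μ := ν) (ν := ν) fun y => ∫ x, G y x).symm

lemma calR_nonneg {R₁ R₂ : ℝ} (h1 : 1 ≤ R₁) (h12 : R₁ ≤ R₂) : 0 ≤ calR R₁ R₂ := by
  have : 0 ≤ R₂ - R₁ + 1 := by linarith
  have : 0 ≤ R₁ := by linarith
  have : 0 ≤ R₂ := by linarith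
  unfold calR; positivity

lemma ofReal_cpow_I_mul {u : ℝ} (hu : 0 < u) (t : ℝ) :
    (u : ℂ) ^ (Complex.I * (t : ℂ)) = Complex.exp (Complex.I * ((t * Real.log u : ℝ) : ℂ)) := by
  rw [Complex.cpow_def_of_ne_zero (by exact_mod_cast hu.ne'), ← Complex.ofReal_log hu.le]
  congr 1; push_cast; ring

lemma conj_cexp_I_mul (t : ℝ) :
    conj (Complex.exp (Complex.I * (t : ℂ))) = Complex.exp (Complex.I * ((-t : ℝ) : ℂ)) := by
  rw [← Complex.exp_conj]; congr 1
  simp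

/-- Conjugation flips the sign of the logarithms, so `τ` enters through a linear phase in the two
log-ratios. The first log-ratio multiplies both `τ₁` and `τ₂`, the second only `τ₂`. -/
lemma testF_mul_conj {f : ℝ → ℝ} {τ₁ τ₂ X₁ X₂ R₁ R₂ u₁ u₂ v₁ v₂ : ℝ} (h1 : 1 ≤ R₁)
    (h12 : R₁ ≤ R₂) (hu₁ : 0 < u₁) (hu₂ : 0 < u₂) (hv₁ : 0 < v₁) (hv₂ : 0 < v₂) :
    testF f τ₁ τ₂ X₁ X₂ R₁ R₂ u₁ u₂ * conj (testF f τ₁ τ₂ X₁ X₂ R₁ R₂ v₁ v₂)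
      = (calR R₁ R₂ : ℂ) * (f (X₁ * u₁) : ℂ) * (f (X₂ * u₂) : ℂ) * (f (X₁ * v₁) : ℂ)
        * (f (X₂ * v₂) : ℂ) * Complex.exp (Complex.I *
          ((τ₁ * (Real.log u₁ - Real.log v₁)
            + τ₂ * (Real.log u₁ - Real.log v₁ + (Real.log u₂ - Real.log v₂)) : ℝ) : ℂ)) := by
  have hR : (calR R₁ R₂ : ℂ) = (√(calR R₁ R₂) : ℂ) * (√(calR R₁ R₂) : ℂ) := by
    rw [← Complex.ofReal_mul, Real.mul_self_sqrt (calR_nonneg h1 h12)]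
  have hE : Complex.exp (Complex.I *
          ((τ₁ * (Real.log u₁ - Real.log v₁)
            + τ₂ * (Real.log u₁ - Real.log v₁ + (Real.log u₂ - Real.log v₂)) : ℝ) : ℂ))
      = Complex.exp (Complex.I * (((τ₁ + τ₂) * Real.log u₁ : ℝ) : ℂ))
        * Complex.exp (Complex.I * ((τ₂ * Real.log u₂ : ℝ) : ℂ))
        * Complex.exp (Complex.I * ((-((τ₁ + τ₂) * Real.log v₁) : ℝ) : ℂ))
        * Complex.exp (Complex.I * ((-(τ₂ * Real.log v₂) : ℝ) : ℂ)) := by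
    rw [← Complex.exp_add, ← Complex.exp_add, ← Complex.exp_add]; congr 1; push_cast; ring
  rw [hE, hR]
  unfold testF
  rw [ofReal_cpow_I_mul hu₁, ofReal_cpow_I_mul hu₂, ofReal_cpow_I_mul hv₁, ofReal_cpow_I_mul hv₂]
  simp only [map_mul, Complex.conj_ofReal, conj_cexp_I_mul]
  ring

/-! ### Elementary inequalities -/

/-- Interpolation between arbitrary polynomial decay and a bound without decay. -/
lemma exists_interpolation_exponent {C₁ C₂ ε : ℝ} (hC₁ : 0 ≤ C₁) (hC₂ : 0 ≤ C₂) (hε : 0 < ε) :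
    ∃ N : ℕ, ∀ I V R q₁ q₂ : ℝ, 1 ≤ R → 0 ≤ V → 1 / R ≤ q₁ → 1 / R ≤ q₂ →
      I ≤ V → I ≤ V * (R ^ 2 * q₁ ^ N) → I ≤ V * (R ^ 2 * q₂ ^ N) →
      I ≤ V * (R ^ ε * q₁ ^ C₁ * q₂ ^ C₂) := by
  -- The threshold is `R ^ (-δ)`. If some `qᵢ` lies below it, its `N`-th power outweighs `R ^ 2` and
  -- all the factors wanted. If both lie above, those factors are together at least `R ^ (-ε)`, and
  -- the bound without decay suffices.
  set δ : ℝ := ε / (C₁ + C₂ + 1) with hδ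
  have hδ0 : 0 < δ := by positivity
  have hδC : δ * (C₁ + C₂) ≤ ε := by
    rw [hδ, div_mul_eq_mul_div, div_le_iff₀ (by positivity)]; nlinarith
  -- After `c ≤ C₁ + C₂` powers of `q` are set aside, the remaining `N - c` gain at least `R ^ (2 +
  -- C₁ + C₂)`: enough for `R ^ 2` and for `q' ^ c' ≥ R ^ (-c')`.
  obtain ⟨N, hN⟩ := exists_nat_ge (C₁ + C₂ + (2 + C₁ + C₂) / δ)
  have hquot : 0 ≤ (2 + C₁ + C₂) / δ := by positivity
  have key : ∀ R q q' c c' : ℝ, 1 ≤ R → 1 / R ≤ q → 1 / R ≤ q' → 0 ≤ c → 0 ≤ c' →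
      c + c' = C₁ + C₂ → q ≤ R ^ (-δ) → R ^ 2 * q ^ N ≤ R ^ ε * (q ^ c * q' ^ c') := by
    intro R q q' c c' hR hq hq' hc hc' hcc hle
    have hR0 : 0 < R := by linarith
    have hq0 : 0 < q := lt_of_lt_of_le (by positivity) hq
    have hq0' : 0 < q' := lt_of_lt_of_le (by positivity) hq'
    have h1 : q ^ N = q ^ c * q ^ ((N : ℝ) - c) := by
      rw [← Real.rpow_add hq0, ← Real.rpow_natCast]; congr 1; ring
    have h2 : q ^ ((N : ℝ) - c) ≤ R ^ (-(2 + C₁ + C₂)) := by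
      calc q ^ ((N : ℝ) - c) ≤ (R ^ (-δ)) ^ ((N : ℝ) - c) :=
            Real.rpow_le_rpow hq0.le hle (by linarith)
        _ = R ^ (-δ * ((N : ℝ) - c)) := (Real.rpow_mul hR0.le _ _).symm
        _ ≤ _ := by
            refine Real.rpow_le_rpow_of_exponent_le hR ?_
            have h3 : (2 + C₁ + C₂) / δ ≤ (N : ℝ) - c := by linarith
            rw [div_le_iff₀ hδ0] at h3
            linarith
    have h4 : R ^ (-c') ≤ q' ^ c' := by
      rw [Real.rpow_neg hR0.le, ← Real.inv_rpow hR0.le]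
      refine Real.rpow_le_rpow (by positivity) ?_ hc'
      rwa [← one_div]
    have h5 : R ^ (2 : ℕ) * R ^ (-(2 + C₁ + C₂)) ≤ R ^ (-c') := by
      rw [← Real.rpow_natCast, ← Real.rpow_add hR0]
      refine Real.rpow_le_rpow_of_exponent_le hR ?_
      push_cast; linarith
    have h6 : 1 ≤ R ^ ε := Real.one_le_rpow hR hε.le
    have hqc : 0 ≤ q ^ c := by positivity
    calc R ^ 2 * q ^ N = q ^ c * (R ^ 2 * q ^ ((N : ℝ) - c)) := by rw [h1]; ring
      _ ≤ q ^ c * (R ^ 2 * R ^ (-(2 + C₁ + C₂))) := by gcongr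
      _ ≤ q ^ c * q' ^ c' := by gcongr; exact h5.trans h4
      _ = 1 * (q ^ c * q' ^ c') := by ring
      _ ≤ _ := by gcongr
  refine ⟨N, fun I V R q₁ q₂ hR hV hq₁ hq₂ h0 h1 h2 => ?_⟩
  have hR0 : 0 < R := by linarith
  have hq₁0 : 0 < q₁ := lt_of_lt_of_le (by positivity) hq₁
  have hq₂0 : 0 < q₂ := lt_of_lt_of_le (by positivity) hq₂
  rcases le_or_gt q₁ (R ^ (-δ)) with h | h
  · refine h1.trans ?_
    rw [mul_assoc]
    gcongr V * ?_
    exact key R q₁ q₂ C₁ C₂ hR hq₁ hq₂ hC₁ hC₂ rfl h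
  rcases le_or_gt q₂ (R ^ (-δ)) with h' | h'
  · refine h2.trans ?_
    rw [mul_assoc, mul_comm (q₁ ^ C₁)]
    gcongr V * ?_
    exact key R q₂ q₁ C₂ C₁ hR hq₂ hq₁ hC₂ hC₁ (add_comm _ _) h'
  · refine h0.trans (le_mul_of_one_le_right hV ?_)
    have e1 : R ^ (-δ * C₁) ≤ q₁ ^ C₁ := by
      rw [Real.rpow_mul hR0.le]; exact Real.rpow_le_rpow (by positivity) h.le hC₁
    have e2 : R ^ (-δ * C₂) ≤ q₂ ^ C₂ := by
      rw [Real.rpow_mul hR0.le]; exact Real.rpow_le_rpow (by positivity) h'.le hC₂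
    calc 1 ≤ R ^ (ε + -δ * C₁ + -δ * C₂) := Real.one_le_rpow hR (by linarith)
      _ = R ^ ε * R ^ (-δ * C₁) * R ^ (-δ * C₂) := by
          rw [Real.rpow_add hR0, Real.rpow_add hR0]
      _ ≤ _ := by gcongr

/-- It rests on `1 - b/a ≤ log (a/b)`. Its purpose is to pass from localisation of a log-ratio of
the `ξ` polynomials to localisation of their difference, which is a polynomial. -/
lemma abs_sub_le_mul_abs_log {a b T : ℝ} (ha : 0 < a) (hb : 0 < b) (haT : a ≤ T) (hbT : b ≤ T) :
    |a - b| ≤ T * |Real.log (a / b)| := by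
  have key : ∀ a b : ℝ, 0 < a → 0 < b → a ≤ T → b ≤ a → |a - b| ≤ T * |Real.log (a / b)| := by
    intro a b ha hb haT hab
    have h1 := Real.log_le_sub_one_of_pos (show 0 < b / a by positivity)
    have h2 : Real.log (a / b) = -Real.log (b / a) := by rw [← Real.log_inv, inv_div]
    have h3 : 1 - b / a ≤ Real.log (a / b) := by linarith
    have h4 : 0 ≤ 1 - b / a := by
      rw [sub_nonneg, div_le_one ha]; exact hab
    rw [abs_of_nonneg (sub_nonneg.2 hab), abs_of_nonneg (h4.trans h3)]
    calc a - b = a * (1 - b / a) := by field_simp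
      _ ≤ T * Real.log (a / b) := by gcongr; exact ha.le.trans haT
  rcases le_total b a with h | h
  · exact key a b ha hb haT h
  · have := key b a hb ha hbT h
    rwa [abs_sub_comm, ← inv_div, Real.log_inv, abs_neg] at this

lemma mem_Icc_of_support {f : ℝ → ℝ} (hfs : Function.support f ⊆ Icc 1 2) {x : ℝ}
    (h : (f x : ℂ) ≠ 0) : 1 ≤ x ∧ x ≤ 2 :=
  hfs (by simpa using h)

lemma norm_ofReal_le_one {f : ℝ → ℝ} (hf01 : ∀ x, f x ∈ Icc (0 : ℝ) 1) (x : ℝ) :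
    ‖(f x : ℂ)‖ ≤ 1 := by
  rw [Complex.norm_real, Real.norm_eq_abs, abs_of_nonneg (hf01 x).1]; exact (hf01 x).2

/-! ### Overlapping bumps, and the combined bound for general phase data -/

namespace PhaseData

/-- The region of `p` on which the two bumps in the distinguished variable overlap. -/
def overlap {P : Type} (c : P → ℝ) (X : ℝ) : Set P := {p | 1 ≤ c p * X ∧ c p * X ≤ 4}

lemma measurableSet_overlap {P : Type} [MeasurableSpace P] {c : P → ℝ} (hc : Measurable c)
    (X : ℝ) : MeasurableSet (overlap c X) := by
  have h : Measurable fun p => c p * X := by fun_prop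
  exact (measurableSet_le measurable_const h).inter (measurableSet_le h measurable_const)

/-- The two arguments multiply to `cX`, free of `y`, so both lying in `[1, 2]` forces `cX` into `[1,
4]`. The weight `w` may therefore be cut off to `overlap`, where size bounds are available, without
changing the integrand. -/
lemma bumps_eq_zero_of_notMem_overlap {P : Type} {c : P → ℝ} {X : ℝ} {p : P} {f : ℝ → ℝ}
    (hfs : Function.support f ⊆ Icc 1 2) {y : ℝ} (hy : 0 < y) (hp : p ∉ overlap c X) :
    (f (X * y) : ℂ) * (f (c p / y) : ℂ) = 0 := by
  by_contra hne
  obtain ⟨h1, h2⟩ := mem_Icc_of_support hfs (left_ne_zero_of_mul hne)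
  obtain ⟨h3, h4⟩ := mem_Icc_of_support hfs (right_ne_zero_of_mul hne)
  have h5 : c p * X = (X * y) * (c p / y) := by field_simp
  refine hp ⟨?_, ?_⟩
  · rw [h5]; nlinarith
  · rw [h5]; nlinarith

/-- The decay estimate prepared for interpolation: `R₁R₂` is enlarged to `R₂ ^ 2`, and the factor
100 leaves room for the absolute constants of the support estimates. -/
lemma exists_norm_integral_le_decay' {f : ℝ → ℝ} (hf : ContDiff ℝ ∞ f)
    (hf01 : ∀ x, f x ∈ Icc (0 : ℝ) 1) (hfs : Function.support f ⊆ Icc 1 2)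
    {g : ℝ → ℝ} (hg : ContDiff ℝ ∞ g) (hgc : HasCompactSupport g) (hgpos : tsupport g ⊆ Ioi 0)
    (N : ℕ) :
    ∃ C : ℝ, 0 ≤ C ∧ ∀ (P : Type) [MeasurableSpace P] (D : PhaseData P) (μ : Measure P)
      [SFinite μ] (R₁ R₂ Y V : ℝ), 1 ≤ R₁ → R₁ ≤ R₂ → 0 ≤ Y → 0 ≤ V →
      (∀ p, D.w p ≠ 0 → |D.a p| * D.X ≤ 100 * Y ∧ |D.b p| ≤ 100 * Y * D.X) →
      (∫⁻ p, ‖D.w p‖ₑ ∂μ ≤ ENNReal.ofReal V) →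
      ‖∫ τ : ℝ × ℝ, ((g (τ.1 / R₁) * g (τ.2 / R₂) : ℝ) : ℂ)
          * ∫ q, D.amplitude f q * D.twist τ q ∂(μ.prod (volume.restrict (Ioi 0)))‖
        ≤ C * V * (R₂ ^ 2 * ((1 + Y) / R₂) ^ N) := by
  obtain ⟨C, hC0, hC⟩ := exists_norm_integral_le_decay hf hf01 hfs hg hgc hgpos N
  refine ⟨C * 100 ^ N, by positivity, fun P _ D μ _ R₁ R₂ Y V hR₁ hR₁₂ hY hV hab hvol => ?_⟩
  have hR₂' : 0 < R₂ := by linarith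
  have hw : Integrable D.w μ :=
    ⟨D.measurable_w.aestronglyMeasurable, lt_of_le_of_lt hvol ENNReal.ofReal_lt_top⟩
  have hW : ∫ p, ‖D.w p‖ ∂μ ≤ V := by
    rw [integral_norm_eq_lintegral_enorm hw.aestronglyMeasurable]
    exact ENNReal.toReal_le_of_le_ofReal hV hvol
  refine (hC P D μ R₁ R₂ (100 * Y) hR₁ (hR₁.trans hR₁₂) (by positivity) hab hw).trans ?_
  calc C * (R₁ * R₂ * ((1 + 100 * Y) / R₂) ^ N) * ∫ p, ‖D.w p‖ ∂μ
      ≤ C * (R₂ * R₂ * ((100 * (1 + Y)) / R₂) ^ N) * V := by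
        gcongr
        linarith
    _ = _ := by rw [mul_div_assoc, mul_pow]; ring

/-- Decay and localisation combined. -/
lemma exists_norm_integral_le {f : ℝ → ℝ} (hf : ContDiff ℝ ∞ f)
    (hf01 : ∀ x, f x ∈ Icc (0 : ℝ) 1) (hfs : Function.support f ⊆ Icc 1 2)
    {g : ℝ → ℝ} (hg : ContDiff ℝ ∞ g) (hgc : HasCompactSupport g) (hgpos : tsupport g ⊆ Ioi 0)
    {C ε : ℝ} (hC : 0 ≤ C) (hε : 0 < ε) :
    ∃ K : ℝ, 0 ≤ K ∧ ∀ (P : Type) [MeasurableSpace P] (D : PhaseData P) (μ : Measure P)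
      [SFinite μ] (R₁ R₂ Y V : ℝ), 1 ≤ R₁ → R₁ ≤ R₂ → 0 ≤ Y → 0 ≤ V →
      (∀ p, D.w p ≠ 0 → |D.a p| * D.X ≤ 100 * Y ∧ |D.b p| ≤ 100 * Y * D.X) →
      (∫⁻ p, ‖D.w p‖ₑ ∂μ ≤ ENNReal.ofReal V) →
      (∫⁻ p, ‖D.w p‖ₑ * ENNReal.ofReal (R₁ / (1 + R₁ * |D.r p - D.σ * D.s p|) ^ 2) ∂μ
        ≤ ENNReal.ofReal V) →
      ‖∫ τ : ℝ × ℝ, ((g (τ.1 / R₁) * g (τ.2 / R₂) : ℝ) : ℂ)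
          * ∫ q, D.amplitude f q * D.twist τ q ∂(μ.prod (volume.restrict (Ioi 0)))‖
        ≤ K * V * R₂ ^ ε * ((1 + Y) / R₂) ^ C := by
  obtain ⟨N, hN⟩ := exists_interpolation_exponent hC le_rfl hε
  obtain ⟨K₁, hK₁, h₁⟩ := exists_norm_integral_le_decay' hf hf01 hfs hg hgc hgpos N
  obtain ⟨K₂, hK₂, h₂⟩ := exists_norm_integral_le_localised hf hf01 hfs hg hgc
  refine ⟨K₁ + K₂, by positivity, fun P _ D μ _ R₁ R₂ Y V hR₁ hR₁₂ hY hV hab hv1 hv2 => ?_⟩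
  have hR₂ : 1 ≤ R₂ := hR₁.trans hR₁₂
  have hR₂' : 0 < R₂ := by linarith
  have hw : Integrable D.w μ :=
    ⟨D.measurable_w.aestronglyMeasurable, lt_of_le_of_lt hv1 ENNReal.ofReal_lt_top⟩
  have e1 := h₁ P D μ R₁ R₂ Y V hR₁ hR₁₂ hY hV hab hv1
  have e2 := h₂ P D μ R₁ R₂ V hR₁ hR₁₂ hV hw hv2
  set I := ‖∫ τ : ℝ × ℝ, ((g (τ.1 / R₁) * g (τ.2 / R₂) : ℝ) : ℂ)
          * ∫ q, D.amplitude f q * D.twist τ q ∂(μ.prod (volume.restrict (Ioi 0)))‖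
  have hI : I ≤ (K₁ + K₂) * V := e2.trans (by nlinarith [mul_nonneg hK₁ hV])
  -- There is a single decaying quantity here; the second slot is filled by `q₂ = 1` with exponent
  -- 0.
  have := hN I ((K₁ + K₂) * V) R₂ ((1 + Y) / R₂) 1 hR₂ (by positivity)
    (by gcongr; linarith) (by rw [div_le_one hR₂']; exact hR₂) hI
    (e1.trans (by gcongr; linarith))
    (hI.trans (le_mul_of_one_le_right (by positivity) (by
      rw [one_pow, mul_one]; exact one_le_pow₀ hR₂)))
  refine this.trans (le_of_eq ?_)
  rw [Real.rpow_zero]; ring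

end PhaseData

lemma norm_weight_le {f : ℝ → ℝ} (hf01 : ∀ x, f x ∈ Icc (0 : ℝ) 1) {z : ℂ} {c r B : ℝ}
    (hz : ‖z‖ ≤ c) (hr : |r| ≤ B) (x y : ℝ) :
    ‖z * (f x : ℂ) * (f y : ℂ) * (r : ℂ)‖ ≤ c * B := by
  rw [norm_mul, norm_mul, norm_mul, Complex.norm_real r, Real.norm_eq_abs]
  have hx := norm_ofReal_le_one hf01 x
  have hy := norm_ofReal_le_one hf01 y
  have hc : 0 ≤ c := (norm_nonneg z).trans hz
  calc _ ≤ c * 1 * 1 * B := by gcongr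
    _ = _ := by ring

/-- Integration of a weight supported on an interval in the first variable. -/
lemma lintegral_weight_le {E : Type} [MeasureSpace E] [SFinite (volume : Measure E)]
    {w : ℝ × E → ℂ} {k : ℝ × E → ℝ≥0∞} {Ψ : E → ℝ≥0∞} (hΨ : Measurable Ψ) {B l u : ℝ}
    (h : ∀ p, w p ≠ 0 → p.1 ∈ Icc l u ∧ ‖w p‖ ≤ B ∧ k p ≤ Ψ p.2) :
    ∫⁻ p, ‖w p‖ₑ * k p ∂((volume.restrict (Ioi (0 : ℝ))).prod volume)
      ≤ ENNReal.ofReal B * ENNReal.ofReal (u - l) * ∫⁻ x, Ψ x := by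
  have hpt : ∀ p, ‖w p‖ₑ * k p
      ≤ (Icc l u).indicator (fun _ => ENNReal.ofReal B) p.1 * Ψ p.2 := by
    intro p
    by_cases hp : w p = 0
    · simp [hp]
    · obtain ⟨h1, h2, h3⟩ := h p hp
      rw [indicator_of_mem h1, ← ofReal_norm]
      gcongr
  refine (lintegral_mono hpt).trans ?_
  rw [lintegral_prod_mul (measurable_const.indicator measurableSet_Icc).aemeasurable
    hΨ.aemeasurable]
  gcongr
  rw [lintegral_indicator measurableSet_Icc, lintegral_const]
  gcongr
  rw [Measure.restrict_apply_univ, ← Real.volume_Icc]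
  exact Measure.restrict_le_self _

/-! ### The transform for `αβα` -/

lemma xiABA1_pos (x₁ x₂ x₄ : ℝ) : 0 < xiABA1 x₁ x₂ x₄ := by unfold xiABA1; positivity

lemma xiABA2_pos (x₁ x₂ x₄ : ℝ) : 0 < xiABA2 x₁ x₂ x₄ := by unfold xiABA2; positivity

/-- The data of `𝒥_{αβα}` with distinguished variable `y₁` and `p = (y₂, x)`. -/
def dataABA {f : ℝ → ℝ} (hf : Measurable f) {A X₁ : ℝ} (hA : 0 < A) (hX₁ : 0 < X₁)
    (X₂ R₁ R₂ : ℝ) : PhaseData (ℝ × ℝ × ℝ × ℝ) where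
  w := (PhaseData.overlap (fun p => X₁ * (A * √(xiABA1 p.2.1 p.2.2.1 p.2.2.2)
      / (xiABA2 p.2.1 p.2.2.1 p.2.2.2 * p.1))) (A * X₁)).indicator fun p =>
    calR R₁ R₂ * e (zetaABA2 p.2.1 p.2.2.1 p.2.2.2 * p.1 / xiABA1 p.2.1 p.2.2.1 p.2.2.2)
      * f (X₂ * (xiABA2 p.2.1 p.2.2.1 p.2.2.2 * p.1 / xiABA1 p.2.1 p.2.2.1 p.2.2.2))
      * f (X₂ * p.1) * ((1 / p.1 ^ 2 : ℝ) : ℂ)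
  a p := A * zetaABA1 p.2.1 p.2.2.1 p.2.2.2 / (xiABA2 p.2.1 p.2.2.1 p.2.2.2 * p.1)
  b p := -(A * p.2.1)
  c p := X₁ * (A * √(xiABA1 p.2.1 p.2.2.1 p.2.2.2) / (xiABA2 p.2.1 p.2.2.1 p.2.2.2 * p.1))
  r p := Real.log (A * √(xiABA1 p.2.1 p.2.2.1 p.2.2.2) / (xiABA2 p.2.1 p.2.2.1 p.2.2.2 * p.1))
    - Real.log A
  s p := Real.log (A * √(xiABA1 p.2.1 p.2.2.1 p.2.2.2) / (xiABA2 p.2.1 p.2.2.1 p.2.2.2 * p.1))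
    - Real.log A + (Real.log (xiABA2 p.2.1 p.2.2.1 p.2.2.2 * p.1 / xiABA1 p.2.1 p.2.2.1 p.2.2.2)
    - Real.log p.1)
  X := A * X₁
  -- `y₁` occurs only in the first arguments of `F` and its conjugate. Their log-ratio multiplies
  -- `τ₁` and `τ₂` alike, so both carry the full `-2 log y₁`.
  σ := 1
  measurable_w := by
    refine Measurable.indicator ?_ (PhaseData.measurableSet_overlap ?_ _)
    · unfold xiABA1 xiABA2 zetaABA2; fun_prop
    · unfold xiABA1 xiABA2; fun_prop
  measurable_a := by unfold zetaABA1 xiABA2; fun_prop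
  measurable_b := by fun_prop
  measurable_c := by unfold xiABA1 xiABA2; fun_prop
  measurable_r := by unfold xiABA1 xiABA2; fun_prop
  measurable_s := by unfold xiABA1 xiABA2; fun_prop
  X_pos := by positivity
  σ_nonneg := zero_le_one
  σ_le_one := le_rfl

lemma integrand_ABA_eq {f : ℝ → ℝ} (hf : Measurable f) (hfs : Function.support f ⊆ Icc 1 2)
    {A X₁ X₂ R₁ R₂ : ℝ} (hA : 0 < A) (hX₁ : 0 < X₁) (h1 : 1 ≤ R₁) (h12 : R₁ ≤ R₂)
    (τ : ℝ × ℝ) (y₁ y₂ : ℝ) (x : ℝ × ℝ × ℝ) (hy₁ : 0 < y₁) (hy₂ : 0 < y₂) :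
    e (A * zetaABA1 x.1 x.2.1 x.2.2 / (xiABA2 x.1 x.2.1 x.2.2 * y₁ * y₂))
    * e (zetaABA2 x.1 x.2.1 x.2.2 * y₂ / xiABA1 x.1 x.2.1 x.2.2)
    * e (-(A * x.1 * y₁))
    * testF f τ.1 τ.2 X₁ X₂ R₁ R₂
        (A * √(xiABA1 x.1 x.2.1 x.2.2) / (xiABA2 x.1 x.2.1 x.2.2 * y₁ * y₂))
        (xiABA2 x.1 x.2.1 x.2.2 * y₂ / xiABA1 x.1 x.2.1 x.2.2)
    * conj (testF f τ.1 τ.2 X₁ X₂ R₁ R₂ (A * y₁) y₂)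
    * ((1 / (y₁ * y₂ ^ 2) : ℝ) : ℂ)
    = (dataABA hf hA hX₁ X₂ R₁ R₂).amplitude f ((y₂, x), y₁)
      * (dataABA hf hA hX₁ X₂ R₁ R₂).twist τ ((y₂, x), y₁) := by
  obtain ⟨x₁, x₂, x₄⟩ := x
  have hξ₁ := xiABA1_pos x₁ x₂ x₄
  have hξ₂ := xiABA2_pos x₁ x₂ x₄
  dsimp only
  set ξ₁ := xiABA1 x₁ x₂ x₄ with hξ₁d
  set ξ₂ := xiABA2 x₁ x₂ x₄ with hξ₂d
  have hs : 0 < √ξ₁ := Real.sqrt_pos.2 hξ₁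
  have hu : A * √ξ₁ / (ξ₂ * y₁ * y₂) = A * √ξ₁ / (ξ₂ * y₂) / y₁ := by field_simp
  rw [mul_assoc (_ * _) (testF _ _ _ _ _ _ _ _ _) (conj _),
    testF_mul_conj h1 h12 (by positivity) (by positivity) (by positivity) (by positivity)]
  have hlog : Real.log (A * √ξ₁ / (ξ₂ * y₁ * y₂)) - Real.log (A * y₁)
      = Real.log (A * √ξ₁ / (ξ₂ * y₂)) - Real.log A - 2 * Real.log y₁ := by
    rw [hu, Real.log_div (by positivity) (by positivity), Real.log_mul hA.ne' hy₁.ne']; ring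
  have htw : (dataABA hf hA hX₁ X₂ R₁ R₂).twist τ ((y₂, x₁, x₂, x₄), y₁)
      = Complex.exp (Complex.I * ((τ.1 * (Real.log (A * √ξ₁ / (ξ₂ * y₁ * y₂)) - Real.log (A * y₁))
        + τ.2 * (Real.log (A * √ξ₁ / (ξ₂ * y₁ * y₂)) - Real.log (A * y₁)
          + (Real.log (ξ₂ * y₂ / ξ₁) - Real.log y₂)) : ℝ) : ℂ)) := by
    rw [hlog]
    simp only [PhaseData.twist, dataABA, ← hξ₁d, ← hξ₂d]
    congr 3; ring
  rw [← htw, hu]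
  generalize (dataABA hf hA hX₁ X₂ R₁ R₂).twist τ ((y₂, x₁, x₂, x₄), y₁) = tw
  have harg : X₁ * (A * √ξ₁ / (ξ₂ * y₂) / y₁) = X₁ * (A * √ξ₁ / (ξ₂ * y₂)) / y₁ := by ring
  have harg' : X₁ * (A * y₁) = A * X₁ * y₁ := by ring
  have he : e (A * zetaABA1 x₁ x₂ x₄ / (ξ₂ * y₁ * y₂)) * e (-(A * x₁ * y₁))
      = e (A * zetaABA1 x₁ x₂ x₄ / (ξ₂ * y₂) / y₁ + -(A * x₁) * y₁) := by
    rw [← e_add]; congr 1; field_simp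
  have hr : ((1 / (y₁ * y₂ ^ 2) : ℝ) : ℂ) = ((1 / y₂ ^ 2 : ℝ) : ℂ) * ((1 / y₁ : ℝ) : ℂ) := by
    rw [← Complex.ofReal_mul]; congr 1; field_simp
  rw [harg, harg', hr, mul_right_comm (e _) (e _) (e _), he]
  simp only [PhaseData.amplitude, dataABA]
  by_cases hp : (y₂, x₁, x₂, x₄) ∈ PhaseData.overlap (fun p : ℝ × ℝ × ℝ × ℝ =>
      X₁ * (A * √(xiABA1 p.2.1 p.2.2.1 p.2.2.2) / (xiABA2 p.2.1 p.2.2.1 p.2.2.2 * p.1))) (A * X₁)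
  · rw [indicator_of_mem hp]
    ring
  -- Off the overlap the cut-off weight vanishes, and the original integrand contains the vanishing
  -- product of bumps.
  · have h0 := PhaseData.bumps_eq_zero_of_notMem_overlap hfs hy₁ hp
    dsimp only at h0
    rw [← hξ₁d, ← hξ₂d] at h0
    rw [indicator_of_notMem hp, zero_mul, zero_mul]
    linear_combination ((calR R₁ R₂ : ℂ) * e (A * zetaABA1 x₁ x₂ x₄ / (ξ₂ * y₂) / y₁
      + -(A * x₁) * y₁) * e (zetaABA2 x₁ x₂ x₄ * y₂ / ξ₁) * f (X₂ * (ξ₂ * y₂ / ξ₁)) * f (X₂ * y₂)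
      * tw * (((1 / y₂ ^ 2 : ℝ) : ℂ) * ((1 / y₁ : ℝ) : ℂ))) * h0

lemma JABA_eq {f : ℝ → ℝ} (hf : Measurable f) (hf01 : ∀ x, f x ∈ Icc (0 : ℝ) 1)
    (hfs : Function.support f ⊆ Icc 1 2)
    {A X₁ X₂ R₁ R₂ : ℝ} (hA : 0 < A) (hX₁ : 0 < X₁) (h1 : 1 ≤ R₁) (h12 : R₁ ≤ R₂)
    (hw : Integrable (dataABA hf hA hX₁ X₂ R₁ R₂).w ((volume.restrict (Ioi 0)).prod volume))
    (τ : ℝ × ℝ) :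
    JABA (testF f τ.1 τ.2 X₁ X₂ R₁ R₂) A = ((A ^ 4)⁻¹ : ℝ)
      * ∫ q, (dataABA hf hA hX₁ X₂ R₁ R₂).amplitude f q
        * (dataABA hf hA hX₁ X₂ R₁ R₂).twist τ q
        ∂(((volume.restrict (Ioi 0)).prod volume).prod (volume.restrict (Ioi 0))) := by
  rw [JABA]
  congr 1
  exact setIntegral_posQuadrant_eq_left
    ((dataABA hf hA hX₁ X₂ R₁ R₂).integrable_amplitude_mul_twist hf hf01 hfs hw τ)
    (fun y₁ y₂ x hy₁ hy₂ => integrand_ABA_eq hf hfs hA hX₁ h1 h12 τ y₁ y₂ x hy₁ hy₂)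

/-! ### The transform for `βαβ` -/

lemma xiBAB1_pos (x₂ x₄ x₅ : ℝ) : 0 < xiBAB1 x₂ x₄ x₅ := by unfold xiBAB1; positivity

lemma xiBAB2_pos (x₂ x₄ x₅ : ℝ) : 0 < xiBAB2 x₂ x₄ x₅ := by unfold xiBAB2; positivity

/-- The data of `𝒥_{βαβ}` with distinguished variable `y₂` and `p = (y₁, x)`. -/
def dataBAB {f : ℝ → ℝ} (hf : Measurable f) {A X₂ : ℝ} (hA : 0 < A) (hX₂ : 0 < X₂)
    (X₁ R₁ R₂ : ℝ) : PhaseData (ℝ × ℝ × ℝ × ℝ) where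
  w := (PhaseData.overlap (fun p => X₂ * (xiBAB1 p.2.1 p.2.2.1 p.2.2.2
      / (xiBAB2 p.2.1 p.2.2.1 p.2.2.2 * p.1 ^ 2))) (A * X₂)).indicator fun p =>
    calR R₁ R₂ * e (zetaBAB1 p.2.1 p.2.2.1 p.2.2.2 * p.1 / xiBAB1 p.2.1 p.2.2.1 p.2.2.2)
      * f (X₁ * (√(xiBAB2 p.2.1 p.2.2.1 p.2.2.2) * p.1 / xiBAB1 p.2.1 p.2.2.1 p.2.2.2))
      * f (X₁ * p.1) * ((1 / p.1 ^ 2 : ℝ) : ℂ)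
  a p := zetaBAB2 p.2.1 p.2.2.1 p.2.2.2 / (xiBAB2 p.2.1 p.2.2.1 p.2.2.2 * p.1 ^ 2)
  b p := -(A * p.2.2.2)
  c p := X₂ * (xiBAB1 p.2.1 p.2.2.1 p.2.2.2 / (xiBAB2 p.2.1 p.2.2.1 p.2.2.2 * p.1 ^ 2))
  r p := Real.log (√(xiBAB2 p.2.1 p.2.2.1 p.2.2.2) * p.1 / xiBAB1 p.2.1 p.2.2.1 p.2.2.2)
    - Real.log p.1
  s p := Real.log (√(xiBAB2 p.2.1 p.2.2.1 p.2.2.2) * p.1 / xiBAB1 p.2.1 p.2.2.1 p.2.2.2)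
    - Real.log p.1
    + (Real.log (xiBAB1 p.2.1 p.2.2.1 p.2.2.2 / (xiBAB2 p.2.1 p.2.2.1 p.2.2.2 * p.1 ^ 2))
    - Real.log A)
  X := A * X₂
  -- `y₂` occurs only in the second arguments, whose log-ratio is multiplied by `τ₂` alone.
  σ := 0
  measurable_w := by
    refine Measurable.indicator ?_ (PhaseData.measurableSet_overlap ?_ _)
    · unfold xiBAB1 xiBAB2 zetaBAB1; fun_prop
    · unfold xiBAB1 xiBAB2; fun_prop
  measurable_a := by unfold zetaBAB2 xiBAB2; fun_prop
  measurable_b := by fun_prop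
  measurable_c := by unfold xiBAB1 xiBAB2; fun_prop
  measurable_r := by unfold xiBAB1 xiBAB2; fun_prop
  measurable_s := by unfold xiBAB1 xiBAB2; fun_prop
  X_pos := by positivity
  σ_nonneg := le_rfl
  σ_le_one := zero_le_one

lemma integrand_BAB_eq {f : ℝ → ℝ} (hf : Measurable f) (hfs : Function.support f ⊆ Icc 1 2)
    {A X₁ X₂ R₁ R₂ : ℝ} (hA : 0 < A) (hX₂ : 0 < X₂) (h1 : 1 ≤ R₁) (h12 : R₁ ≤ R₂)
    (τ : ℝ × ℝ) (y₁ y₂ : ℝ) (x : ℝ × ℝ × ℝ) (hy₁ : 0 < y₁) (hy₂ : 0 < y₂) :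
    e (zetaBAB1 x.1 x.2.1 x.2.2 * y₁ / xiBAB1 x.1 x.2.1 x.2.2)
    * e (zetaBAB2 x.1 x.2.1 x.2.2 / (xiBAB2 x.1 x.2.1 x.2.2 * y₁ ^ 2 * y₂))
    * e (-(A * x.2.2 * y₂))
    * testF f τ.1 τ.2 X₁ X₂ R₁ R₂
        (√(xiBAB2 x.1 x.2.1 x.2.2) * y₁ / xiBAB1 x.1 x.2.1 x.2.2)
        (xiBAB1 x.1 x.2.1 x.2.2 / (xiBAB2 x.1 x.2.1 x.2.2 * y₁ ^ 2 * y₂))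
    * conj (testF f τ.1 τ.2 X₁ X₂ R₁ R₂ y₁ (A * y₂))
    * ((1 / (y₁ ^ 2 * y₂) : ℝ) : ℂ)
    = (dataBAB hf hA hX₂ X₁ R₁ R₂).amplitude f ((y₁, x), y₂)
      * (dataBAB hf hA hX₂ X₁ R₁ R₂).twist τ ((y₁, x), y₂) := by
  obtain ⟨x₂, x₄, x₅⟩ := x
  have hξ₁ := xiBAB1_pos x₂ x₄ x₅
  have hξ₂ := xiBAB2_pos x₂ x₄ x₅
  dsimp only
  set ξ₁ := xiBAB1 x₂ x₄ x₅ with hξ₁d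
  set ξ₂ := xiBAB2 x₂ x₄ x₅ with hξ₂d
  have hs : 0 < √ξ₂ := Real.sqrt_pos.2 hξ₂
  have hu : ξ₁ / (ξ₂ * y₁ ^ 2 * y₂) = ξ₁ / (ξ₂ * y₁ ^ 2) / y₂ := by field_simp
  rw [mul_assoc (_ * _) (testF _ _ _ _ _ _ _ _ _) (conj _),
    testF_mul_conj h1 h12 (by positivity) (by positivity) (by positivity) (by positivity)]
  have hlog : Real.log (ξ₁ / (ξ₂ * y₁ ^ 2 * y₂)) - Real.log (A * y₂)
      = Real.log (ξ₁ / (ξ₂ * y₁ ^ 2)) - Real.log A - 2 * Real.log y₂ := by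
    rw [hu, Real.log_div (by positivity) (by positivity), Real.log_mul hA.ne' hy₂.ne']; ring
  have htw : (dataBAB hf hA hX₂ X₁ R₁ R₂).twist τ ((y₁, x₂, x₄, x₅), y₂)
      = Complex.exp (Complex.I * ((τ.1 * (Real.log (√ξ₂ * y₁ / ξ₁) - Real.log y₁)
        + τ.2 * (Real.log (√ξ₂ * y₁ / ξ₁) - Real.log y₁
          + (Real.log (ξ₁ / (ξ₂ * y₁ ^ 2 * y₂)) - Real.log (A * y₂))) : ℝ) : ℂ)) := by
    rw [hlog]
    simp only [PhaseData.twist, dataBAB, ← hξ₁d, ← hξ₂d]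
    congr 3; ring
  rw [← htw, hu]
  generalize (dataBAB hf hA hX₂ X₁ R₁ R₂).twist τ ((y₁, x₂, x₄, x₅), y₂) = tw
  have harg : X₂ * (ξ₁ / (ξ₂ * y₁ ^ 2) / y₂) = X₂ * (ξ₁ / (ξ₂ * y₁ ^ 2)) / y₂ := by ring
  have harg' : X₂ * (A * y₂) = A * X₂ * y₂ := by ring
  have he : e (zetaBAB2 x₂ x₄ x₅ / (ξ₂ * y₁ ^ 2 * y₂)) * e (-(A * x₅ * y₂))
      = e (zetaBAB2 x₂ x₄ x₅ / (ξ₂ * y₁ ^ 2) / y₂ + -(A * x₅) * y₂) := by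
    rw [← e_add]; congr 1; field_simp
  have hr : ((1 / (y₁ ^ 2 * y₂) : ℝ) : ℂ) = ((1 / y₁ ^ 2 : ℝ) : ℂ) * ((1 / y₂ : ℝ) : ℂ) := by
    rw [← Complex.ofReal_mul]; congr 1; field_simp
  rw [harg, harg', hr, mul_assoc (e _) (e _) (e _), he]
  simp only [PhaseData.amplitude, dataBAB]
  by_cases hp : (y₁, x₂, x₄, x₅) ∈ PhaseData.overlap (fun p : ℝ × ℝ × ℝ × ℝ =>
      X₂ * (xiBAB1 p.2.1 p.2.2.1 p.2.2.2 / (xiBAB2 p.2.1 p.2.2.1 p.2.2.2 * p.1 ^ 2))) (A * X₂)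
  · rw [indicator_of_mem hp]
    ring
  · have h0 := PhaseData.bumps_eq_zero_of_notMem_overlap hfs hy₂ hp
    dsimp only at h0
    rw [← hξ₁d, ← hξ₂d] at h0
    rw [indicator_of_notMem hp, zero_mul, zero_mul]
    linear_combination ((calR R₁ R₂ : ℂ) * e (zetaBAB2 x₂ x₄ x₅ / (ξ₂ * y₁ ^ 2) / y₂
      + -(A * x₅) * y₂) * e (zetaBAB1 x₂ x₄ x₅ * y₁ / ξ₁) * f (X₁ * (√ξ₂ * y₁ / ξ₁)) * f (X₁ * y₁)
      * tw * (((1 / y₁ ^ 2 : ℝ) : ℂ) * ((1 / y₂ : ℝ) : ℂ))) * h0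

lemma JBAB_eq {f : ℝ → ℝ} (hf : Measurable f) (hf01 : ∀ x, f x ∈ Icc (0 : ℝ) 1)
    (hfs : Function.support f ⊆ Icc 1 2)
    {A X₁ X₂ R₁ R₂ : ℝ} (hA : 0 < A) (hX₂ : 0 < X₂) (h1 : 1 ≤ R₁) (h12 : R₁ ≤ R₂)
    (hw : Integrable (dataBAB hf hA hX₂ X₁ R₁ R₂).w ((volume.restrict (Ioi 0)).prod volume))
    (τ : ℝ × ℝ) :
    JBAB (testF f τ.1 τ.2 X₁ X₂ R₁ R₂) A = ((A ^ 3)⁻¹ : ℝ)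
      * ∫ q, (dataBAB hf hA hX₂ X₁ R₁ R₂).amplitude f q
        * (dataBAB hf hA hX₂ X₁ R₁ R₂).twist τ q
        ∂(((volume.restrict (Ioi 0)).prod volume).prod (volume.restrict (Ioi 0))) := by
  rw [JBAB]
  congr 1
  exact setIntegral_posQuadrant_eq_right
    ((dataBAB hf hA hX₂ X₁ R₁ R₂).integrable_amplitude_mul_twist hf hf01 hfs hw τ)
    (fun y₁ y₂ x hy₁ hy₂ => integrand_BAB_eq hf hfs hA hX₂ h1 h12 τ y₁ y₂ x hy₁ hy₂)

/-! ### The transform for `w₀` -/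

lemma xiLong1_pos (x₁ x₂ x₄ x₅ : ℝ) : 0 < xiLong1 x₁ x₂ x₄ x₅ := by unfold xiLong1; positivity

lemma xiLong2_pos (x₁ x₂ x₄ x₅ : ℝ) : 0 < xiLong2 x₁ x₂ x₄ x₅ := by unfold xiLong2; positivity

/-- The integrand of `𝒥_{w₀}`. -/
def integrandLong (f : ℝ → ℝ) (A₁ A₂ X₁ X₂ R₁ R₂ : ℝ) (τ : ℝ × ℝ) (y : ℝ × ℝ)
    (x : ℝ × ℝ × ℝ × ℝ) : ℂ :=
  e (A₁ * zetaLong1 x.1 x.2.1 x.2.2.1 x.2.2.2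
      / (xiLong2 x.1 x.2.1 x.2.2.1 x.2.2.2 * y.1))
  * e (A₂ * zetaLong2 x.1 x.2.1 x.2.2.1 x.2.2.2
      / (xiLong1 x.1 x.2.1 x.2.2.1 x.2.2.2 * y.2))
  * e (-(A₁ * x.1 * y.1) - A₂ * x.2.2.2 * y.2)
  * testF f τ.1 τ.2 X₁ X₂ R₁ R₂ (A₁ * √(xiLong1 x.1 x.2.1 x.2.2.1 x.2.2.2)
        / (xiLong2 x.1 x.2.1 x.2.2.1 x.2.2.2 * y.1))
      (A₂ * xiLong2 x.1 x.2.1 x.2.2.1 x.2.2.2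
        / (xiLong1 x.1 x.2.1 x.2.2.1 x.2.2.2 * y.2))
  * conj (testF f τ.1 τ.2 X₁ X₂ R₁ R₂ (A₁ * y.1) (A₂ * y.2))
  * ((1 / (y.1 * y.2) : ℝ) : ℂ)

/-- The data of `𝒥_{w₀}` with distinguished variable `y₁` and `p = (y₂, x)`. -/
def dataLongLeft {f : ℝ → ℝ} (hf : Measurable f) {A₁ X₁ : ℝ} (hA₁ : 0 < A₁) (hX₁ : 0 < X₁)
    (A₂ X₂ R₁ R₂ : ℝ) : PhaseData (ℝ × ℝ × ℝ × ℝ × ℝ) where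
  w := (PhaseData.overlap (fun p => X₁ * (A₁ * √(xiLong1 p.2.1 p.2.2.1 p.2.2.2.1 p.2.2.2.2)
      / xiLong2 p.2.1 p.2.2.1 p.2.2.2.1 p.2.2.2.2)) (A₁ * X₁)).indicator fun p =>
    calR R₁ R₂ * e (A₂ * zetaLong2 p.2.1 p.2.2.1 p.2.2.2.1 p.2.2.2.2
        / (xiLong1 p.2.1 p.2.2.1 p.2.2.2.1 p.2.2.2.2 * p.1))
      * e (-(A₂ * p.2.2.2.2 * p.1))
      * f (X₂ * (A₂ * xiLong2 p.2.1 p.2.2.1 p.2.2.2.1 p.2.2.2.2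
        / (xiLong1 p.2.1 p.2.2.1 p.2.2.2.1 p.2.2.2.2 * p.1)))
      * f (X₂ * (A₂ * p.1)) * ((1 / p.1 : ℝ) : ℂ)
  a p := A₁ * zetaLong1 p.2.1 p.2.2.1 p.2.2.2.1 p.2.2.2.2
    / xiLong2 p.2.1 p.2.2.1 p.2.2.2.1 p.2.2.2.2
  b p := -(A₁ * p.2.1)
  c p := X₁ * (A₁ * √(xiLong1 p.2.1 p.2.2.1 p.2.2.2.1 p.2.2.2.2)
      / xiLong2 p.2.1 p.2.2.1 p.2.2.2.1 p.2.2.2.2)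
  r p := Real.log (A₁ * √(xiLong1 p.2.1 p.2.2.1 p.2.2.2.1 p.2.2.2.2)
      / xiLong2 p.2.1 p.2.2.1 p.2.2.2.1 p.2.2.2.2) - Real.log A₁
  s p := Real.log (A₁ * √(xiLong1 p.2.1 p.2.2.1 p.2.2.2.1 p.2.2.2.2)
      / xiLong2 p.2.1 p.2.2.1 p.2.2.2.1 p.2.2.2.2) - Real.log A₁
    + (Real.log (A₂ * xiLong2 p.2.1 p.2.2.1 p.2.2.2.1 p.2.2.2.2
      / (xiLong1 p.2.1 p.2.2.1 p.2.2.2.1 p.2.2.2.2 * p.1)) - Real.log (A₂ * p.1))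
  X := A₁ * X₁
  σ := 1
  measurable_w := by
    refine Measurable.indicator ?_ (PhaseData.measurableSet_overlap ?_ _)
    · unfold xiLong1 xiLong2 zetaLong2; fun_prop
    · unfold xiLong1 xiLong2; fun_prop
  measurable_a := by unfold zetaLong1 xiLong2; fun_prop
  measurable_b := by fun_prop
  measurable_c := by unfold xiLong1 xiLong2; fun_prop
  measurable_r := by unfold xiLong1 xiLong2; fun_prop
  measurable_s := by unfold xiLong1 xiLong2; fun_prop
  X_pos := by positivity
  σ_nonneg := zero_le_one
  σ_le_one := le_rfl

/-- The data of `𝒥_{w₀}` with distinguished variable `y₂` and `p = (y₁, x)`. -/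
def dataLongRight {f : ℝ → ℝ} (hf : Measurable f) {A₂ X₂ : ℝ} (hA₂ : 0 < A₂) (hX₂ : 0 < X₂)
    (A₁ X₁ R₁ R₂ : ℝ) : PhaseData (ℝ × ℝ × ℝ × ℝ × ℝ) where
  w := (PhaseData.overlap (fun p => X₂ * (A₂ * xiLong2 p.2.1 p.2.2.1 p.2.2.2.1 p.2.2.2.2
      / xiLong1 p.2.1 p.2.2.1 p.2.2.2.1 p.2.2.2.2)) (A₂ * X₂)).indicator fun p =>
    calR R₁ R₂ * e (A₁ * zetaLong1 p.2.1 p.2.2.1 p.2.2.2.1 p.2.2.2.2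
        / (xiLong2 p.2.1 p.2.2.1 p.2.2.2.1 p.2.2.2.2 * p.1))
      * e (-(A₁ * p.2.1 * p.1))
      * f (X₁ * (A₁ * √(xiLong1 p.2.1 p.2.2.1 p.2.2.2.1 p.2.2.2.2)
        / (xiLong2 p.2.1 p.2.2.1 p.2.2.2.1 p.2.2.2.2 * p.1)))
      * f (X₁ * (A₁ * p.1)) * ((1 / p.1 : ℝ) : ℂ)
  a p := A₂ * zetaLong2 p.2.1 p.2.2.1 p.2.2.2.1 p.2.2.2.2
    / xiLong1 p.2.1 p.2.2.1 p.2.2.2.1 p.2.2.2.2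
  b p := -(A₂ * p.2.2.2.2)
  c p := X₂ * (A₂ * xiLong2 p.2.1 p.2.2.1 p.2.2.2.1 p.2.2.2.2
      / xiLong1 p.2.1 p.2.2.1 p.2.2.2.1 p.2.2.2.2)
  r p := Real.log (A₁ * √(xiLong1 p.2.1 p.2.2.1 p.2.2.2.1 p.2.2.2.2)
      / (xiLong2 p.2.1 p.2.2.1 p.2.2.2.1 p.2.2.2.2 * p.1)) - Real.log (A₁ * p.1)
  s p := Real.log (A₁ * √(xiLong1 p.2.1 p.2.2.1 p.2.2.2.1 p.2.2.2.2)
      / (xiLong2 p.2.1 p.2.2.1 p.2.2.2.1 p.2.2.2.2 * p.1)) - Real.log (A₁ * p.1)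
    + (Real.log (A₂ * xiLong2 p.2.1 p.2.2.1 p.2.2.2.1 p.2.2.2.2
      / xiLong1 p.2.1 p.2.2.1 p.2.2.2.1 p.2.2.2.2) - Real.log A₂)
  X := A₂ * X₂
  -- The localised combination is then `r` itself. It still contains `-2 log y₁`, so the
  -- `y₁`-integral can absorb it.
  σ := 0
  measurable_w := by
    refine Measurable.indicator ?_ (PhaseData.measurableSet_overlap ?_ _)
    · unfold xiLong1 xiLong2 zetaLong1; fun_prop
    · unfold xiLong1 xiLong2; fun_prop
  measurable_a := by unfold zetaLong2 xiLong1; fun_prop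
  measurable_b := by fun_prop
  measurable_c := by unfold xiLong1 xiLong2; fun_prop
  measurable_r := by unfold xiLong1 xiLong2; fun_prop
  measurable_s := by unfold xiLong1 xiLong2; fun_prop
  X_pos := by positivity
  σ_nonneg := le_rfl
  σ_le_one := zero_le_one

lemma integrandLong_eq_left {f : ℝ → ℝ} (hf : Measurable f) (hfs : Function.support f ⊆ Icc 1 2)
    {A₁ A₂ X₁ X₂ R₁ R₂ : ℝ} (hA₁ : 0 < A₁) (hA₂ : 0 < A₂) (hX₁ : 0 < X₁) (h1 : 1 ≤ R₁)
    (h12 : R₁ ≤ R₂) (τ : ℝ × ℝ) (y₁ y₂ : ℝ) (x : ℝ × ℝ × ℝ × ℝ) (hy₁ : 0 < y₁) (hy₂ : 0 < y₂) :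
    integrandLong f A₁ A₂ X₁ X₂ R₁ R₂ τ (y₁, y₂) x
    = (dataLongLeft hf hA₁ hX₁ A₂ X₂ R₁ R₂).amplitude f ((y₂, x), y₁)
      * (dataLongLeft hf hA₁ hX₁ A₂ X₂ R₁ R₂).twist τ ((y₂, x), y₁) := by
  obtain ⟨x₁, x₂, x₄, x₅⟩ := x
  have hξ₁ := xiLong1_pos x₁ x₂ x₄ x₅
  have hξ₂ := xiLong2_pos x₁ x₂ x₄ x₅
  rw [integrandLong]
  dsimp only
  set ξ₁ := xiLong1 x₁ x₂ x₄ x₅ with hξ₁d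
  set ξ₂ := xiLong2 x₁ x₂ x₄ x₅ with hξ₂d
  have hs : 0 < √ξ₁ := Real.sqrt_pos.2 hξ₁
  have hu : A₁ * √ξ₁ / (ξ₂ * y₁) = A₁ * √ξ₁ / ξ₂ / y₁ := by field_simp
  rw [mul_assoc (_ * _) (testF _ _ _ _ _ _ _ _ _) (conj _),
    testF_mul_conj h1 h12 (by positivity) (by positivity) (by positivity) (by positivity)]
  have hlog : Real.log (A₁ * √ξ₁ / (ξ₂ * y₁)) - Real.log (A₁ * y₁)
      = Real.log (A₁ * √ξ₁ / ξ₂) - Real.log A₁ - 2 * Real.log y₁ := by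
    rw [hu, Real.log_div (by positivity) (by positivity), Real.log_mul hA₁.ne' hy₁.ne']; ring
  have htw : (dataLongLeft hf hA₁ hX₁ A₂ X₂ R₁ R₂).twist τ ((y₂, x₁, x₂, x₄, x₅), y₁)
      = Complex.exp (Complex.I *
        ((τ.1 * (Real.log (A₁ * √ξ₁ / (ξ₂ * y₁)) - Real.log (A₁ * y₁))
        + τ.2 * (Real.log (A₁ * √ξ₁ / (ξ₂ * y₁)) - Real.log (A₁ * y₁)
          + (Real.log (A₂ * ξ₂ / (ξ₁ * y₂)) - Real.log (A₂ * y₂))) : ℝ) : ℂ)) := by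
    rw [hlog]
    simp only [PhaseData.twist, dataLongLeft, ← hξ₁d, ← hξ₂d]
    congr 3; ring
  rw [← htw, hu]
  generalize (dataLongLeft hf hA₁ hX₁ A₂ X₂ R₁ R₂).twist τ ((y₂, x₁, x₂, x₄, x₅), y₁) = tw
  have harg : X₁ * (A₁ * √ξ₁ / ξ₂ / y₁) = X₁ * (A₁ * √ξ₁ / ξ₂) / y₁ := by ring
  have harg' : X₁ * (A₁ * y₁) = A₁ * X₁ * y₁ := by ring
  have he : e (A₁ * zetaLong1 x₁ x₂ x₄ x₅ / (ξ₂ * y₁))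
        * e (A₂ * zetaLong2 x₁ x₂ x₄ x₅ / (ξ₁ * y₂)) * e (-(A₁ * x₁ * y₁) - A₂ * x₅ * y₂)
      = e (A₁ * zetaLong1 x₁ x₂ x₄ x₅ / ξ₂ / y₁ + -(A₁ * x₁) * y₁)
        * (e (A₂ * zetaLong2 x₁ x₂ x₄ x₅ / (ξ₁ * y₂)) * e (-(A₂ * x₅ * y₂))) := by
    rw [← e_add, ← e_add, ← e_add, ← e_add]; congr 1; field_simp; ring
  have hr : ((1 / (y₁ * y₂) : ℝ) : ℂ) = ((1 / y₂ : ℝ) : ℂ) * ((1 / y₁ : ℝ) : ℂ) := by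
    rw [← Complex.ofReal_mul]; congr 1; field_simp
  rw [harg, harg', hr, he]
  simp only [PhaseData.amplitude, dataLongLeft]
  by_cases hp : (y₂, x₁, x₂, x₄, x₅) ∈ PhaseData.overlap (fun p : ℝ × ℝ × ℝ × ℝ × ℝ =>
      X₁ * (A₁ * √(xiLong1 p.2.1 p.2.2.1 p.2.2.2.1 p.2.2.2.2)
      / xiLong2 p.2.1 p.2.2.1 p.2.2.2.1 p.2.2.2.2)) (A₁ * X₁)
  · rw [indicator_of_mem hp]
    ring
  · have h0 := PhaseData.bumps_eq_zero_of_notMem_overlap hfs hy₁ hp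
    dsimp only at h0
    rw [← hξ₁d, ← hξ₂d] at h0
    rw [indicator_of_notMem hp, zero_mul, zero_mul]
    linear_combination ((calR R₁ R₂ : ℂ) * e (A₁ * zetaLong1 x₁ x₂ x₄ x₅ / ξ₂ / y₁
      + -(A₁ * x₁) * y₁) * (e (A₂ * zetaLong2 x₁ x₂ x₄ x₅ / (ξ₁ * y₂)) * e (-(A₂ * x₅ * y₂)))
      * f (X₂ * (A₂ * ξ₂ / (ξ₁ * y₂))) * f (X₂ * (A₂ * y₂))
      * tw * (((1 / y₂ : ℝ) : ℂ) * ((1 / y₁ : ℝ) : ℂ))) * h0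

lemma integrandLong_eq_right {f : ℝ → ℝ} (hf : Measurable f) (hfs : Function.support f ⊆ Icc 1 2)
    {A₁ A₂ X₁ X₂ R₁ R₂ : ℝ} (hA₁ : 0 < A₁) (hA₂ : 0 < A₂) (hX₂ : 0 < X₂) (h1 : 1 ≤ R₁)
    (h12 : R₁ ≤ R₂) (τ : ℝ × ℝ) (y₁ y₂ : ℝ) (x : ℝ × ℝ × ℝ × ℝ) (hy₁ : 0 < y₁) (hy₂ : 0 < y₂) :
    integrandLong f A₁ A₂ X₁ X₂ R₁ R₂ τ (y₁, y₂) x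
    = (dataLongRight hf hA₂ hX₂ A₁ X₁ R₁ R₂).amplitude f ((y₁, x), y₂)
      * (dataLongRight hf hA₂ hX₂ A₁ X₁ R₁ R₂).twist τ ((y₁, x), y₂) := by
  obtain ⟨x₁, x₂, x₄, x₅⟩ := x
  have hξ₁ := xiLong1_pos x₁ x₂ x₄ x₅
  have hξ₂ := xiLong2_pos x₁ x₂ x₄ x₅
  rw [integrandLong]
  dsimp only
  set ξ₁ := xiLong1 x₁ x₂ x₄ x₅ with hξ₁d
  set ξ₂ := xiLong2 x₁ x₂ x₄ x₅ with hξ₂d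
  have hs : 0 < √ξ₁ := Real.sqrt_pos.2 hξ₁
  have hu : A₂ * ξ₂ / (ξ₁ * y₂) = A₂ * ξ₂ / ξ₁ / y₂ := by field_simp
  rw [mul_assoc (_ * _) (testF _ _ _ _ _ _ _ _ _) (conj _),
    testF_mul_conj h1 h12 (by positivity) (by positivity) (by positivity) (by positivity)]
  have hlog : Real.log (A₂ * ξ₂ / (ξ₁ * y₂)) - Real.log (A₂ * y₂)
      = Real.log (A₂ * ξ₂ / ξ₁) - Real.log A₂ - 2 * Real.log y₂ := by
    rw [hu, Real.log_div (by positivity) (by positivity), Real.log_mul hA₂.ne' hy₂.ne']; ring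
  have htw : (dataLongRight hf hA₂ hX₂ A₁ X₁ R₁ R₂).twist τ ((y₁, x₁, x₂, x₄, x₅), y₂)
      = Complex.exp (Complex.I *
        ((τ.1 * (Real.log (A₁ * √ξ₁ / (ξ₂ * y₁)) - Real.log (A₁ * y₁))
        + τ.2 * (Real.log (A₁ * √ξ₁ / (ξ₂ * y₁)) - Real.log (A₁ * y₁)
          + (Real.log (A₂ * ξ₂ / (ξ₁ * y₂)) - Real.log (A₂ * y₂))) : ℝ) : ℂ)) := by
    rw [hlog]
    simp only [PhaseData.twist, dataLongRight, ← hξ₁d, ← hξ₂d]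
    congr 3; ring
  rw [← htw, hu]
  generalize (dataLongRight hf hA₂ hX₂ A₁ X₁ R₁ R₂).twist τ ((y₁, x₁, x₂, x₄, x₅), y₂) = tw
  have harg : X₂ * (A₂ * ξ₂ / ξ₁ / y₂) = X₂ * (A₂ * ξ₂ / ξ₁) / y₂ := by ring
  have harg' : X₂ * (A₂ * y₂) = A₂ * X₂ * y₂ := by ring
  have he : e (A₁ * zetaLong1 x₁ x₂ x₄ x₅ / (ξ₂ * y₁))
        * e (A₂ * zetaLong2 x₁ x₂ x₄ x₅ / (ξ₁ * y₂)) * e (-(A₁ * x₁ * y₁) - A₂ * x₅ * y₂)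
      = e (A₂ * zetaLong2 x₁ x₂ x₄ x₅ / ξ₁ / y₂ + -(A₂ * x₅) * y₂)
        * (e (A₁ * zetaLong1 x₁ x₂ x₄ x₅ / (ξ₂ * y₁)) * e (-(A₁ * x₁ * y₁))) := by
    rw [← e_add, ← e_add, ← e_add, ← e_add]; congr 1; field_simp; ring
  have hr : ((1 / (y₁ * y₂) : ℝ) : ℂ) = ((1 / y₁ : ℝ) : ℂ) * ((1 / y₂ : ℝ) : ℂ) := by
    rw [← Complex.ofReal_mul]; congr 1; field_simp
  rw [harg, harg', hr, he]
  simp only [PhaseData.amplitude, dataLongRight]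
  by_cases hp : (y₁, x₁, x₂, x₄, x₅) ∈ PhaseData.overlap (fun p : ℝ × ℝ × ℝ × ℝ × ℝ =>
      X₂ * (A₂ * xiLong2 p.2.1 p.2.2.1 p.2.2.2.1 p.2.2.2.2
      / xiLong1 p.2.1 p.2.2.1 p.2.2.2.1 p.2.2.2.2)) (A₂ * X₂)
  · rw [indicator_of_mem hp]
    ring
  · have h0 := PhaseData.bumps_eq_zero_of_notMem_overlap hfs hy₂ hp
    dsimp only at h0
    rw [← hξ₁d, ← hξ₂d] at h0
    rw [indicator_of_notMem hp, zero_mul, zero_mul]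
    linear_combination ((calR R₁ R₂ : ℂ) * e (A₂ * zetaLong2 x₁ x₂ x₄ x₅ / ξ₁ / y₂
      + -(A₂ * x₅) * y₂) * (e (A₁ * zetaLong1 x₁ x₂ x₄ x₅ / (ξ₂ * y₁)) * e (-(A₁ * x₁ * y₁)))
      * f (X₁ * (A₁ * √ξ₁ / (ξ₂ * y₁))) * f (X₁ * (A₁ * y₁))
      * tw * (((1 / y₁ : ℝ) : ℂ) * ((1 / y₂ : ℝ) : ℂ))) * h0

lemma JLong_eq_left {f : ℝ → ℝ} (hf : Measurable f) (hf01 : ∀ x, f x ∈ Icc (0 : ℝ) 1)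
    (hfs : Function.support f ⊆ Icc 1 2) {A₁ A₂ X₁ X₂ R₁ R₂ : ℝ} (hA₁ : 0 < A₁) (hA₂ : 0 < A₂)
    (hX₁ : 0 < X₁) (h1 : 1 ≤ R₁) (h12 : R₁ ≤ R₂)
    (hw : Integrable (dataLongLeft hf hA₁ hX₁ A₂ X₂ R₁ R₂).w
      ((volume.restrict (Ioi 0)).prod volume)) (τ : ℝ × ℝ) :
    JLong (testF f τ.1 τ.2 X₁ X₂ R₁ R₂) A₁ A₂ = ((A₁ ^ 4 * A₂ ^ 3)⁻¹ : ℝ)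
      * ∫ q, (dataLongLeft hf hA₁ hX₁ A₂ X₂ R₁ R₂).amplitude f q
        * (dataLongLeft hf hA₁ hX₁ A₂ X₂ R₁ R₂).twist τ q
        ∂(((volume.restrict (Ioi 0)).prod volume).prod (volume.restrict (Ioi 0))) := by
  rw [JLong]
  congr 1
  exact setIntegral_posQuadrant_eq_left
    ((dataLongLeft hf hA₁ hX₁ A₂ X₂ R₁ R₂).integrable_amplitude_mul_twist hf hf01 hfs hw τ)
    (integrandLong_eq_left hf hfs hA₁ hA₂ hX₁ h1 h12 τ)

lemma JLong_eq_right {f : ℝ → ℝ} (hf : Measurable f) (hf01 : ∀ x, f x ∈ Icc (0 : ℝ) 1)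
    (hfs : Function.support f ⊆ Icc 1 2) {A₁ A₂ X₁ X₂ R₁ R₂ : ℝ} (hA₁ : 0 < A₁) (hA₂ : 0 < A₂)
    (hX₂ : 0 < X₂) (h1 : 1 ≤ R₁) (h12 : R₁ ≤ R₂)
    (hw : Integrable (dataLongRight hf hA₂ hX₂ A₁ X₁ R₁ R₂).w
      ((volume.restrict (Ioi 0)).prod volume)) (τ : ℝ × ℝ) :
    JLong (testF f τ.1 τ.2 X₁ X₂ R₁ R₂) A₁ A₂ = ((A₁ ^ 4 * A₂ ^ 3)⁻¹ : ℝ)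
      * ∫ q, (dataLongRight hf hA₂ hX₂ A₁ X₁ R₁ R₂).amplitude f q
        * (dataLongRight hf hA₂ hX₂ A₁ X₁ R₁ R₂).twist τ q
        ∂(((volume.restrict (Ioi 0)).prod volume).prod (volume.restrict (Ioi 0))) := by
  rw [JLong]
  congr 1
  exact setIntegral_posQuadrant_eq_right
    ((dataLongRight hf hA₂ hX₂ A₁ X₁ R₁ R₂).integrable_amplitude_mul_twist hf hf01 hfs hw τ)
    (integrandLong_eq_right hf hfs hA₁ hA₂ hX₂ h1 h12 τ)

/-! ### Support, phase and volume bounds for αβα -/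

lemma support_ABA_bounds {A X₁ X₂ ξ₁ ξ₂ u y : ℝ} (hA : 0 < A) (hX₁ : 0 < X₁) (hX₂ : 0 < X₂)
    (hξ₂ : 0 < ξ₂) (hu : 0 < u) (hu2 : u ^ 2 = ξ₁) (ht1 : 1 ≤ X₂ * y)
    (ht2 : X₂ * y ≤ 2) (h1 : 1 ≤ X₂ * (ξ₂ * y / ξ₁)) (h2 : X₂ * (ξ₂ * y / ξ₁) ≤ 2)
    (h3 : 1 ≤ X₁ * (A * u / (ξ₂ * y)) * (A * X₁))
    (h4 : X₁ * (A * u / (ξ₂ * y)) * (A * X₁) ≤ 4) :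
    u ≤ A ^ 2 * X₁ ^ 2 * X₂ ∧ ξ₂ ≤ (A ^ 2 * X₁ ^ 2 * X₂) ^ 2 ∧ ξ₁ ≤ (A ^ 2 * X₁ ^ 2 * X₂) ^ 2
      ∧ (A ^ 2 * X₁ ^ 2 * X₂) ^ 2 ≤ 128 * ξ₂ := by
  have hξ₁ : 0 < ξ₁ := by rw [← hu2]; positivity
  have hy : 0 < y := by
    by_contra h
    have := mul_nonpos_of_nonneg_of_nonpos hX₂.le (not_lt.1 h)
    linarith
  set M := A ^ 2 * X₁ ^ 2 * X₂ with hM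
  have hM0 : 0 < M := by positivity
  set t := X₂ * y with ht
  have e1 : X₂ * (ξ₂ * y / ξ₁) = ξ₂ * t / ξ₁ := by rw [ht]; ring
  have e2 : X₁ * (A * u / (ξ₂ * y)) * (A * X₁) = M * u / (ξ₂ * t) := by
    rw [ht, hM]; field_simp
  rw [e1, le_div_iff₀ hξ₁, one_mul] at h1
  rw [e1, div_le_iff₀ hξ₁] at h2
  have ht0 : 0 < t := by linarith
  rw [e2, le_div_iff₀ (by positivity), one_mul] at h3
  rw [e2, div_le_iff₀ (by positivity)] at h4
  -- With `t` in `[1, 2]` the supports say `u² ≤ ξ₂t ≤ 2u²` and `ξ₂t ≤ Mu ≤ 4ξ₂t`. Comparing them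
  -- gives `u ≤ M ≤ 8u`, and then `M² ≤ 64u² ≤ 128ξ₂`.
  have huM : u ≤ M := by
    have : u * u ≤ M * u := by nlinarith
    exact le_of_mul_le_mul_right this hu
  have hMu : M ≤ 8 * u := by
    have : M * u ≤ 8 * u * u := by nlinarith
    exact le_of_mul_le_mul_right this hu
  have hξt : ξ₂ ≤ ξ₂ * t := by nlinarith
  have hξt2 : ξ₂ * t ≤ 2 * ξ₂ := by nlinarith
  refine ⟨huM, ?_, ?_, ?_⟩ <;> nlinarith

/-- With `M = A²X₁²X₂`, both bounds come from `u ≤ M`: `|x₁| ≤ √M = A X₁ √X₂` and `z² ≤ Mξ₂`, the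
latter combined with `M² ≤ 128ξ₂`. Any constant from `√128` on would serve in place of 100. -/
lemma phase_ABA_bounds {A X₁ X₂ ξ₂ u y z x₁ : ℝ} (hA : 0 < A) (hX₁ : 0 < X₁) (hX₂ : 0 < X₂)
    (hξ₂ : 0 < ξ₂) (ht1 : 1 ≤ X₂ * y) (huM : u ≤ A ^ 2 * X₁ ^ 2 * X₂)
    (hMξ : (A ^ 2 * X₁ ^ 2 * X₂) ^ 2 ≤ 128 * ξ₂) (hx : x₁ ^ 2 ≤ u) (hz : z ^ 2 ≤ u * ξ₂) :
    |A * z / (ξ₂ * y)| * (A * X₁) ≤ 100 * (A * √X₂)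
      ∧ |-(A * x₁)| ≤ 100 * (A * √X₂) * (A * X₁) := by
  set v := √X₂ with hv
  have hv0 : 0 < v := Real.sqrt_pos.2 hX₂
  have hv2 : X₂ = v ^ 2 := (Real.sq_sqrt hX₂.le).symm
  have hy : 0 < y := by
    by_contra h
    have := mul_nonpos_of_nonneg_of_nonpos hX₂.le (not_lt.1 h)
    linarith
  constructor
  · have h1 : (A * X₁ * X₂ * |z|) ^ 2 ≤ (100 * v * ξ₂) ^ 2 := by
      rw [mul_pow, sq_abs]
      calc (A * X₁ * X₂) ^ 2 * z ^ 2 ≤ (A * X₁ * X₂) ^ 2 * (u * ξ₂) := by gcongr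
        _ ≤ (A * X₁ * X₂) ^ 2 * ((A ^ 2 * X₁ ^ 2 * X₂) * ξ₂) := by gcongr
        _ = X₂ * (A ^ 2 * X₁ ^ 2 * X₂) ^ 2 * ξ₂ := by ring
        _ ≤ X₂ * (128 * ξ₂) * ξ₂ := by gcongr
        _ ≤ _ := by rw [hv2]; nlinarith [mul_pos (pow_pos hv0 2) (pow_pos hξ₂ 2)]
    have h2 : A * X₁ * X₂ * |z| ≤ 100 * v * ξ₂ := by
      exact (sq_le_sq₀ (by positivity) (by positivity)).1 h1
    rw [abs_div, abs_mul, abs_of_pos hA, abs_of_pos (show 0 < ξ₂ * y by positivity),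
      div_mul_eq_mul_div, div_le_iff₀ (by positivity)]
    have h3 : A * X₁ * |z| ≤ A * X₁ * |z| * (X₂ * y) :=
      le_mul_of_one_le_right (by positivity) ht1
    calc A * |z| * (A * X₁) = A * (A * X₁ * |z|) := by ring
      _ ≤ A * (A * X₁ * |z| * (X₂ * y)) := by gcongr
      _ = A * y * (A * X₁ * X₂ * |z|) := by ring
      _ ≤ A * y * (100 * v * ξ₂) := by gcongr
      _ = _ := by ring
  · have h1 : |x₁| ≤ A * X₁ * v := by
      refine abs_le_of_sq_le_sq ?_ (by positivity)
      calc x₁ ^ 2 ≤ A ^ 2 * X₁ ^ 2 * X₂ := hx.trans huM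
        _ = _ := by rw [hv2]; ring
    rw [abs_neg, abs_mul, abs_of_pos hA]
    have h2 : 0 < A * X₁ * v := by positivity
    calc A * |x₁| ≤ A * (A * X₁ * v) := by gcongr
      _ ≤ A * (100 * (A * X₁ * v)) := mul_le_mul_of_nonneg_left (by linarith) hA.le
      _ = _ := by ring

lemma dataABA_support {f : ℝ → ℝ} (hf : Measurable f) (hf01 : ∀ x, f x ∈ Icc (0 : ℝ) 1)
    (hfs : Function.support f ⊆ Icc 1 2) {A X₁ X₂ R₁ R₂ : ℝ} (hA : 0 < A) (hX₁ : 0 < X₁)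
    (hX₂ : 0 < X₂) (h1 : 1 ≤ R₁) (h12 : R₁ ≤ R₂) {p : ℝ × ℝ × ℝ × ℝ}
    (hp : (dataABA hf hA hX₁ X₂ R₁ R₂).w p ≠ 0) :
    p.1 ∈ Icc (1 / X₂) (2 / X₂) ∧ ‖(dataABA hf hA hX₁ X₂ R₁ R₂).w p‖ ≤ calR R₁ R₂ * X₂ ^ 2
      ∧ √(xiABA1 p.2.1 p.2.2.1 p.2.2.2) ≤ A ^ 2 * X₁ ^ 2 * X₂
      ∧ xiABA2 p.2.1 p.2.2.1 p.2.2.2 ≤ (A ^ 2 * X₁ ^ 2 * X₂) ^ 2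
      ∧ xiABA1 p.2.1 p.2.2.1 p.2.2.2 ≤ (A ^ 2 * X₁ ^ 2 * X₂) ^ 2
      ∧ (A ^ 2 * X₁ ^ 2 * X₂) ^ 2 ≤ 128 * xiABA2 p.2.1 p.2.2.1 p.2.2.2 := by
  have hp' := hp
  simp only [dataABA] at hp'
  have hmem := mem_of_indicator_ne_zero hp'
  have hval := indicator_of_mem hmem fun p : ℝ × ℝ × ℝ × ℝ =>
    calR R₁ R₂ * e (zetaABA2 p.2.1 p.2.2.1 p.2.2.2 * p.1 / xiABA1 p.2.1 p.2.2.1 p.2.2.2)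
      * f (X₂ * (xiABA2 p.2.1 p.2.2.1 p.2.2.2 * p.1 / xiABA1 p.2.1 p.2.2.1 p.2.2.2))
      * f (X₂ * p.1) * ((1 / p.1 ^ 2 : ℝ) : ℂ)
  have hw : (dataABA hf hA hX₁ X₂ R₁ R₂).w p = calR R₁ R₂
      * e (zetaABA2 p.2.1 p.2.2.1 p.2.2.2 * p.1 / xiABA1 p.2.1 p.2.2.1 p.2.2.2)
      * f (X₂ * (xiABA2 p.2.1 p.2.2.1 p.2.2.2 * p.1 / xiABA1 p.2.1 p.2.2.1 p.2.2.2))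
      * f (X₂ * p.1) * ((1 / p.1 ^ 2 : ℝ) : ℂ) := hval
  rw [hw] at hp ⊢
  obtain ⟨a1, a2⟩ := mem_Icc_of_support hfs (right_ne_zero_of_mul (left_ne_zero_of_mul hp))
  obtain ⟨b1, b2⟩ := mem_Icc_of_support hfs
    (right_ne_zero_of_mul (left_ne_zero_of_mul (left_ne_zero_of_mul hp)))
  have hl : 1 / X₂ ≤ p.1 := by rw [div_le_iff₀ hX₂]; linarith
  have hp0 : 0 < p.1 := lt_of_lt_of_le (by positivity) hl
  refine ⟨⟨hl, by rw [le_div_iff₀ hX₂]; linarith⟩, ?_,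
    support_ABA_bounds hA hX₁ hX₂ (xiABA2_pos _ _ _) (Real.sqrt_pos.2 (xiABA1_pos _ _ _))
      (Real.sq_sqrt (xiABA1_pos _ _ _).le) a1 a2 b1 b2 hmem.1 hmem.2⟩
  have hc := calR_nonneg h1 h12
  refine norm_weight_le hf01 ?_ ?_ _ _
  · rw [norm_mul, norm_e, mul_one, Complex.norm_real, Real.norm_of_nonneg hc]
  · rw [abs_of_pos (by positivity), div_le_iff₀ (by positivity), ← mul_pow]
    exact one_le_pow₀ a1

lemma abs_le_of_sq_le_xi {x ξ M : ℝ} (hM : 0 ≤ M) (h : x ^ 2 ≤ ξ) (h' : ξ ≤ M ^ 2) :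
    x ∈ Icc (-M) M :=
  abs_le.1 (abs_le_of_sq_le_sq (h.trans h') hM)

/-- The factor `k` lets one argument cover the total mass and the localised mass. Here `r - s = -log
(ξ₂/ξ₁)`, so the kernel is at most `R₁ ^ η` times the weight at `(ξ₂ - ξ₁)/M²`. On the support this
point has absolute value at most 1, so the same majorant is at least 1 and also dominates `k ≤ 1`.
-/
lemma dataABA_lintegral_le {f : ℝ → ℝ} (hf : Measurable f) (hf01 : ∀ x, f x ∈ Icc (0 : ℝ) 1)
    (hfs : Function.support f ⊆ Icc 1 2) {A X₁ X₂ R₁ R₂ η : ℝ} (hA : 0 < A) (hX₁ : 0 < X₁)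
    (hX₂ : 0 < X₂) (h1 : 1 ≤ R₁) (h12 : R₁ ≤ R₂) (hη0 : 0 < η) (hη : η < 1)
    {k : ℝ × ℝ × ℝ × ℝ → ℝ≥0∞}
    (hk : ∀ p, k p ≤ 1 ∨ k p = ENNReal.ofReal (R₁ / (1 + R₁ *
      |(dataABA hf hA hX₁ X₂ R₁ R₂).r p
        - (dataABA hf hA hX₁ X₂ R₁ R₂).σ * (dataABA hf hA hX₁ X₂ R₁ R₂).s p|) ^ 2)) :
    ∫⁻ p, ‖(dataABA hf hA hX₁ X₂ R₁ R₂).w p‖ₑ * k p ∂((volume.restrict (Ioi 0)).prod volume)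
      ≤ ENNReal.ofReal (calR R₁ R₂ * X₂ * (R₁ ^ η * ((A ^ 2 * X₁ ^ 2 * X₂) ^ (2 * (1 - η))
          * singMass η (A ^ 2 * X₁ ^ 2 * X₂) ^ 3))) := by
  set M := A ^ 2 * X₁ ^ 2 * X₂ with hM
  have hM0 : 0 < M := by positivity
  have hmass := singMass_pos hη0 hM0
  have hR := Real.one_le_rpow h1 hη0.le
  have hc := calR_nonneg h1 h12
  set Box : Set (ℝ × ℝ × ℝ) := Icc (-M) M ×ˢ Icc (-M) M ×ˢ Icc (-M) M with hBox
  have hBoxm : MeasurableSet Box :=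
    measurableSet_Icc.prod (measurableSet_Icc.prod measurableSet_Icc)
  set S : ℝ × ℝ × ℝ → ℝ≥0∞ := fun x =>
    singWeight η (xiABA2 x.1 x.2.1 x.2.2 - xiABA1 x.1 x.2.1 x.2.2) with hS
  have hSm : Measurable S := by rw [hS]; unfold xiABA2 xiABA1; fun_prop
  have hsM : singWeight η (1 / M ^ 2) = ENNReal.ofReal (M ^ (2 * (1 - η))) := by
    rw [singWeight_of_ne_zero (by positivity), abs_of_pos (by positivity), one_div,
      Real.inv_rpow (by positivity), Real.rpow_neg (by positivity), inv_inv,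
      ← Real.rpow_natCast, ← Real.rpow_mul hM0.le]
    norm_num
  refine (lintegral_weight_le (B := calR R₁ R₂ * X₂ ^ 2) (l := 1 / X₂) (u := 2 / X₂)
    (Ψ := fun x => ENNReal.ofReal (R₁ ^ η) * (ENNReal.ofReal (M ^ (2 * (1 - η)))
      * Box.indicator S x)) ?_ ?_).trans ?_
  · exact ((hSm.indicator hBoxm).const_mul _).const_mul _
  · intro p hp
    obtain ⟨m1, m2, -, m4, m5, -⟩ := dataABA_support hf hf01 hfs hA hX₁ hX₂ h1 h12 hp
    refine ⟨m1, m2, ?_⟩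
    have hξ₁ := xiABA1_pos p.2.1 p.2.2.1 p.2.2.2
    have hξ₂ := xiABA2_pos p.2.1 p.2.2.1 p.2.2.2
    have hin : p.2 ∈ Box := by
      refine ⟨abs_le_of_sq_le_xi hM0.le ?_ m4, abs_le_of_sq_le_xi hM0.le ?_ m4,
        abs_le_of_sq_le_xi hM0.le ?_ m4⟩ <;>
      · unfold xiABA2; nlinarith [sq_nonneg p.2.1, sq_nonneg p.2.2.1, sq_nonneg p.2.2.2]
    have hp0 : 0 < p.1 := lt_of_lt_of_le (by positivity) m1.1
    rw [indicator_of_mem hin, ← hsM, hS, ← singWeight_mul hη]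
    set ξ₁ := xiABA1 p.2.1 p.2.2.1 p.2.2.2 with hξ₁d
    set ξ₂ := xiABA2 p.2.1 p.2.2.1 p.2.2.2 with hξ₂d
    have habs : |1 / M ^ 2 * (ξ₂ - ξ₁)| = |ξ₂ - ξ₁| / M ^ 2 := by
      rw [abs_mul, abs_of_pos (by positivity)]; ring
    rcases hk p with hk1 | hk2
    · refine hk1.trans ?_
      calc (1 : ℝ≥0∞) = 1 * 1 := (one_mul 1).symm
        _ ≤ _ := by
          refine mul_le_mul' (ENNReal.one_le_ofReal.2 hR) (one_le_singWeight hη ?_)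
          rw [habs, div_le_one (by positivity), abs_le]
          constructor <;> linarith
    · rw [hk2]
      refine (ofReal_localisation_le hη0 hη h1 _).trans ?_
      gcongr
      refine singWeight_anti hη ?_
      have hd : (dataABA hf hA hX₁ X₂ R₁ R₂).r p
        - (dataABA hf hA hX₁ X₂ R₁ R₂).σ * (dataABA hf hA hX₁ X₂ R₁ R₂).s p
        = -Real.log (ξ₂ / ξ₁) := by
        simp only [dataABA, ← hξ₁d, ← hξ₂d]
        rw [mul_div_right_comm ξ₂, Real.log_mul (x := ξ₂ / ξ₁) (by positivity) (by positivity)]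
        ring
      rw [hd, abs_neg, habs, div_le_iff₀ (by positivity), mul_comm]
      exact abs_sub_le_mul_abs_log hξ₂ hξ₁ m4 m5
  · rw [lintegral_const_mul _ ((hSm.indicator hBoxm).const_mul _),
      lintegral_const_mul _ (hSm.indicator hBoxm), lintegral_indicator hBoxm]
    calc _ ≤ ENNReal.ofReal (calR R₁ R₂ * X₂ ^ 2) * ENNReal.ofReal (2 / X₂ - 1 / X₂)
          * (ENNReal.ofReal (R₁ ^ η) * (ENNReal.ofReal (M ^ (2 * (1 - η)))
            * ENNReal.ofReal (singMass η M ^ 3))) := by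
          gcongr
          exact lintegral_singWeight_ABA_le hη0 hη hM0
      _ = _ := by
          rw [show 2 / X₂ - 1 / X₂ = 1 / X₂ by ring, ← ENNReal.ofReal_mul (by positivity),
            ← ENNReal.ofReal_mul (by positivity), ← ENNReal.ofReal_mul (by positivity),
            ← ENNReal.ofReal_mul (by positivity)]
          congr 2
          field_simp

lemma norm_integral_mul_const_mul_le {a b : ℝ × ℝ → ℂ} {J : ℝ × ℝ → ℂ} {c B : ℝ} (hc : 0 < c)
    (hJ : ∀ τ, J τ = (c⁻¹ : ℝ) * b τ) (h : ‖∫ τ, a τ * b τ‖ ≤ c * B) :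
    ‖∫ τ, a τ * J τ‖ ≤ B := by
  have : ∀ τ, a τ * J τ = (c⁻¹ : ℝ) * (a τ * b τ) := fun τ => by rw [hJ]; ring
  simp_rw [this]
  rw [integral_const_mul, norm_mul, Complex.norm_real, Real.norm_of_nonneg (by positivity),
    inv_mul_le_iff₀ hc]
  exact h

/-- Power count: `M^(2(1-η))` times `M^(3η)` is `M^(2+η)`, and `X₂M² = A⁴X₁⁴X₂³`. The surplus `M^η`
goes into the `ε`-powers, which uses `M ≥ 1`. -/
lemma volume_ABA_le {A X₁ X₂ R₁ c η ε : ℝ} (hA : 0 < A) (hX₁ : 1 ≤ X₁) (hX₂ : 1 ≤ X₂)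
    (h1 : 1 ≤ R₁) (hc : 0 ≤ c) (hη0 : 0 < η) (hηε : η ≤ ε / 2)
    (hM : 1 ≤ A ^ 2 * X₁ ^ 2 * X₂) :
    c * X₂ * (R₁ ^ η * ((A ^ 2 * X₁ ^ 2 * X₂) ^ (2 * (1 - η))
          * singMass η (A ^ 2 * X₁ ^ 2 * X₂) ^ 3))
      ≤ A ^ 4 * ((2 / η + 2) ^ 3 * c * A ^ ε * R₁ ^ ε * (X₁ ^ 4 * X₂ ^ 3) ^ (1 + ε)) := by
  set M := A ^ 2 * X₁ ^ 2 * X₂ with hMd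
  have hM0 : 0 < M := by linarith
  have hX₁' : 0 < X₁ := by linarith
  have hX₂' : 0 < X₂ := by linarith
  have hR' : 0 < R₁ := by linarith
  have e1 : M ^ (2 * (1 - η)) * singMass η M ^ 3 = (2 / η + 2) ^ 3 * (M ^ 2 * M ^ η) := by
    rw [singMass, mul_pow, ← Real.rpow_natCast (M ^ η) 3, ← Real.rpow_mul hM0.le,
      ← Real.rpow_natCast M 2, ← Real.rpow_add hM0, mul_left_comm, ← Real.rpow_add hM0]
    congr 2; push_cast; ring
  have e2 : M ^ η ≤ A ^ ε * (X₁ ^ 4 * X₂ ^ 3) ^ ε := by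
    calc M ^ η ≤ M ^ (ε / 2) := Real.rpow_le_rpow_of_exponent_le hM hηε
      _ ≤ ((A * (X₁ ^ 4 * X₂ ^ 3)) ^ 2) ^ (ε / 2) := by
          refine Real.rpow_le_rpow hM0.le ?_ (by linarith)
          rw [hMd, mul_pow, mul_assoc]
          gcongr
          calc X₁ ^ 2 * X₂ ≤ X₁ ^ 8 * X₂ ^ 6 := by
                gcongr
                · norm_num
                · exact le_self_pow₀ hX₂ (by norm_num)
            _ = _ := by ring
      _ = (A * (X₁ ^ 4 * X₂ ^ 3)) ^ ε := by
          rw [← Real.rpow_natCast, ← Real.rpow_mul (by positivity)]; congr 1; push_cast; ring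
      _ = _ := Real.mul_rpow hA.le (by positivity)
  have e3 : R₁ ^ η ≤ R₁ ^ ε := Real.rpow_le_rpow_of_exponent_le h1 (by linarith)
  rw [e1, Real.rpow_add (by positivity), Real.rpow_one]
  calc c * X₂ * (R₁ ^ η * ((2 / η + 2) ^ 3 * (M ^ 2 * M ^ η)))
      ≤ c * X₂ * (R₁ ^ ε * ((2 / η + 2) ^ 3 * (M ^ 2 * (A ^ ε * (X₁ ^ 4 * X₂ ^ 3) ^ ε)))) := by
        gcongr
    _ = _ := by rw [hMd]; ring

lemma exists_bound_ABA {f : ℝ → ℝ} (hf : ContDiff ℝ ∞ f)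
    (hf01 : ∀ x, f x ∈ Icc (0 : ℝ) 1) (hfs : Function.support f ⊆ Icc 1 2)
    {g : ℝ → ℝ} (hg : ContDiff ℝ ∞ g) (hgc : HasCompactSupport g) (hgpos : tsupport g ⊆ Ioi 0)
    {C ε : ℝ} (hC : 0 ≤ C) (hε : 0 < ε) :
    ∃ K : ℝ, 0 ≤ K ∧ ∀ R₁ R₂ X₁ X₂ A : ℝ, 1 ≤ R₁ → R₁ ≤ R₂ → 1 ≤ X₁ → 1 ≤ X₂ → 0 < A →
      ‖∫ τ : ℝ × ℝ, ((g (τ.1 / R₁) * g (τ.2 / R₂) : ℝ) : ℂ)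
          * JABA (testF f τ.1 τ.2 X₁ X₂ R₁ R₂) A‖
        ≤ K * (calR R₁ R₂ * (A * R₁ * R₂) ^ ε * (X₁ ^ 4 * X₂ ^ 3) ^ (1 + ε)
            * ((1 + A * √X₂) / R₂) ^ C) := by
  obtain ⟨K, hK, hb⟩ := PhaseData.exists_norm_integral_le hf hf01 hfs hg hgc hgpos hC hε
  set η : ℝ := min (1 / 2) (ε / 2) with hη
  have hη0 : 0 < η := lt_min (by norm_num) (by linarith)
  have hη1 : η < 1 := lt_of_le_of_lt (min_le_left _ _) (by norm_num)
  have hηε : η ≤ ε / 2 := min_le_right _ _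
  refine ⟨K * (2 / η + 2) ^ 3, by positivity, fun R₁ R₂ X₁ X₂ A hR₁ hR₁₂ hX₁ hX₂ hA => ?_⟩
  have hX₁' : 0 < X₁ := by linarith
  have hX₂' : 0 < X₂ := by linarith
  have hR₁' : 0 < R₁ := by linarith
  have hR₂' : 0 < R₂ := by linarith
  have hm := hf.continuous.measurable
  have hc := calR_nonneg hR₁ hR₁₂
  set D := dataABA hm hA hX₁' X₂ R₁ R₂ with hD
  set V : ℝ := A ^ 4 * ((2 / η + 2) ^ 3 * calR R₁ R₂ * A ^ ε * R₁ ^ ε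
    * (X₁ ^ 4 * X₂ ^ 3) ^ (1 + ε)) with hV
  have hV0 : 0 ≤ V := by positivity
  have hvol : ∀ k : ℝ × ℝ × ℝ × ℝ → ℝ≥0∞, (∀ p, k p ≤ 1 ∨ k p = ENNReal.ofReal
      (R₁ / (1 + R₁ * |D.r p - D.σ * D.s p|) ^ 2)) →
      ∫⁻ p, ‖D.w p‖ₑ * k p ∂((volume.restrict (Ioi 0)).prod volume) ≤ ENNReal.ofReal V := by
    intro k hk
    by_cases hM : 1 ≤ A ^ 2 * X₁ ^ 2 * X₂
    · refine (dataABA_lintegral_le hm hf01 hfs hA hX₁' hX₂' hR₁ hR₁₂ hη0 hη1 hk).trans ?_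
      exact ENNReal.ofReal_le_ofReal (volume_ABA_le hA hX₁ hX₂ hR₁ hc hη0 hηε hM)
    -- For `M < 1` the condition `ξ₂ ≤ M²` contradicts `ξ₂ ≥ 1`, so the support is empty.
    · have hz : ∀ p, D.w p = 0 := by
        intro p
        by_contra hp
        obtain ⟨-, -, -, h4, -, -⟩ := dataABA_support hm hf01 hfs hA hX₁' hX₂' hR₁ hR₁₂ hp
        have h5 : 1 ≤ xiABA2 p.2.1 p.2.2.1 p.2.2.2 := by
          unfold xiABA2; nlinarith [sq_nonneg p.2.1, sq_nonneg p.2.2.1, sq_nonneg p.2.2.2]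
        have h6 : 0 < A ^ 2 * X₁ ^ 2 * X₂ := by positivity
        exact hM (by nlinarith)
      simp [hz]
  have hv1 := hvol 1 (fun p => Or.inl le_rfl)
  simp only [Pi.one_apply, mul_one] at hv1
  have hw : Integrable D.w ((volume.restrict (Ioi 0)).prod volume) :=
    ⟨D.measurable_w.aestronglyMeasurable, lt_of_le_of_lt hv1 ENNReal.ofReal_lt_top⟩
  refine norm_integral_mul_const_mul_le (c := A ^ 4) (by positivity)
    (JABA_eq hm hf01 hfs hA hX₁' hR₁ hR₁₂ hw) ?_
  refine (hb _ D _ R₁ R₂ (A * √X₂) V hR₁ hR₁₂ (by positivity) hV0 ?_ hv1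
    (hvol _ fun p => Or.inr rfl)).trans (le_of_eq ?_)
  · intro p hp
    obtain ⟨m1, -, m3, -, -, m6⟩ := dataABA_support hm hf01 hfs hA hX₁' hX₂' hR₁ hR₁₂ hp
    have ht : 1 ≤ X₂ * p.1 := by
      have := m1.1
      rwa [div_le_iff₀ hX₂', mul_comm] at this
    have hx : p.2.1 ^ 2 + 1 ≤ √(xiABA1 p.2.1 p.2.2.1 p.2.2.2) := by
      refine Real.le_sqrt_of_sq_le ?_
      unfold xiABA1; nlinarith [sq_nonneg (p.2.1 * p.2.2.2 + p.2.2.1)]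
    -- Cauchy–Schwarz for `(x₁, -1)` against `(x₂, x₄)`.
    have hz : zetaABA1 p.2.1 p.2.2.1 p.2.2.2 ^ 2
        ≤ (p.2.1 ^ 2 + 1) * xiABA2 p.2.1 p.2.2.1 p.2.2.2 := by
      unfold zetaABA1 xiABA2
      nlinarith [sq_nonneg (p.2.1 * p.2.2.2 + p.2.2.1), sq_nonneg p.2.1]
    exact phase_ABA_bounds hA hX₁' hX₂' (xiABA2_pos _ _ _) ht m3 m6
      (by linarith) (hz.trans (mul_le_mul_of_nonneg_right hx (xiABA2_pos _ _ _).le))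
  · rw [hV, Real.mul_rpow (by positivity) hR₂'.le, Real.mul_rpow hA.le hR₁'.le]
    ring

/-! ### Support, phase and volume bounds for βαβ -/

lemma support_BAB_bounds {A X₁ X₂ ξ₁ ξ₂ u y : ℝ} (hA : 0 < A) (hX₁ : 0 < X₁) (hX₂ : 0 < X₂)
    (hξ₁ : 0 < ξ₁) (hu : 0 < u) (hu2 : u ^ 2 = ξ₂) (ht1 : 1 ≤ X₁ * y)
    (ht2 : X₁ * y ≤ 2) (h1 : 1 ≤ X₁ * (u * y / ξ₁)) (h2 : X₁ * (u * y / ξ₁) ≤ 2)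
    (h3 : 1 ≤ X₂ * (ξ₁ / (ξ₂ * y ^ 2)) * (A * X₂))
    (h4 : X₂ * (ξ₁ / (ξ₂ * y ^ 2)) * (A * X₂) ≤ 4) :
    ξ₂ ≤ (A * X₁ ^ 2 * X₂ ^ 2) ^ 2 ∧ ξ₁ ≤ A * X₁ ^ 2 * X₂ ^ 2
      ∧ A * X₁ ^ 2 * X₂ ^ 2 / 16 ≤ ξ₁ ∧ ξ₁ ^ 2 ≤ 4 * ξ₂ := by
  have hξ₂ : 0 < ξ₂ := by rw [← hu2]; positivity
  have hy : 0 < y := by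
    by_contra h
    have := mul_nonpos_of_nonneg_of_nonpos hX₁.le (not_lt.1 h)
    linarith
  set M := A * X₁ ^ 2 * X₂ ^ 2 with hM
  have hM0 : 0 < M := by positivity
  set t := X₁ * y with ht
  have e1 : X₁ * (u * y / ξ₁) = u * t / ξ₁ := by rw [ht]; ring
  have e2 : X₂ * (ξ₁ / (ξ₂ * y ^ 2)) * (A * X₂) = M * ξ₁ / (ξ₂ * t ^ 2) := by
    rw [ht, hM]; field_simp
  rw [e1, le_div_iff₀ hξ₁, one_mul] at h1
  rw [e1, div_le_iff₀ hξ₁] at h2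
  have ht0 : 0 < t := by linarith
  rw [e2, le_div_iff₀ (by positivity), one_mul] at h3
  rw [e2, div_le_iff₀ (by positivity)] at h4
  -- The supports now read `ξ₁ ≤ ut ≤ 2ξ₁` and `(ut)² ≤ Mξ₁ ≤ 4(ut)²`, whence `ξ₁ ≤ ut ≤ M ≤ 16ξ₁`.
  have e3 : ξ₂ * t ^ 2 = (u * t) * (u * t) := by rw [← hu2]; ring
  rw [e3] at h3 h4
  have hut : 0 < u * t := by positivity
  have hutM : u * t ≤ M := by
    have : (u * t) * (u * t) ≤ M * (u * t) := h3.trans (by gcongr)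
    exact le_of_mul_le_mul_right this hut
  have huM : u ≤ M := by nlinarith
  have hut2 : u * t ≤ u * 2 := by gcongr
  refine ⟨?_, h1.trans hutM, ?_, ?_⟩
  · rw [← hu2]; gcongr
  · have : M * ξ₁ ≤ (16 * ξ₁) * ξ₁ := by nlinarith
    have := le_of_mul_le_mul_right this hξ₁
    linarith
  · rw [← hu2]; nlinarith

/-- With `M = A X₁²X₂²`, the second bound is `|x₅| ≤ √M = √A X₁X₂`. For the first, `(A X₁X₂)² z² ≤ A
ξ₂ M ξ₁`, and `M ≤ 16ξ₁`, `ξ₁² ≤ 4ξ₂` turn this into `64 A ξ₂²`. -/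
lemma phase_BAB_bounds {A X₁ X₂ ξ₁ ξ₂ y z x₅ : ℝ} (hA : 0 < A) (hX₁ : 0 < X₁) (hX₂ : 0 < X₂)
    (hξ₁ : 0 < ξ₁) (hξ₂ : 0 < ξ₂) (ht1 : 1 ≤ X₁ * y) (hξM : ξ₁ ≤ A * X₁ ^ 2 * X₂ ^ 2)
    (hMξ : A * X₁ ^ 2 * X₂ ^ 2 / 16 ≤ ξ₁) (h12 : ξ₁ ^ 2 ≤ 4 * ξ₂) (hx : x₅ ^ 2 ≤ ξ₁)
    (hz : z ^ 2 ≤ ξ₂ * ξ₁) :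
    |z / (ξ₂ * y ^ 2)| * (A * X₂) ≤ 100 * (√A * X₁)
      ∧ |-(A * x₅)| ≤ 100 * (√A * X₁) * (A * X₂) := by
  set v := √A with hv
  have hv0 : 0 < v := Real.sqrt_pos.2 hA
  have hv2 : A = v ^ 2 := (Real.sq_sqrt hA.le).symm
  have hy : 0 < y := by
    by_contra h
    have := mul_nonpos_of_nonneg_of_nonpos hX₁.le (not_lt.1 h)
    linarith
  constructor
  · have h1 : (A * X₂ * X₁ * |z|) ^ 2 ≤ (100 * v * ξ₂) ^ 2 := by
      rw [mul_pow, sq_abs]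
      calc (A * X₂ * X₁) ^ 2 * z ^ 2 ≤ (A * X₂ * X₁) ^ 2 * (ξ₂ * ξ₁) := by gcongr
        _ = A * ξ₂ * ((A * X₁ ^ 2 * X₂ ^ 2) * ξ₁) := by ring
        _ ≤ A * ξ₂ * (16 * ξ₁ * ξ₁) :=
            mul_le_mul_of_nonneg_left (mul_le_mul_of_nonneg_right (by linarith) hξ₁.le)
              (by positivity)
        _ = A * ξ₂ * (16 * ξ₁ ^ 2) := by ring
        _ ≤ A * ξ₂ * (16 * (4 * ξ₂)) := by gcongr
        _ ≤ _ := by rw [hv2]; nlinarith [mul_pos (pow_pos hv0 2) (pow_pos hξ₂ 2)]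
    have h2 : A * X₂ * X₁ * |z| ≤ 100 * v * ξ₂ :=
      (sq_le_sq₀ (by positivity) (by positivity)).1 h1
    rw [abs_div, abs_of_pos (show 0 < ξ₂ * y ^ 2 by positivity),
      div_mul_eq_mul_div, div_le_iff₀ (by positivity)]
    have h3 : 1 ≤ (X₁ * y) ^ 2 := one_le_pow₀ ht1
    calc |z| * (A * X₂) ≤ |z| * (A * X₂) * (X₁ * y) ^ 2 :=
          le_mul_of_one_le_right (by positivity) h3
      _ = X₁ * y ^ 2 * (A * X₂ * X₁ * |z|) := by ring
      _ ≤ X₁ * y ^ 2 * (100 * v * ξ₂) := by gcongr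
      _ = _ := by ring
  · have h1 : |x₅| ≤ v * X₁ * X₂ := by
      refine abs_le_of_sq_le_sq ?_ (by positivity)
      calc x₅ ^ 2 ≤ A * X₁ ^ 2 * X₂ ^ 2 := hx.trans hξM
        _ = _ := by rw [hv2]; ring
    rw [abs_neg, abs_mul, abs_of_pos hA]
    have h2 : 0 < v * X₁ * X₂ := by positivity
    calc A * |x₅| ≤ A * (v * X₁ * X₂) := by gcongr
      _ ≤ A * (100 * (v * X₁ * X₂)) := mul_le_mul_of_nonneg_left (by linarith) hA.le
      _ = _ := by ring

lemma dataBAB_support {f : ℝ → ℝ} (hf : Measurable f) (hf01 : ∀ x, f x ∈ Icc (0 : ℝ) 1)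
    (hfs : Function.support f ⊆ Icc 1 2) {A X₁ X₂ R₁ R₂ : ℝ} (hA : 0 < A) (hX₁ : 0 < X₁)
    (hX₂ : 0 < X₂) (h1 : 1 ≤ R₁) (h12 : R₁ ≤ R₂) {p : ℝ × ℝ × ℝ × ℝ}
    (hp : (dataBAB hf hA hX₂ X₁ R₁ R₂).w p ≠ 0) :
    p.1 ∈ Icc (1 / X₁) (2 / X₁) ∧ ‖(dataBAB hf hA hX₂ X₁ R₁ R₂).w p‖ ≤ calR R₁ R₂ * X₁ ^ 2
      ∧ xiBAB2 p.2.1 p.2.2.1 p.2.2.2 ≤ (A * X₁ ^ 2 * X₂ ^ 2) ^ 2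
      ∧ xiBAB1 p.2.1 p.2.2.1 p.2.2.2 ≤ A * X₁ ^ 2 * X₂ ^ 2
      ∧ A * X₁ ^ 2 * X₂ ^ 2 / 16 ≤ xiBAB1 p.2.1 p.2.2.1 p.2.2.2
      ∧ xiBAB1 p.2.1 p.2.2.1 p.2.2.2 ^ 2 ≤ 4 * xiBAB2 p.2.1 p.2.2.1 p.2.2.2 := by
  have hp' := hp
  simp only [dataBAB] at hp'
  have hmem := mem_of_indicator_ne_zero hp'
  have hval := indicator_of_mem hmem fun p : ℝ × ℝ × ℝ × ℝ =>
    calR R₁ R₂ * e (zetaBAB1 p.2.1 p.2.2.1 p.2.2.2 * p.1 / xiBAB1 p.2.1 p.2.2.1 p.2.2.2)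
      * f (X₁ * (√(xiBAB2 p.2.1 p.2.2.1 p.2.2.2) * p.1 / xiBAB1 p.2.1 p.2.2.1 p.2.2.2))
      * f (X₁ * p.1) * ((1 / p.1 ^ 2 : ℝ) : ℂ)
  have hw : (dataBAB hf hA hX₂ X₁ R₁ R₂).w p = calR R₁ R₂
      * e (zetaBAB1 p.2.1 p.2.2.1 p.2.2.2 * p.1 / xiBAB1 p.2.1 p.2.2.1 p.2.2.2)
      * f (X₁ * (√(xiBAB2 p.2.1 p.2.2.1 p.2.2.2) * p.1 / xiBAB1 p.2.1 p.2.2.1 p.2.2.2))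
      * f (X₁ * p.1) * ((1 / p.1 ^ 2 : ℝ) : ℂ) := hval
  rw [hw] at hp ⊢
  obtain ⟨a1, a2⟩ := mem_Icc_of_support hfs (right_ne_zero_of_mul (left_ne_zero_of_mul hp))
  obtain ⟨b1, b2⟩ := mem_Icc_of_support hfs
    (right_ne_zero_of_mul (left_ne_zero_of_mul (left_ne_zero_of_mul hp)))
  have hl : 1 / X₁ ≤ p.1 := by rw [div_le_iff₀ hX₁]; linarith
  have hp0 : 0 < p.1 := lt_of_lt_of_le (by positivity) hl
  refine ⟨⟨hl, by rw [le_div_iff₀ hX₁]; linarith⟩, ?_,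
    support_BAB_bounds hA hX₁ hX₂ (xiBAB1_pos _ _ _) (Real.sqrt_pos.2 (xiBAB2_pos _ _ _))
      (Real.sq_sqrt (xiBAB2_pos _ _ _).le) a1 a2 b1 b2 hmem.1 hmem.2⟩
  have hc := calR_nonneg h1 h12
  refine norm_weight_le hf01 ?_ ?_ _ _
  · rw [norm_mul, norm_e, mul_one, Complex.norm_real, Real.norm_of_nonneg hc]
  · rw [abs_of_pos (by positivity), div_le_iff₀ (by positivity), ← mul_pow]
    exact one_le_pow₀ a1

/-- Since `σ = 0` and `2r = log (ξ₂/ξ₁²)`, the weight is taken at `(ξ₂ - ξ₁²)/(2M²)`, at most 1 in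
absolute value on the support; again one majorant serves both kinds of `k`. The box is anisotropic:
`ξ₂ ≤ M²` bounds `x₂` by `M`, while `ξ₁ ≤ M` bounds `x₄` and `x₅` by `√M`. -/
lemma dataBAB_lintegral_le {f : ℝ → ℝ} (hf : Measurable f) (hf01 : ∀ x, f x ∈ Icc (0 : ℝ) 1)
    (hfs : Function.support f ⊆ Icc 1 2) {A X₁ X₂ R₁ R₂ η : ℝ} (hA : 0 < A) (hX₁ : 0 < X₁)
    (hX₂ : 0 < X₂) (h1 : 1 ≤ R₁) (h12 : R₁ ≤ R₂) (hη0 : 0 < η) (hη : η < 1)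
    {k : ℝ × ℝ × ℝ × ℝ → ℝ≥0∞}
    (hk : ∀ p, k p ≤ 1 ∨ k p = ENNReal.ofReal (R₁ / (1 + R₁ *
      |(dataBAB hf hA hX₂ X₁ R₁ R₂).r p
        - (dataBAB hf hA hX₂ X₁ R₁ R₂).σ * (dataBAB hf hA hX₂ X₁ R₁ R₂).s p|) ^ 2)) :
    ∫⁻ p, ‖(dataBAB hf hA hX₂ X₁ R₁ R₂).w p‖ₑ * k p ∂((volume.restrict (Ioi 0)).prod volume)
      ≤ ENNReal.ofReal (calR R₁ R₂ * X₁ * (R₁ ^ η *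
          ((2 * (A * X₁ ^ 2 * X₂ ^ 2) ^ 2) ^ (1 - η)
          * (4 * singMass η (A * X₁ ^ 2 * X₂ ^ 2) * (A * X₁ ^ 2 * X₂ ^ 2 / 16) ^ (-(1 - η))
            * √(A * X₁ ^ 2 * X₂ ^ 2) * singMass η √(A * X₁ ^ 2 * X₂ ^ 2))))) := by
  set M := A * X₁ ^ 2 * X₂ ^ 2 with hM
  have hM0 : 0 < M := by positivity
  have hB0 : 0 < √M := Real.sqrt_pos.2 hM0
  have hB2 : √M ^ 2 = M := Real.sq_sqrt hM0.le
  have hmass := singMass_pos hη0 hM0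
  have hmass' := singMass_pos hη0 hB0
  have hR := Real.one_le_rpow h1 hη0.le
  have hc := calR_nonneg h1 h12
  set Box : Set (ℝ × ℝ × ℝ) := Icc (-M) M ×ˢ Icc (-√M) √M ×ˢ Icc (-√M) √M with hBox
  have hBoxm : MeasurableSet Box :=
    measurableSet_Icc.prod (measurableSet_Icc.prod measurableSet_Icc)
  set S : ℝ × ℝ × ℝ → ℝ≥0∞ := {x | M / 16 ≤ xiBAB1 x.1 x.2.1 x.2.2}.indicator fun x =>
    singWeight η (xiBAB2 x.1 x.2.1 x.2.2 - xiBAB1 x.1 x.2.1 x.2.2 ^ 2) with hS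
  have hSm : Measurable S := by
    refine Measurable.indicator ?_ (measurableSet_le measurable_const ?_) <;>
    · unfold xiBAB1; try unfold xiBAB2
      fun_prop
  have hsM : singWeight η (1 / (2 * M ^ 2)) = ENNReal.ofReal ((2 * M ^ 2) ^ (1 - η)) := by
    rw [singWeight_of_ne_zero (by positivity), abs_of_pos (by positivity), one_div,
      Real.inv_rpow (by positivity), Real.rpow_neg (by positivity), inv_inv]
  refine (lintegral_weight_le (B := calR R₁ R₂ * X₁ ^ 2) (l := 1 / X₁) (u := 2 / X₁)
    (Ψ := fun x => ENNReal.ofReal (R₁ ^ η) * (ENNReal.ofReal ((2 * M ^ 2) ^ (1 - η))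
      * Box.indicator S x)) ?_ ?_).trans ?_
  · exact ((hSm.indicator hBoxm).const_mul _).const_mul _
  · intro p hp
    obtain ⟨m1, m2, m3, m4, m5, -⟩ := dataBAB_support hf hf01 hfs hA hX₁ hX₂ h1 h12 hp
    refine ⟨m1, m2, ?_⟩
    have hξ₁ := xiBAB1_pos p.2.1 p.2.2.1 p.2.2.2
    have hξ₂ := xiBAB2_pos p.2.1 p.2.2.1 p.2.2.2
    have hin : p.2 ∈ Box := by
      refine ⟨abs_le_of_sq_le_xi hM0.le ?_ m3, abs_le_of_sq_le_xi hB0.le ?_ (m4.trans hB2.ge),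
        abs_le_of_sq_le_xi hB0.le ?_ (m4.trans hB2.ge)⟩
      · unfold xiBAB2
        nlinarith [sq_nonneg (p.2.2.1 ^ 2 - p.2.1 * p.2.2.2), sq_nonneg p.2.2.1,
          sq_nonneg p.2.2.2]
      · unfold xiBAB1; nlinarith [sq_nonneg p.2.2.2]
      · unfold xiBAB1; nlinarith [sq_nonneg p.2.2.1]
    have hin' : p.2 ∈ {x : ℝ × ℝ × ℝ | M / 16 ≤ xiBAB1 x.1 x.2.1 x.2.2} := m5
    have hp0 : 0 < p.1 := lt_of_lt_of_le (by positivity) m1.1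
    rw [indicator_of_mem hin, ← hsM, hS, indicator_of_mem hin', ← singWeight_mul hη]
    set ξ₁ := xiBAB1 p.2.1 p.2.2.1 p.2.2.2 with hξ₁d
    set ξ₂ := xiBAB2 p.2.1 p.2.2.1 p.2.2.2 with hξ₂d
    have hsq : ξ₁ ^ 2 ≤ M ^ 2 := by gcongr
    have habs : |1 / (2 * M ^ 2) * (ξ₂ - ξ₁ ^ 2)| = |ξ₂ - ξ₁ ^ 2| / (2 * M ^ 2) := by
      rw [abs_mul, abs_of_pos (by positivity)]; ring
    rcases hk p with hk1 | hk2
    · refine hk1.trans ?_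
      calc (1 : ℝ≥0∞) = 1 * 1 := (one_mul 1).symm
        _ ≤ _ := by
          refine mul_le_mul' (ENNReal.one_le_ofReal.2 hR) (one_le_singWeight hη ?_)
          rw [habs, div_le_one (by positivity), abs_le]
          constructor <;> nlinarith
    · rw [hk2]
      refine (ofReal_localisation_le hη0 hη h1 _).trans ?_
      gcongr
      refine singWeight_anti hη ?_
      have hd : Real.log (ξ₂ / ξ₁ ^ 2) = 2 * ((dataBAB hf hA hX₂ X₁ R₁ R₂).r p
        - (dataBAB hf hA hX₂ X₁ R₁ R₂).σ * (dataBAB hf hA hX₂ X₁ R₁ R₂).s p) := by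
        simp only [dataBAB, ← hξ₁d, ← hξ₂d]
        rw [mul_div_right_comm √ξ₂, Real.log_mul (x := √ξ₂ / ξ₁) (by positivity) (by positivity),
          Real.log_div (by positivity) (by positivity),
          Real.log_div (x := √ξ₂) (by positivity) (by positivity), Real.log_sqrt hξ₂.le,
          Real.log_pow]
        push_cast; ring
      have hlog := abs_sub_le_mul_abs_log hξ₂ (by positivity : 0 < ξ₁ ^ 2) m3 hsq
      rw [hd, abs_mul, abs_two] at hlog
      rw [habs, div_le_iff₀ (by positivity)]
      linarith
  · rw [lintegral_const_mul _ ((hSm.indicator hBoxm).const_mul _),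
      lintegral_const_mul _ (hSm.indicator hBoxm), lintegral_indicator hBoxm]
    calc _ ≤ ENNReal.ofReal (calR R₁ R₂ * X₁ ^ 2) * ENNReal.ofReal (2 / X₁ - 1 / X₁)
          * (ENNReal.ofReal (R₁ ^ η) * (ENNReal.ofReal ((2 * M ^ 2) ^ (1 - η))
            * ENNReal.ofReal (4 * singMass η M * (M / 16) ^ (-(1 - η)) * √M
              * singMass η √M))) := by
          gcongr
          exact lintegral_singWeight_BAB_le hη0 hη hB0 hM0 (by positivity)
      _ = _ := by
          rw [show 2 / X₁ - 1 / X₁ = 1 / X₁ by ring, ← ENNReal.ofReal_mul (by positivity),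
            ← ENNReal.ofReal_mul (by positivity), ← ENNReal.ofReal_mul (by positivity),
            ← ENNReal.ofReal_mul (by positivity)]
          congr 2
          field_simp

/-- Power count: the exponents `2(1-η)`, `η`, `-(1-η)`, `1/2`, `η/2` of `M` add up to `3/2 + η/2`,
and `X₁M^(3/2) = A^(3/2)X₁⁴X₂³`. The constant is `128 = 2 · 16 · 4`. -/
lemma volume_BAB_le {A X₁ X₂ R₁ c η ε : ℝ} (hA : 0 < A) (hX₁ : 1 ≤ X₁) (hX₂ : 1 ≤ X₂)
    (h1 : 1 ≤ R₁) (hc : 0 ≤ c) (hη0 : 0 < η) (hη1 : η < 1) (hηε : η ≤ ε / 2)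
    (hM : 1 ≤ A * X₁ ^ 2 * X₂ ^ 2) :
    c * X₁ * (R₁ ^ η * ((2 * (A * X₁ ^ 2 * X₂ ^ 2) ^ 2) ^ (1 - η)
          * (4 * singMass η (A * X₁ ^ 2 * X₂ ^ 2) * (A * X₁ ^ 2 * X₂ ^ 2 / 16) ^ (-(1 - η))
            * √(A * X₁ ^ 2 * X₂ ^ 2) * singMass η √(A * X₁ ^ 2 * X₂ ^ 2))))
      ≤ A ^ 3 * (128 * (2 / η + 2) ^ 2 * c * A ^ (-(3 / 2 : ℝ) + ε) * R₁ ^ ε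
        * (X₁ ^ 4 * X₂ ^ 3) ^ (1 + ε)) := by
  set M := A * X₁ ^ 2 * X₂ ^ 2 with hMd
  have hM0 : 0 < M := by linarith
  have hX₁' : 0 < X₁ := by linarith
  have hX₂' : 0 < X₂ := by linarith
  have hR' : 0 < R₁ := by linarith
  have e0 : √M = √A * X₁ * X₂ := by
    rw [hMd, show A * X₁ ^ 2 * X₂ ^ 2 = A * (X₁ * X₂) ^ 2 by ring, Real.sqrt_mul hA.le,
      Real.sqrt_sq (by positivity)]; ring
  have a1 : (2 : ℝ) ^ (1 - η) ≤ 2 := by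
    calc (2 : ℝ) ^ (1 - η) ≤ 2 ^ (1 : ℝ) :=
          Real.rpow_le_rpow_of_exponent_le (by norm_num) (by linarith)
      _ = 2 := Real.rpow_one 2
  have a2 : (16 : ℝ) ^ (1 - η) ≤ 16 := by
    calc (16 : ℝ) ^ (1 - η) ≤ 16 ^ (1 : ℝ) :=
          Real.rpow_le_rpow_of_exponent_le (by norm_num) (by linarith)
      _ = 16 := Real.rpow_one 16
  have e1 : (2 * M ^ 2) ^ (1 - η) * (4 * singMass η M * (M / 16) ^ (-(1 - η)) * √M
      * singMass η √M) = (2 ^ (1 - η) * 16 ^ (1 - η)) * (4 * (2 / η + 2) ^ 2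
        * (√M * (M * M ^ (η / 2)))) := by
    have b1 : (M ^ 2) ^ (1 - η) = M ^ (2 * (1 - η)) := by
      rw [← Real.rpow_natCast, ← Real.rpow_mul hM0.le]; norm_num
    have b2 : √M ^ η = M ^ (η / 2) := by
      rw [Real.sqrt_eq_rpow, ← Real.rpow_mul hM0.le]; congr 1; ring
    have b3 : (M / 16) ^ (-(1 - η)) = M ^ (-(1 - η)) * 16 ^ (1 - η) := by
      rw [Real.div_rpow hM0.le (by norm_num), Real.rpow_neg (by norm_num : (0 : ℝ) ≤ 16),
        div_inv_eq_mul]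
    have b4 : M * M ^ (η / 2) = M ^ (2 * (1 - η)) * (M ^ η * M ^ (-(1 - η))) * M ^ (η / 2) := by
      congr 1
      rw [← Real.rpow_add hM0, ← Real.rpow_add hM0]
      conv_lhs => rw [← Real.rpow_one M]
      congr 1; ring
    rw [Real.mul_rpow (by norm_num) (by positivity), b1, b3, b4, singMass, singMass, b2]
    ring
  have e2 : M ^ (η / 2) ≤ A ^ ε * (X₁ ^ 4 * X₂ ^ 3) ^ ε := by
    calc M ^ (η / 2) ≤ M ^ ε := Real.rpow_le_rpow_of_exponent_le hM (by linarith)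
      _ ≤ (A * (X₁ ^ 4 * X₂ ^ 3)) ^ ε := by
          refine Real.rpow_le_rpow hM0.le ?_ (by linarith)
          rw [hMd, mul_assoc]
          gcongr
          · norm_num
          · norm_num
      _ = _ := Real.mul_rpow hA.le (by positivity)
  have e3 : R₁ ^ η ≤ R₁ ^ ε := Real.rpow_le_rpow_of_exponent_le h1 (by linarith)
  have e4 : A ^ 3 * A ^ (-(3 / 2 : ℝ) + ε) = √A * A * A ^ ε := by
    rw [Real.sqrt_eq_rpow, ← Real.rpow_natCast, ← Real.rpow_add hA, ← Real.rpow_add_one hA.ne',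
      ← Real.rpow_add hA]
    congr 1; push_cast; ring
  rw [e1, Real.rpow_add (by positivity : (0:ℝ) < X₁ ^ 4 * X₂ ^ 3), Real.rpow_one]
  calc c * X₁ * (R₁ ^ η * ((2 ^ (1 - η) * 16 ^ (1 - η)) * (4 * (2 / η + 2) ^ 2
        * (√M * (M * M ^ (η / 2))))))
      ≤ c * X₁ * (R₁ ^ ε * ((2 * 16) * (4 * (2 / η + 2) ^ 2
        * (√M * (M * (A ^ ε * (X₁ ^ 4 * X₂ ^ 3) ^ ε)))))) := by
        gcongr
    _ = 128 * (2 / η + 2) ^ 2 * c * (√A * A * A ^ ε) * R₁ ^ ε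
        * (X₁ ^ 4 * X₂ ^ 3 * (X₁ ^ 4 * X₂ ^ 3) ^ ε) := by rw [e0, hMd]; ring
    _ = _ := by rw [← e4]; ring

lemma exists_bound_BAB {f : ℝ → ℝ} (hf : ContDiff ℝ ∞ f)
    (hf01 : ∀ x, f x ∈ Icc (0 : ℝ) 1) (hfs : Function.support f ⊆ Icc 1 2)
    {g : ℝ → ℝ} (hg : ContDiff ℝ ∞ g) (hgc : HasCompactSupport g) (hgpos : tsupport g ⊆ Ioi 0)
    {C ε : ℝ} (hC : 0 ≤ C) (hε : 0 < ε) :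
    ∃ K : ℝ, 0 ≤ K ∧ ∀ R₁ R₂ X₁ X₂ A : ℝ, 1 ≤ R₁ → R₁ ≤ R₂ → 1 ≤ X₁ → 1 ≤ X₂ → 0 < A →
      ‖∫ τ : ℝ × ℝ, ((g (τ.1 / R₁) * g (τ.2 / R₂) : ℝ) : ℂ)
          * JBAB (testF f τ.1 τ.2 X₁ X₂ R₁ R₂) A‖
        ≤ K * (calR R₁ R₂ * A ^ (-(3 / 2 : ℝ) + ε) * (R₁ * R₂) ^ ε
            * (X₁ ^ 4 * X₂ ^ 3) ^ (1 + ε) * ((1 + √A * X₁) / R₂) ^ C) := by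
  obtain ⟨K, hK, hb⟩ := PhaseData.exists_norm_integral_le hf hf01 hfs hg hgc hgpos hC hε
  set η : ℝ := min (1 / 2) (ε / 2) with hη
  have hη0 : 0 < η := lt_min (by norm_num) (by linarith)
  have hη1 : η < 1 := lt_of_le_of_lt (min_le_left _ _) (by norm_num)
  have hηε : η ≤ ε / 2 := min_le_right _ _
  refine ⟨K * (128 * (2 / η + 2) ^ 2), by positivity,
    fun R₁ R₂ X₁ X₂ A hR₁ hR₁₂ hX₁ hX₂ hA => ?_⟩
  have hX₁' : 0 < X₁ := by linarith
  have hX₂' : 0 < X₂ := by linarith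
  have hR₁' : 0 < R₁ := by linarith
  have hR₂' : 0 < R₂ := by linarith
  have hm := hf.continuous.measurable
  have hc := calR_nonneg hR₁ hR₁₂
  set D := dataBAB hm hA hX₂' X₁ R₁ R₂ with hD
  set V : ℝ := A ^ 3 * (128 * (2 / η + 2) ^ 2 * calR R₁ R₂ * A ^ (-(3 / 2 : ℝ) + ε) * R₁ ^ ε
    * (X₁ ^ 4 * X₂ ^ 3) ^ (1 + ε)) with hV
  have hV0 : 0 ≤ V := by positivity
  have hvol : ∀ k : ℝ × ℝ × ℝ × ℝ → ℝ≥0∞, (∀ p, k p ≤ 1 ∨ k p = ENNReal.ofReal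
      (R₁ / (1 + R₁ * |D.r p - D.σ * D.s p|) ^ 2)) →
      ∫⁻ p, ‖D.w p‖ₑ * k p ∂((volume.restrict (Ioi 0)).prod volume) ≤ ENNReal.ofReal V := by
    intro k hk
    by_cases hM : 1 ≤ A * X₁ ^ 2 * X₂ ^ 2
    · refine (dataBAB_lintegral_le hm hf01 hfs hA hX₁' hX₂' hR₁ hR₁₂ hη0 hη1 hk).trans ?_
      exact ENNReal.ofReal_le_ofReal (volume_BAB_le hA hX₁ hX₂ hR₁ hc hη0 hη1 hηε hM)
    · have hz : ∀ p, D.w p = 0 := by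
        intro p
        by_contra hp
        obtain ⟨-, -, -, h4, -, -⟩ := dataBAB_support hm hf01 hfs hA hX₁' hX₂' hR₁ hR₁₂ hp
        have h5 : 1 ≤ xiBAB1 p.2.1 p.2.2.1 p.2.2.2 := by
          unfold xiBAB1; nlinarith [sq_nonneg p.2.2.1, sq_nonneg p.2.2.2]
        exact hM (h5.trans h4)
      simp [hz]
  have hv1 := hvol 1 (fun p => Or.inl le_rfl)
  simp only [Pi.one_apply, mul_one] at hv1
  have hw : Integrable D.w ((volume.restrict (Ioi 0)).prod volume) :=
    ⟨D.measurable_w.aestronglyMeasurable, lt_of_le_of_lt hv1 ENNReal.ofReal_lt_top⟩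
  refine norm_integral_mul_const_mul_le (c := A ^ 3) (by positivity)
    (JBAB_eq hm hf01 hfs hA hX₂' hR₁ hR₁₂ hw) ?_
  refine (hb _ D _ R₁ R₂ (√A * X₁) V hR₁ hR₁₂ (by positivity) hV0 ?_ hv1
    (hvol _ fun p => Or.inr rfl)).trans (le_of_eq ?_)
  · intro p hp
    obtain ⟨m1, -, -, m4, m5, m6⟩ := dataBAB_support hm hf01 hfs hA hX₁' hX₂' hR₁ hR₁₂ hp
    have ht : 1 ≤ X₁ * p.1 := by
      have := m1.1
      rwa [div_le_iff₀ hX₁', mul_comm] at this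
    have hx : p.2.2.2 ^ 2 + 1 ≤ xiBAB1 p.2.1 p.2.2.1 p.2.2.2 := by
      unfold xiBAB1; nlinarith [sq_nonneg p.2.2.1]
    -- Cauchy–Schwarz for `(x₄² - x₂x₅, x₂)` against `(x₅, -1)`.
    have hz : zetaBAB2 p.2.1 p.2.2.1 p.2.2.2 ^ 2
        ≤ xiBAB2 p.2.1 p.2.2.1 p.2.2.2 * (p.2.2.2 ^ 2 + 1) := by
      have e1 : zetaBAB2 p.2.1 p.2.2.1 p.2.2.2
          = (p.2.2.1 ^ 2 - p.2.1 * p.2.2.2) * p.2.2.2 - p.2.1 := by unfold zetaBAB2; ring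
      have e2 : (p.2.2.1 ^ 2 - p.2.1 * p.2.2.2) ^ 2 + p.2.1 ^ 2
          ≤ xiBAB2 p.2.1 p.2.2.1 p.2.2.2 := by
        unfold xiBAB2; nlinarith [sq_nonneg p.2.2.1, sq_nonneg p.2.2.2]
      rw [e1]
      refine le_trans ?_ (mul_le_mul_of_nonneg_right e2 (by positivity))
      nlinarith [sq_nonneg ((p.2.2.1 ^ 2 - p.2.1 * p.2.2.2) + p.2.1 * p.2.2.2)]
    exact phase_BAB_bounds hA hX₁' hX₂' (xiBAB1_pos _ _ _) (xiBAB2_pos _ _ _) ht m4 m5 m6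
      (by linarith) (hz.trans (mul_le_mul_of_nonneg_left hx (xiBAB2_pos _ _ _).le))
  · rw [hV, Real.mul_rpow hR₁'.le hR₂'.le]
    ring

/-! ### Support, phase and volume bounds for w₀ -/

lemma one_le_xiLong1 (x₁ x₂ x₄ x₅ : ℝ) : 1 ≤ xiLong1 x₁ x₂ x₄ x₅ :=
  le_add_of_nonneg_left (by positivity)

/-- Cauchy–Schwarz: up to sign `ζ₁` is the inner product of `(x₅, x₄, 1)` and `(x₁x₅ + x₄, x₂, x₁)`,
whose squared lengths are at most `ξ₁` and `ξ₂`. -/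
lemma zetaLong1_sq_le (x₁ x₂ x₄ x₅ : ℝ) :
    zetaLong1 x₁ x₂ x₄ x₅ ^ 2 ≤ xiLong1 x₁ x₂ x₄ x₅ * xiLong2 x₁ x₂ x₄ x₅ := by
  have e1 : zetaLong1 x₁ x₂ x₄ x₅ = -(x₅ * (x₁ * x₅ + x₄) + x₄ * x₂ + 1 * x₁) := by
    unfold zetaLong1; ring
  have e2 : x₅ ^ 2 + x₄ ^ 2 + 1 ≤ xiLong1 x₁ x₂ x₄ x₅ := by
    unfold xiLong1
    nlinarith [sq_nonneg (x₄ ^ 2 + x₁ * x₄ * x₅ - x₂ * x₅), sq_nonneg (x₁ * x₄ - x₂), sq_nonneg x₄]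
  have e3 : (x₁ * x₅ + x₄) ^ 2 + x₂ ^ 2 + x₁ ^ 2 ≤ xiLong2 x₁ x₂ x₄ x₅ := by
    unfold xiLong2; linarith
  refine le_trans ?_ (mul_le_mul e2 e3 (by positivity) (xiLong1_pos _ _ _ _).le)
  rw [e1, neg_sq]
  generalize x₁ * x₅ + x₄ = L
  nlinarith [sq_nonneg (x₅ * x₂ - x₄ * L), sq_nonneg (x₅ * x₁ - L), sq_nonneg (x₄ * x₁ - x₂)]

/-- In terms of `D` and `L`, `ζ₂` is a sum of six products, each of a quantity bounded by `ξ₂` and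
one of `D`, `x₄`, `x₅`, which are bounded by `√ξ₁`. -/
lemma abs_zetaLong2_le (x₁ x₂ x₄ x₅ : ℝ) :
    |zetaLong2 x₁ x₂ x₄ x₅| ≤ 7 * (√(xiLong1 x₁ x₂ x₄ x₅) * xiLong2 x₁ x₂ x₄ x₅) := by
  set D := x₁ * x₄ - x₂ with hD
  set L := x₁ * x₅ + x₄ with hL
  set u := √(xiLong1 x₁ x₂ x₄ x₅) with hu
  have e1 : zetaLong2 x₁ x₂ x₄ x₅
      = L ^ 2 * D + 2 * (L * x₂) * x₄ + x₁ ^ 2 * D - x₂ ^ 2 * x₅ + 2 * x₁ * x₄ - x₅ := by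
    rw [hD, hL]; unfold zetaLong2; ring
  have e2 : xiLong2 x₁ x₂ x₄ x₅ = L ^ 2 + x₁ ^ 2 + x₂ ^ 2 + 1 := rfl
  have hu0 : 0 ≤ u := Real.sqrt_nonneg _
  have hDu : |D| ≤ u := Real.abs_le_sqrt (by
    unfold xiLong1; nlinarith [sq_nonneg (x₄ ^ 2 + x₁ * x₄ * x₅ - x₂ * x₅), sq_nonneg x₄,
      sq_nonneg x₅])
  have h4u : |x₄| ≤ u := Real.abs_le_sqrt (by
    unfold xiLong1; nlinarith [sq_nonneg (x₄ ^ 2 + x₁ * x₄ * x₅ - x₂ * x₅), sq_nonneg x₄,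
      sq_nonneg x₅, sq_nonneg (x₁ * x₄ - x₂)])
  have h5u : |x₅| ≤ u := Real.abs_le_sqrt (by
    unfold xiLong1; nlinarith [sq_nonneg (x₄ ^ 2 + x₁ * x₄ * x₅ - x₂ * x₅), sq_nonneg x₄,
      sq_nonneg x₅, sq_nonneg (x₁ * x₄ - x₂)])
  have key : ∀ c d : ℝ, |c| ≤ xiLong2 x₁ x₂ x₄ x₅ → |d| ≤ u →
      |c * d| ≤ u * xiLong2 x₁ x₂ x₄ x₅ := by
    intro c d hc hd
    rw [abs_mul, mul_comm u]
    exact mul_le_mul hc hd (abs_nonneg _) (xiLong2_pos _ _ _ _).le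
  have t1 := key (L ^ 2) D (by rw [abs_of_nonneg (sq_nonneg _), e2]; nlinarith) hDu
  have t2 := key (2 * (L * x₂)) x₄ (by
    rw [e2, abs_le]
    constructor <;> nlinarith [sq_nonneg (L + x₂), sq_nonneg (L - x₂), sq_nonneg x₁]) h4u
  have t3 := key (x₁ ^ 2) D (by rw [abs_of_nonneg (sq_nonneg _), e2]; nlinarith) hDu
  have t4 := key (x₂ ^ 2) x₅ (by rw [abs_of_nonneg (sq_nonneg _), e2]; nlinarith) h5u
  have t5 := key (2 * x₁) x₄ (by
    rw [e2, abs_le]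
    constructor <;> nlinarith [sq_nonneg (x₁ + 1), sq_nonneg (x₁ - 1), sq_nonneg L, sq_nonneg x₂]) h4u
  have t6 := key 1 x₅ (by rw [abs_one, e2]; nlinarith) h5u
  rw [one_mul] at t6
  rw [abs_le] at t1 t2 t3 t4 t5 t6 ⊢
  rw [e1]
  constructor <;> linarith [t1.1, t1.2, t2.1, t2.2, t3.1, t3.2, t4.1, t4.2, t5.1, t5.2, t6.1, t6.2]

/-- The constraints imposed on `x` by the supports of the bumps. -/
def longAdmissible (P q : ℝ) : Set (ℝ × ℝ × ℝ × ℝ) :=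
  {x | xiLong1 x.1 x.2.1 x.2.2.1 x.2.2.2 ≤ q ^ 2 * xiLong2 x.1 x.2.1 x.2.2.1 x.2.2.2
    ∧ xiLong2 x.1 x.2.1 x.2.2.1 x.2.2.2 ≤ P * √(xiLong1 x.1 x.2.1 x.2.2.1 x.2.2.2)}

/-- Chaining the two conditions gives `ξ₁ ≤ q²ξ₂ ≤ q²P√ξ₁`, to be divided by `√ξ₁`. -/
lemma sqrt_xiLong1_le {P q : ℝ} {x : ℝ × ℝ × ℝ × ℝ}
    (hx : x ∈ longAdmissible P q) : √(xiLong1 x.1 x.2.1 x.2.2.1 x.2.2.2) ≤ P * q ^ 2 := by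
  have hu := Real.sqrt_pos.2 (xiLong1_pos x.1 x.2.1 x.2.2.1 x.2.2.2)
  have hu2 := Real.sq_sqrt (xiLong1_pos x.1 x.2.1 x.2.2.1 x.2.2.2).le
  obtain ⟨h1, h2⟩ := hx
  refine le_of_mul_le_mul_right ?_ hu
  nlinarith [mul_le_mul_of_nonneg_left h2 (sq_nonneg q)]

lemma one_le_of_mem_longAdmissible {P q : ℝ} {x : ℝ × ℝ × ℝ × ℝ}
    (hx : x ∈ longAdmissible P q) : 1 ≤ P * q ^ 2 :=
  (Real.one_le_sqrt.2 (one_le_xiLong1 _ _ _ _)).trans (sqrt_xiLong1_le hx)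

lemma xiLong2_le {P q : ℝ} (hP : 0 ≤ P) {x : ℝ × ℝ × ℝ × ℝ}
    (hx : x ∈ longAdmissible P q) : xiLong2 x.1 x.2.1 x.2.2.1 x.2.2.2 ≤ (P * q) ^ 2 :=
  hx.2.trans ((mul_le_mul_of_nonneg_left (sqrt_xiLong1_le hx) hP).trans (le_of_eq (by ring)))

lemma longAdmissible_subset {P q : ℝ} (hP : 0 ≤ P) (hq : 0 ≤ q) :
    longAdmissible P q ⊆ longRegion (P * q ^ 2) (P * q) := by
  intro x hx
  have h1 := sqrt_xiLong1_le hx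
  have h2 := xiLong2_le hP hx
  obtain ⟨x₁, x₂, x₄, x₅⟩ := x
  dsimp only at h1 h2
  have s1 := sq_nonneg (x₄ ^ 2 + x₁ * x₄ * x₅ - x₂ * x₅)
  have s2 := sq_nonneg (x₁ * x₄ - x₂)
  have s4 := sq_nonneg x₄
  have s5 := sq_nonneg x₅
  have s6 := sq_nonneg (x₁ * x₅ + x₄)
  have s7 := sq_nonneg x₁
  have s8 := sq_nonneg x₂
  refine ⟨?_, ?_, ?_, ?_, ?_, ?_⟩ <;> dsimp only
  · exact (Real.abs_le_sqrt (by unfold xiLong1; linarith)).trans h1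
  · exact (Real.abs_le_sqrt (by unfold xiLong1; linarith)).trans h1
  · exact abs_le_of_sq_le_sq (le_trans (by unfold xiLong2; linarith) h2) (by positivity)
  · exact abs_le_of_sq_le_sq (le_trans (by unfold xiLong2; linarith) h2) (by positivity)
  · exact (Real.abs_le_sqrt (by unfold xiLong1; linarith)).trans h1
  · refine (Real.abs_le_sqrt ?_).trans h1
    unfold xiLong1
    rw [show x₄ ^ 2 + (x₁ * x₄ - x₂) * x₅ = x₄ ^ 2 + x₁ * x₄ * x₅ - x₂ * x₅ by ring]
    linarith

/-- Multiplying the two bump arguments that contain `y` eliminates it and gives the condition on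
`ξ₁`; the overlap in the distinguished variable gives the one on `ξ₂`. In the right-hand version
these roles are exchanged. -/
lemma mem_longAdmissible_left {A₁ A₂ X₁ X₂ y : ℝ} {x : ℝ × ℝ × ℝ × ℝ} (hy : 0 < y)
    (h : 1 ≤ X₁ * (A₁ * √(xiLong1 x.1 x.2.1 x.2.2.1 x.2.2.2)
      / xiLong2 x.1 x.2.1 x.2.2.1 x.2.2.2) * (A₁ * X₁))
    (h1 : 1 ≤ X₂ * (A₂ * xiLong2 x.1 x.2.1 x.2.2.1 x.2.2.2
      / (xiLong1 x.1 x.2.1 x.2.2.1 x.2.2.2 * y))) (h2 : 1 ≤ X₂ * (A₂ * y)) :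
    x ∈ longAdmissible (A₁ ^ 2 * X₁ ^ 2) (A₂ * X₂) := by
  have hξ₁ := xiLong1_pos x.1 x.2.1 x.2.2.1 x.2.2.2
  have hξ₂ := xiLong2_pos x.1 x.2.1 x.2.2.1 x.2.2.2
  rw [longAdmissible, mem_ofPred_eq]
  generalize xiLong1 x.1 x.2.1 x.2.2.1 x.2.2.2 = ξ₁ at *
  generalize xiLong2 x.1 x.2.1 x.2.2.1 x.2.2.2 = ξ₂ at *
  constructor
  · have h3 := one_le_mul_of_one_le_of_one_le h1 h2
    have e : X₂ * (A₂ * ξ₂ / (ξ₁ * y)) * (X₂ * (A₂ * y)) = (A₂ * X₂) ^ 2 * ξ₂ / ξ₁ := by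
      field_simp
    rwa [e, le_div_iff₀ hξ₁, one_mul] at h3
  · have e : X₁ * (A₁ * √ξ₁ / ξ₂) * (A₁ * X₁) = A₁ ^ 2 * X₁ ^ 2 * √ξ₁ / ξ₂ := by ring
    rwa [e, le_div_iff₀ hξ₂, one_mul] at h

lemma mem_longAdmissible_right {A₁ A₂ X₁ X₂ y : ℝ} {x : ℝ × ℝ × ℝ × ℝ} (hy : 0 < y)
    (h : 1 ≤ X₂ * (A₂ * xiLong2 x.1 x.2.1 x.2.2.1 x.2.2.2
      / xiLong1 x.1 x.2.1 x.2.2.1 x.2.2.2) * (A₂ * X₂))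
    (h1 : 1 ≤ X₁ * (A₁ * √(xiLong1 x.1 x.2.1 x.2.2.1 x.2.2.2)
      / (xiLong2 x.1 x.2.1 x.2.2.1 x.2.2.2 * y))) (h2 : 1 ≤ X₁ * (A₁ * y)) :
    x ∈ longAdmissible (A₁ ^ 2 * X₁ ^ 2) (A₂ * X₂) := by
  have hξ₁ := xiLong1_pos x.1 x.2.1 x.2.2.1 x.2.2.2
  have hξ₂ := xiLong2_pos x.1 x.2.1 x.2.2.1 x.2.2.2
  rw [longAdmissible, mem_ofPred_eq]
  generalize xiLong1 x.1 x.2.1 x.2.2.1 x.2.2.2 = ξ₁ at *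
  generalize xiLong2 x.1 x.2.1 x.2.2.1 x.2.2.2 = ξ₂ at *
  constructor
  · have e : X₂ * (A₂ * ξ₂ / ξ₁) * (A₂ * X₂) = (A₂ * X₂) ^ 2 * ξ₂ / ξ₁ := by ring
    rwa [e, le_div_iff₀ hξ₁, one_mul] at h
  · have h3 := one_le_mul_of_one_le_of_one_le h1 h2
    have e : X₁ * (A₁ * √ξ₁ / (ξ₂ * y)) * (X₁ * (A₁ * y)) = A₁ ^ 2 * X₁ ^ 2 * √ξ₁ / ξ₂ := by
      field_simp
    rwa [e, le_div_iff₀ hξ₂, one_mul] at h3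

lemma dataLongLeft_support {f : ℝ → ℝ} (hf : Measurable f) (hf01 : ∀ x, f x ∈ Icc (0 : ℝ) 1)
    (hfs : Function.support f ⊆ Icc 1 2) {A₁ A₂ X₁ X₂ R₁ R₂ : ℝ} (hA₁ : 0 < A₁) (hA₂ : 0 < A₂)
    (hX₁ : 0 < X₁) (hX₂ : 0 < X₂) (h1 : 1 ≤ R₁) (h12 : R₁ ≤ R₂) {p : ℝ × ℝ × ℝ × ℝ × ℝ}
    (hp : (dataLongLeft hf hA₁ hX₁ A₂ X₂ R₁ R₂).w p ≠ 0) :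
    p.1 ∈ Icc (1 / (A₂ * X₂)) (2 / (A₂ * X₂))
      ∧ ‖(dataLongLeft hf hA₁ hX₁ A₂ X₂ R₁ R₂).w p‖ ≤ calR R₁ R₂ * (1 / p.1)
      ∧ p.2 ∈ longAdmissible (A₁ ^ 2 * X₁ ^ 2) (A₂ * X₂) := by
  have hp' := hp
  simp only [dataLongLeft] at hp'
  have hmem := mem_of_indicator_ne_zero hp'
  have hval := indicator_of_mem hmem fun p : ℝ × ℝ × ℝ × ℝ × ℝ =>
    calR R₁ R₂ * e (A₂ * zetaLong2 p.2.1 p.2.2.1 p.2.2.2.1 p.2.2.2.2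
        / (xiLong1 p.2.1 p.2.2.1 p.2.2.2.1 p.2.2.2.2 * p.1))
      * e (-(A₂ * p.2.2.2.2 * p.1))
      * f (X₂ * (A₂ * xiLong2 p.2.1 p.2.2.1 p.2.2.2.1 p.2.2.2.2
        / (xiLong1 p.2.1 p.2.2.1 p.2.2.2.1 p.2.2.2.2 * p.1)))
      * f (X₂ * (A₂ * p.1)) * ((1 / p.1 : ℝ) : ℂ)
  have hw : (dataLongLeft hf hA₁ hX₁ A₂ X₂ R₁ R₂).w p = _ := hval
  rw [hw] at hp ⊢
  obtain ⟨a1, a2⟩ := mem_Icc_of_support hfs (right_ne_zero_of_mul (left_ne_zero_of_mul hp))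
  obtain ⟨b1, b2⟩ := mem_Icc_of_support hfs
    (right_ne_zero_of_mul (left_ne_zero_of_mul (left_ne_zero_of_mul hp)))
  have hq : 0 < A₂ * X₂ := by positivity
  have hl : 1 / (A₂ * X₂) ≤ p.1 := by rw [div_le_iff₀ hq]; linarith
  have hp0 : 0 < p.1 := lt_of_lt_of_le (by positivity) hl
  refine ⟨⟨hl, by rw [le_div_iff₀ hq]; linarith⟩, ?_, mem_longAdmissible_left hp0 hmem.1 b1 a1⟩
  have hc := calR_nonneg h1 h12
  refine norm_weight_le hf01 ?_ (le_of_eq (abs_of_pos (by positivity))) _ _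
  rw [norm_mul, norm_mul, norm_e, norm_e, mul_one, mul_one, Complex.norm_real,
    Real.norm_of_nonneg hc]

lemma dataLongRight_support {f : ℝ → ℝ} (hf : Measurable f) (hf01 : ∀ x, f x ∈ Icc (0 : ℝ) 1)
    (hfs : Function.support f ⊆ Icc 1 2) {A₁ A₂ X₁ X₂ R₁ R₂ : ℝ} (hA₁ : 0 < A₁) (hA₂ : 0 < A₂)
    (hX₁ : 0 < X₁) (hX₂ : 0 < X₂) (h1 : 1 ≤ R₁) (h12 : R₁ ≤ R₂) {p : ℝ × ℝ × ℝ × ℝ × ℝ}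
    (hp : (dataLongRight hf hA₂ hX₂ A₁ X₁ R₁ R₂).w p ≠ 0) :
    p.1 ∈ Icc (1 / (A₁ * X₁)) (2 / (A₁ * X₁))
      ∧ ‖(dataLongRight hf hA₂ hX₂ A₁ X₁ R₁ R₂).w p‖ ≤ calR R₁ R₂ * (1 / p.1)
      ∧ p.2 ∈ longAdmissible (A₁ ^ 2 * X₁ ^ 2) (A₂ * X₂) := by
  have hp' := hp
  simp only [dataLongRight] at hp'
  have hmem := mem_of_indicator_ne_zero hp'
  have hval := indicator_of_mem hmem fun p : ℝ × ℝ × ℝ × ℝ × ℝ =>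
    calR R₁ R₂ * e (A₁ * zetaLong1 p.2.1 p.2.2.1 p.2.2.2.1 p.2.2.2.2
        / (xiLong2 p.2.1 p.2.2.1 p.2.2.2.1 p.2.2.2.2 * p.1))
      * e (-(A₁ * p.2.1 * p.1))
      * f (X₁ * (A₁ * √(xiLong1 p.2.1 p.2.2.1 p.2.2.2.1 p.2.2.2.2)
        / (xiLong2 p.2.1 p.2.2.1 p.2.2.2.1 p.2.2.2.2 * p.1)))
      * f (X₁ * (A₁ * p.1)) * ((1 / p.1 : ℝ) : ℂ)
  have hw : (dataLongRight hf hA₂ hX₂ A₁ X₁ R₁ R₂).w p = _ := hval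
  rw [hw] at hp ⊢
  obtain ⟨a1, a2⟩ := mem_Icc_of_support hfs (right_ne_zero_of_mul (left_ne_zero_of_mul hp))
  obtain ⟨b1, b2⟩ := mem_Icc_of_support hfs
    (right_ne_zero_of_mul (left_ne_zero_of_mul (left_ne_zero_of_mul hp)))
  have hq : 0 < A₁ * X₁ := by positivity
  have hl : 1 / (A₁ * X₁) ≤ p.1 := by rw [div_le_iff₀ hq]; linarith
  have hp0 : 0 < p.1 := lt_of_lt_of_le (by positivity) hl
  refine ⟨⟨hl, by rw [le_div_iff₀ hq]; linarith⟩, ?_, mem_longAdmissible_right hp0 hmem.1 b1 a1⟩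
  have hc := calR_nonneg h1 h12
  refine norm_weight_le hf01 ?_ (le_of_eq (abs_of_pos (by positivity))) _ _
  rw [norm_mul, norm_mul, norm_e, norm_e, mul_one, mul_one, Complex.norm_real,
    Real.norm_of_nonneg hc]

/-- The volume of the region of `x` carrying the integral `𝒥_{w₀}`, up to the factor `ℛ`. -/
lemma lintegral_longRegion_le {c η P q : ℝ} (hc : 0 ≤ c) (hη0 : 0 < η) (hη : η < 1) (hP : 0 < P)
    (hq : 0 < q) :
    ENNReal.ofReal c * ∫⁻ x, (longRegion (P * q ^ 2) (P * q)).indicator 1 x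
      ≤ ENNReal.ofReal (c * (4 * (P * q ^ 2) * (P * q) * singMass η (P * q ^ 2) ^ 2)) := by
  rw [lintegral_indicator_one (measurableSet_longRegion _ _), ENNReal.ofReal_mul hc]
  gcongr
  exact volume_longRegion_le hη0 hη (by positivity) (by positivity)

/-- The remaining `y` runs over `[1/t, 2/t]` with density `1/y ≤ t`, so it contributes at most 1 and
only the volume of the `x`-region is left. -/
lemma lintegral_enorm_long_le {w : ℝ × ℝ × ℝ × ℝ × ℝ → ℂ} {c η P q t : ℝ} (hc : 0 ≤ c)
    (hη0 : 0 < η) (hη : η < 1) (hP : 0 < P) (hq : 0 < q) (ht : 0 < t)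
    (hw : ∀ p, w p ≠ 0 → p.1 ∈ Icc (1 / t) (2 / t) ∧ ‖w p‖ ≤ c * (1 / p.1)
      ∧ p.2 ∈ longAdmissible P q) :
    ∫⁻ p, ‖w p‖ₑ ∂((volume.restrict (Ioi 0)).prod volume)
      ≤ ENNReal.ofReal (c * (4 * (P * q ^ 2) * (P * q) * singMass η (P * q ^ 2) ^ 2)) := by
  have hm := measurableSet_longRegion (P * q ^ 2) (P * q)
  have := lintegral_weight_le (w := w) (k := 1)
    (Ψ := (longRegion (P * q ^ 2) (P * q)).indicator 1) (measurable_one.indicator hm)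
    (B := c * t) (l := 1 / t) (u := 2 / t) (fun p hp => by
      obtain ⟨m1, m2, m3⟩ := hw p hp
      have hp0 : 0 < p.1 := lt_of_lt_of_le (by positivity) m1.1
      refine ⟨m1, m2.trans ?_, ?_⟩
      · gcongr
        exact (one_div_le hp0 ht).2 m1.1
      · rw [indicator_of_mem (longAdmissible_subset hP.le hq.le m3)]; exact le_rfl)
  simp only [Pi.one_apply, mul_one] at this
  refine this.trans (le_trans (le_of_eq ?_) (lintegral_longRegion_le hc hη0 hη hP hq))
  rw [← ENNReal.ofReal_mul (by positivity)]
  congr 2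
  field_simp; ring

/-- The kernel is centred at a value of `log y`, and `1/y` is exactly the density that
`lintegral_Ioi_log_le` expects. Localisation thus costs an absolute constant, with no power of `R`,
and no singular weight is needed for it. -/
lemma lintegral_localised_long_le {w : ℝ × ℝ × ℝ × ℝ × ℝ → ℂ} {d : ℝ × ℝ × ℝ × ℝ × ℝ → ℝ}
    {s : ℝ × ℝ × ℝ × ℝ → ℝ} (hs : Measurable s) {c η P q R : ℝ} (hc : 0 ≤ c)
    (hη0 : 0 < η) (hη : η < 1) (hP : 0 < P) (hq : 0 < q) (hR : 0 < R)
    (hw : ∀ p, w p ≠ 0 → 0 < p.1 ∧ ‖w p‖ ≤ c * (1 / p.1) ∧ p.2 ∈ longAdmissible P q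
      ∧ d p = s p.2 - 2 * Real.log p.1) :
    ∫⁻ p, ‖w p‖ₑ * ENNReal.ofReal (R / (1 + R * |d p|) ^ 2)
        ∂((volume.restrict (Ioi 0)).prod volume)
      ≤ (∫⁻ x : ℝ, ENNReal.ofReal (1 / (1 + |x|) ^ 2))
        * ENNReal.ofReal (c * (4 * (P * q ^ 2) * (P * q) * singMass η (P * q ^ 2) ^ 2)) := by
  set S := longRegion (P * q ^ 2) (P * q) with hS
  have hm : MeasurableSet S := measurableSet_longRegion _ _
  set G : ℝ × ℝ × ℝ × ℝ × ℝ → ℝ≥0∞ := fun p => ENNReal.ofReal c * (S.indicator 1 p.2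
    * (ENNReal.ofReal (R / (1 + R * |s p.2 - 2 * Real.log p.1|) ^ 2)
      * ENNReal.ofReal (1 / p.1))) with hG
  have hGm : Measurable G := by
    refine Measurable.const_mul (((measurable_one.indicator hm).comp measurable_snd).mul ?_) _
    fun_prop
  have hpt : ∀ p, ‖w p‖ₑ * ENNReal.ofReal (R / (1 + R * |d p|) ^ 2) ≤ G p := by
    intro p
    by_cases hp : w p = 0
    · simp [hp]
    · obtain ⟨m1, m2, m3, m4⟩ := hw p hp
      rw [hG, ← ofReal_norm, m4]
      dsimp only
      rw [indicator_of_mem (longAdmissible_subset hP.le hq.le m3), Pi.one_apply, one_mul,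
        mul_comm (ENNReal.ofReal (R / _)), ← mul_assoc, ← ENNReal.ofReal_mul hc]
      gcongr
  refine (lintegral_mono hpt).trans ?_
  rw [lintegral_prod_symm _ hGm.aemeasurable]
  calc _ ≤ ∫⁻ x, ENNReal.ofReal c * (S.indicator 1 x
        * ∫⁻ x : ℝ, ENNReal.ofReal (1 / (1 + |x|) ^ 2)) := by
        refine lintegral_mono fun x => ?_
        rw [hG]
        dsimp only
        rw [lintegral_const_mul _ (by fun_prop), lintegral_const_mul _ (by fun_prop)]
        exact mul_le_mul_right (mul_le_mul_right (PhaseData.lintegral_Ioi_log_le hR (s x)) _) _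
    _ = (∫⁻ x : ℝ, ENNReal.ofReal (1 / (1 + |x|) ^ 2))
        * (ENNReal.ofReal c * ∫⁻ x, S.indicator 1 x) := by
        rw [lintegral_const_mul _ ((measurable_one.indicator hm).mul_const _),
          lintegral_mul_const _ (measurable_one.indicator hm)]
        ring
    _ ≤ _ := by gcongr; exact lintegral_longRegion_le hc hη0 hη hP hq

/-- Power count: with `P = A₁²X₁²` and `q = A₂X₂`, `Pq² · Pq = A₁⁴A₂³X₁⁴X₂³`. The surplus `M^(2η)`
goes into the `ε`-powers. -/
lemma volume_long_le {A₁ A₂ X₁ X₂ c η ε : ℝ} (hA₁ : 0 < A₁) (hA₂ : 0 < A₂) (hX₁ : 1 ≤ X₁)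
    (hX₂ : 1 ≤ X₂) (hc : 0 ≤ c) (hη0 : 0 < η) (hηε : η ≤ ε / 4)
    (hM : 1 ≤ A₁ ^ 2 * X₁ ^ 2 * (A₂ * X₂) ^ 2) :
    c * (4 * (A₁ ^ 2 * X₁ ^ 2 * (A₂ * X₂) ^ 2) * (A₁ ^ 2 * X₁ ^ 2 * (A₂ * X₂))
        * singMass η (A₁ ^ 2 * X₁ ^ 2 * (A₂ * X₂) ^ 2) ^ 2)
      ≤ A₁ ^ 4 * A₂ ^ 3 * (4 * (2 / η + 2) ^ 2 * c * (A₁ * A₂) ^ ε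
        * (X₁ ^ 4 * X₂ ^ 3) ^ (1 + ε)) := by
  set M := A₁ ^ 2 * X₁ ^ 2 * (A₂ * X₂) ^ 2 with hMd
  have hM0 : 0 < M := by linarith
  have hX₁' : 0 < X₁ := by linarith
  have hX₂' : 0 < X₂ := by linarith
  have e1 : singMass η M ^ 2 = (2 / η + 2) ^ 2 * M ^ (2 * η) := by
    rw [singMass, mul_pow, ← Real.rpow_natCast (M ^ η) 2, ← Real.rpow_mul hM0.le]
    congr 2; push_cast; ring
  have e2 : M ^ (2 * η) ≤ (A₁ * A₂) ^ ε * (X₁ ^ 4 * X₂ ^ 3) ^ ε := by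
    calc M ^ (2 * η) ≤ M ^ (ε / 2) := Real.rpow_le_rpow_of_exponent_le hM (by linarith)
      _ ≤ ((A₁ * A₂ * (X₁ ^ 4 * X₂ ^ 3)) ^ 2) ^ (ε / 2) := by
          refine Real.rpow_le_rpow hM0.le ?_ (by linarith)
          calc M = (A₁ * A₂) ^ 2 * (X₁ ^ 2 * X₂ ^ 2) := by rw [hMd]; ring
            _ ≤ (A₁ * A₂) ^ 2 * (X₁ ^ 8 * X₂ ^ 6) := by gcongr <;> norm_num
            _ = _ := by ring
      _ = (A₁ * A₂ * (X₁ ^ 4 * X₂ ^ 3)) ^ ε := by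
          rw [← Real.rpow_natCast, ← Real.rpow_mul (by positivity)]; congr 1; push_cast; ring
      _ = _ := Real.mul_rpow (by positivity) (by positivity)
  rw [e1, Real.rpow_add (by positivity), Real.rpow_one]
  calc c * (4 * M * (A₁ ^ 2 * X₁ ^ 2 * (A₂ * X₂)) * ((2 / η + 2) ^ 2 * M ^ (2 * η)))
      ≤ c * (4 * M * (A₁ ^ 2 * X₁ ^ 2 * (A₂ * X₂)) * ((2 / η + 2) ^ 2
        * ((A₁ * A₂) ^ ε * (X₁ ^ 4 * X₂ ^ 3) ^ ε))) := by gcongr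
    _ = _ := by rw [hMd]; ring

/-- Admissibility turns `ζ₁² ≤ ξ₁ξ₂` into `|ζ₁| ≤ A₂X₂ξ₂`, and `longRegion` bounds `x₁`. The
argument in fact reaches `A₁²A₂X₁X₂`; a further factor `X₂ ≥ 1` is given away. -/
lemma phase_longLeft_bounds {A₁ A₂ X₁ X₂ : ℝ} (hA₁ : 0 < A₁) (hA₂ : 0 < A₂) (hX₁ : 1 ≤ X₁)
    (hX₂ : 1 ≤ X₂) {x : ℝ × ℝ × ℝ × ℝ} (hx : x ∈ longAdmissible (A₁ ^ 2 * X₁ ^ 2) (A₂ * X₂)) :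
    |A₁ * zetaLong1 x.1 x.2.1 x.2.2.1 x.2.2.2 / xiLong2 x.1 x.2.1 x.2.2.1 x.2.2.2| * (A₁ * X₁)
        ≤ 100 * (A₁ ^ 2 * A₂ * X₁ * X₂ ^ 2)
      ∧ |-(A₁ * x.1)| ≤ 100 * (A₁ ^ 2 * A₂ * X₁ * X₂ ^ 2) * (A₁ * X₁) := by
  have hX₁' : 0 < X₁ := by linarith
  have hX₂' : 0 < X₂ := by linarith
  have hx1 := (longAdmissible_subset (by positivity) (by positivity) hx).2.2.1
  have hξ₂ := xiLong2_pos x.1 x.2.1 x.2.2.1 x.2.2.2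
  have hz : |zetaLong1 x.1 x.2.1 x.2.2.1 x.2.2.2|
      ≤ A₂ * X₂ * xiLong2 x.1 x.2.1 x.2.2.1 x.2.2.2 := by
    refine abs_le_of_sq_le_sq ?_ (by positivity)
    refine (zetaLong1_sq_le _ _ _ _).trans ?_
    calc _ ≤ (A₂ * X₂) ^ 2 * xiLong2 x.1 x.2.1 x.2.2.1 x.2.2.2
          * xiLong2 x.1 x.2.1 x.2.2.1 x.2.2.2 := mul_le_mul_of_nonneg_right hx.1 hξ₂.le
      _ = _ := by ring
  generalize xiLong2 x.1 x.2.1 x.2.2.1 x.2.2.2 = ξ₂ at *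
  generalize zetaLong1 x.1 x.2.1 x.2.2.1 x.2.2.2 = z at *
  constructor
  · rw [abs_div, abs_mul, abs_of_pos hA₁, abs_of_pos hξ₂, div_mul_eq_mul_div,
      div_le_iff₀ hξ₂]
    calc A₁ * |z| * (A₁ * X₁) ≤ A₁ * (A₂ * X₂ * ξ₂) * (A₁ * X₁) := by gcongr
      _ = A₁ ^ 2 * A₂ * X₁ * X₂ * ξ₂ := by ring
      _ ≤ A₁ ^ 2 * A₂ * X₁ * X₂ * ξ₂ * (100 * X₂) :=
          le_mul_of_one_le_right (by positivity) (by linarith)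
      _ = _ := by ring
  · rw [abs_neg, abs_mul, abs_of_pos hA₁]
    calc A₁ * |x.1| ≤ A₁ * (A₁ ^ 2 * X₁ ^ 2 * (A₂ * X₂)) := by gcongr
      _ ≤ A₁ * (A₁ ^ 2 * X₁ ^ 2 * (A₂ * X₂)) * (100 * X₂) :=
          le_mul_of_one_le_right (by positivity) (by linarith)
      _ = _ := by ring

/-- Admissibility replaces `ξ₂` by `A₁²X₁²√ξ₁` in `abs_zetaLong2_le`, so `|ζ₂|/ξ₁ ≤ 7A₁²X₁²`;
`longRegion` bounds `x₅`. -/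
lemma phase_longRight_bounds {A₁ A₂ X₁ X₂ : ℝ} (hA₁ : 0 < A₁) (hA₂ : 0 < A₂) (hX₁ : 0 < X₁)
    (hX₂ : 0 < X₂) {x : ℝ × ℝ × ℝ × ℝ} (hx : x ∈ longAdmissible (A₁ ^ 2 * X₁ ^ 2) (A₂ * X₂)) :
    |A₂ * zetaLong2 x.1 x.2.1 x.2.2.1 x.2.2.2 / xiLong1 x.1 x.2.1 x.2.2.1 x.2.2.2| * (A₂ * X₂)
        ≤ 100 * (A₁ ^ 2 * A₂ ^ 2 * X₁ ^ 2 * X₂)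
      ∧ |-(A₂ * x.2.2.2)| ≤ 100 * (A₁ ^ 2 * A₂ ^ 2 * X₁ ^ 2 * X₂) * (A₂ * X₂) := by
  have hx5 := (longAdmissible_subset (by positivity) (by positivity) hx).2.1
  have hξ₁ := xiLong1_pos x.1 x.2.1 x.2.2.1 x.2.2.2
  have hz : |zetaLong2 x.1 x.2.1 x.2.2.1 x.2.2.2|
      ≤ 7 * (A₁ ^ 2 * X₁ ^ 2) * xiLong1 x.1 x.2.1 x.2.2.1 x.2.2.2 := by
    refine (abs_zetaLong2_le _ _ _ _).trans ?_
    calc _ ≤ 7 * (√(xiLong1 x.1 x.2.1 x.2.2.1 x.2.2.2)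
          * (A₁ ^ 2 * X₁ ^ 2 * √(xiLong1 x.1 x.2.1 x.2.2.1 x.2.2.2))) := by
          have := mul_le_mul_of_nonneg_left hx.2
            (Real.sqrt_nonneg (xiLong1 x.1 x.2.1 x.2.2.1 x.2.2.2))
          linarith
      _ = 7 * (A₁ ^ 2 * X₁ ^ 2) * √(xiLong1 x.1 x.2.1 x.2.2.1 x.2.2.2) ^ 2 := by ring
      _ = _ := by rw [Real.sq_sqrt hξ₁.le]
  generalize xiLong1 x.1 x.2.1 x.2.2.1 x.2.2.2 = ξ₁ at *
  generalize zetaLong2 x.1 x.2.1 x.2.2.1 x.2.2.2 = z at *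
  constructor
  · rw [abs_div, abs_mul, abs_of_pos hA₂, abs_of_pos hξ₁, div_mul_eq_mul_div,
      div_le_iff₀ hξ₁]
    calc A₂ * |z| * (A₂ * X₂) ≤ A₂ * (7 * (A₁ ^ 2 * X₁ ^ 2) * ξ₁) * (A₂ * X₂) := by gcongr
      _ = 7 * (A₁ ^ 2 * A₂ ^ 2 * X₁ ^ 2 * X₂) * ξ₁ := by ring
      _ ≤ _ := by gcongr; norm_num
  · rw [abs_neg, abs_mul, abs_of_pos hA₂]
    calc A₂ * |x.2.2.2| ≤ A₂ * (A₁ ^ 2 * X₁ ^ 2 * (A₂ * X₂) ^ 2) := by gcongr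
      _ ≤ A₂ * (A₁ ^ 2 * X₁ ^ 2 * (A₂ * X₂) ^ 2) * 100 :=
          le_mul_of_one_le_right (by positivity) (by norm_num)
      _ = _ := by ring

lemma exists_bound_Long {f : ℝ → ℝ} (hf : ContDiff ℝ ∞ f)
    (hf01 : ∀ x, f x ∈ Icc (0 : ℝ) 1) (hfs : Function.support f ⊆ Icc 1 2)
    {g : ℝ → ℝ} (hg : ContDiff ℝ ∞ g) (hgc : HasCompactSupport g) (hgpos : tsupport g ⊆ Ioi 0)
    {C₁ C₂ ε : ℝ} (hC₁ : 0 ≤ C₁) (hC₂ : 0 ≤ C₂) (hε : 0 < ε) :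
    ∃ K : ℝ, 0 ≤ K ∧ ∀ R₁ R₂ X₁ X₂ A₁ A₂ : ℝ, 1 ≤ R₁ → R₁ ≤ R₂ → 1 ≤ X₁ → 1 ≤ X₂ →
      0 < A₁ → 0 < A₂ →
      ‖∫ τ : ℝ × ℝ, ((g (τ.1 / R₁) * g (τ.2 / R₂) : ℝ) : ℂ)
          * JLong (testF f τ.1 τ.2 X₁ X₂ R₁ R₂) A₁ A₂‖
        ≤ K * (calR R₁ R₂ * (A₁ * A₂ * R₁ * R₂) ^ ε * (X₁ ^ 4 * X₂ ^ 3) ^ (1 + ε)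
            * ((1 + A₁ ^ 2 * A₂ * X₁ * X₂ ^ 2) / R₂) ^ C₁
            * ((1 + A₁ ^ 2 * A₂ ^ 2 * X₁ ^ 2 * X₂) / R₂) ^ C₂) := by
  obtain ⟨N, hN⟩ := exists_interpolation_exponent hC₁ hC₂ hε
  obtain ⟨K₁, hK₁, hd⟩ := PhaseData.exists_norm_integral_le_decay' hf hf01 hfs hg hgc hgpos N
  obtain ⟨K₂, hK₂, hl⟩ := PhaseData.exists_norm_integral_le_localised hf hf01 hfs hg hgc
  set T := (∫⁻ x : ℝ, ENNReal.ofReal (1 / (1 + |x|) ^ 2)).toReal with hT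
  have hT0 : 0 ≤ T := ENNReal.toReal_nonneg
  set η : ℝ := min (1 / 2) (ε / 4) with hη
  have hη0 : 0 < η := lt_min (by norm_num) (by linarith)
  have hη1 : η < 1 := lt_of_le_of_lt (min_le_left _ _) (by norm_num)
  have hηε : η ≤ ε / 4 := min_le_right _ _
  refine ⟨(K₁ + K₂ * T) * (4 * (2 / η + 2) ^ 2), by positivity,
    fun R₁ R₂ X₁ X₂ A₁ A₂ hR₁ hR₁₂ hX₁ hX₂ hA₁ hA₂ => ?_⟩
  have hX₁' : 0 < X₁ := by linarith
  have hX₂' : 0 < X₂ := by linarith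
  have hR₁' : 0 < R₁ := by linarith
  have hR₂' : 0 < R₂ := by linarith
  have hm := hf.continuous.measurable
  have hc := calR_nonneg hR₁ hR₁₂
  set DL := dataLongLeft hm hA₁ hX₁' A₂ X₂ R₁ R₂ with hDL
  set DR := dataLongRight hm hA₂ hX₂' A₁ X₁ R₁ R₂ with hDR
  have hsL := fun p => dataLongLeft_support hm hf01 hfs hA₁ hA₂ hX₁' hX₂' hR₁ hR₁₂ (p := p)
  have hsR := fun p => dataLongRight_support hm hf01 hfs hA₁ hA₂ hX₁' hX₂' hR₁ hR₁₂ (p := p)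
  set V : ℝ := 4 * (2 / η + 2) ^ 2 * calR R₁ R₂ * (A₁ * A₂) ^ ε
    * (X₁ ^ 4 * X₂ ^ 3) ^ (1 + ε) with hV
  have hV0 : 0 ≤ V := by positivity
  set κ : ℝ := A₁ ^ 4 * A₂ ^ 3 with hκ
  have hκ0 : 0 < κ := by positivity
  have hvol : ∀ (w : ℝ × ℝ × ℝ × ℝ × ℝ → ℂ) (k : ℝ × ℝ × ℝ × ℝ × ℝ → ℝ≥0∞) (a : ℝ≥0∞),
      (∀ p, w p ≠ 0 → p.2 ∈ longAdmissible (A₁ ^ 2 * X₁ ^ 2) (A₂ * X₂)) →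
      (∫⁻ p, ‖w p‖ₑ * k p ∂((volume.restrict (Ioi 0)).prod volume) ≤ a * ENNReal.ofReal
        (calR R₁ R₂ * (4 * (A₁ ^ 2 * X₁ ^ 2 * (A₂ * X₂) ^ 2) * (A₁ ^ 2 * X₁ ^ 2 * (A₂ * X₂))
        * singMass η (A₁ ^ 2 * X₁ ^ 2 * (A₂ * X₂) ^ 2) ^ 2))) →
      ∫⁻ p, ‖w p‖ₑ * k p ∂((volume.restrict (Ioi 0)).prod volume)
        ≤ a * ENNReal.ofReal (κ * V) := by
    intro w k a hw h
    by_cases hM : 1 ≤ A₁ ^ 2 * X₁ ^ 2 * (A₂ * X₂) ^ 2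
    · exact h.trans (mul_le_mul_right (ENNReal.ofReal_le_ofReal
        (volume_long_le hA₁ hA₂ hX₁ hX₂ hc hη0 hηε hM)) _)
    · have hz : ∀ p, w p = 0 := fun p => by
        by_contra hp
        exact hM (one_le_of_mem_longAdmissible (hw p hp))
      simp [hz]
  have hvL : ∫⁻ p, ‖DL.w p‖ₑ ∂((volume.restrict (Ioi 0)).prod volume)
      ≤ ENNReal.ofReal (κ * V) := by
    simpa using hvol DL.w 1 1 (fun p hp => (hsL p hp).2.2) (by
      simpa using lintegral_enorm_long_le hc hη0 hη1 (by positivity) (by positivity)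
        (mul_pos hA₂ hX₂') hsL)
  have hvR : ∫⁻ p, ‖DR.w p‖ₑ ∂((volume.restrict (Ioi 0)).prod volume)
      ≤ ENNReal.ofReal (κ * V) := by
    simpa using hvol DR.w 1 1 (fun p hp => (hsR p hp).2.2) (by
      simpa using lintegral_enorm_long_le hc hη0 hη1 (by positivity) (by positivity)
        (mul_pos hA₁ hX₁') hsR)
  have hlR : ∫⁻ p, ‖DR.w p‖ₑ * ENNReal.ofReal (R₁ / (1 + R₁ * |DR.r p - DR.σ * DR.s p|) ^ 2)
      ∂((volume.restrict (Ioi 0)).prod volume) ≤ ENNReal.ofReal (κ * (T * V)) := by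
    rw [mul_left_comm, ENNReal.ofReal_mul hT0, hT,
      ENNReal.ofReal_toReal PhaseData.lintegral_inv_one_add_abs_sq_lt_top.ne]
    refine hvol DR.w _ _ (fun p hp => (hsR p hp).2.2) ?_
    refine lintegral_localised_long_le
      (s := fun x => Real.log (√(xiLong1 x.1 x.2.1 x.2.2.1 x.2.2.2)
        / xiLong2 x.1 x.2.1 x.2.2.1 x.2.2.2)) (by unfold xiLong1 xiLong2; fun_prop)
      hc hη0 hη1 (by positivity) (by positivity) hR₁' fun p hp => ?_
    obtain ⟨m1, m2, m3⟩ := hsR p hp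
    have hp0 : 0 < p.1 := lt_of_lt_of_le (by positivity) m1.1
    refine ⟨hp0, m2, m3, ?_⟩
    have hξ₁ := Real.sqrt_pos.2 (xiLong1_pos p.2.1 p.2.2.1 p.2.2.2.1 p.2.2.2.2)
    have hξ₂ := xiLong2_pos p.2.1 p.2.2.1 p.2.2.2.1 p.2.2.2.2
    simp only [hDR, dataLongRight, zero_mul, sub_zero]
    rw [Real.log_div (by positivity) (by positivity), Real.log_div hξ₁.ne' hξ₂.ne',
      Real.log_mul hA₁.ne' hξ₁.ne', Real.log_mul hξ₂.ne' hp0.ne', Real.log_mul hA₁.ne' hp0.ne']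
    ring
  have hwL : Integrable DL.w ((volume.restrict (Ioi 0)).prod volume) :=
    ⟨DL.measurable_w.aestronglyMeasurable, lt_of_le_of_lt hvL ENNReal.ofReal_lt_top⟩
  have hwR : Integrable DR.w ((volume.restrict (Ioi 0)).prod volume) :=
    ⟨DR.measurable_w.aestronglyMeasurable, lt_of_le_of_lt hvR ENNReal.ofReal_lt_top⟩
  have hJL := JLong_eq_left hm hf01 hfs hA₁ hA₂ hX₁' hR₁ hR₁₂ hwL
  have hJR := JLong_eq_right hm hf01 hfs hA₁ hA₂ hX₂' hR₁ hR₁₂ hwR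
  set Y₁ := A₁ ^ 2 * A₂ * X₁ * X₂ ^ 2 with hY₁
  set Y₂ := A₁ ^ 2 * A₂ ^ 2 * X₁ ^ 2 * X₂ with hY₂
  have hY₁0 : 0 ≤ Y₁ := by positivity
  have hY₂0 : 0 ≤ Y₂ := by positivity
  -- Three bounds for the same integral: `b0` without decay, `b1` with decay in `Y₁` (distinguished
  -- variable `y₁`), and `b2` with decay in `Y₂` (distinguished variable `y₂`).
  have b0 := norm_integral_mul_const_mul_le hκ0 hJR
    ((hl _ DR _ R₁ R₂ (κ * (T * V)) hR₁ hR₁₂ (by positivity) hwR hlR).trans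
      (le_of_eq (mul_left_comm _ _ _)))
  have b1 := norm_integral_mul_const_mul_le (B := K₁ * V * (R₂ ^ 2 * ((1 + Y₁) / R₂) ^ N)) hκ0 hJL
    ((hd _ DL _ R₁ R₂ Y₁ (κ * V) hR₁ hR₁₂ hY₁0 (by positivity)
      (fun p hp => phase_longLeft_bounds hA₁ hA₂ hX₁ hX₂ (hsL p hp).2.2) hvL).trans
      (le_of_eq (by ring)))
  have b2 := norm_integral_mul_const_mul_le (B := K₁ * V * (R₂ ^ 2 * ((1 + Y₂) / R₂) ^ N)) hκ0 hJR
    ((hd _ DR _ R₁ R₂ Y₂ (κ * V) hR₁ hR₁₂ hY₂0 (by positivity)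
      (fun p hp => phase_longRight_bounds hA₁ hA₂ hX₁' hX₂' (hsR p hp).2.2) hvR).trans
      (le_of_eq (by ring)))
  have hK : K₁ * V ≤ (K₁ + K₂ * T) * V := by gcongr; exact le_add_of_nonneg_right (by positivity)
  -- No power of `R₁` has been spent so far; the claimed `R₁ ^ ε` is pure slack.
  have hR1 : 1 ≤ R₁ ^ ε := Real.one_le_rpow hR₁ hε.le
  refine (hN _ ((K₁ + K₂ * T) * V) R₂ ((1 + Y₁) / R₂) ((1 + Y₂) / R₂) (hR₁.trans hR₁₂)
    (by positivity) (by gcongr; linarith) (by gcongr; linarith) (b0.trans ?_)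
    (b1.trans (mul_le_mul_of_nonneg_right hK (by positivity)))
    (b2.trans (mul_le_mul_of_nonneg_right hK (by positivity)))).trans ?_
  · nlinarith [mul_nonneg hK₁ hV0]
  · rw [Real.mul_rpow (by positivity) hR₂'.le, Real.mul_rpow (by positivity) hR₁'.le]
    calc _ ≤ (K₁ + K₂ * T) * V * (R₂ ^ ε * ((1 + Y₁) / R₂) ^ C₁ * ((1 + Y₂) / R₂) ^ C₂)
          * R₁ ^ ε := le_mul_of_one_le_right (by positivity) hR1
      _ = _ := by rw [hV]; ring

end GSp4

end

/-! ### Assembly of the three bounds -/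

theorem mainTheorem10
    (f : ℝ → ℝ) (hf : ContDiff ℝ ∞ f) (hf01 : ∀ x, f x ∈ Set.Icc (0 : ℝ) 1)
    (hfsupp : Function.support f ⊆ Set.Icc 1 2) (hf0 : f ≠ 0)
    (g : ℝ → ℝ) (hg : ContDiff ℝ ∞ g) (hgc : HasCompactSupport g)
    (hgpos : tsupport g ⊆ Set.Ioi 0) :
    ∃ R₀ : ℝ, 1 ≤ R₀ ∧
      ∀ C₁ C₂ ε : ℝ, 0 ≤ C₁ → 0 ≤ C₂ → 0 < ε →
      ∃ K : ℝ, ∀ R₁ R₂ X₁ X₂ : ℝ, R₀ ≤ R₁ → R₁ ≤ R₂ → 1 ≤ X₁ → 1 ≤ X₂ →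
        (∀ A : ℝ, 0 < A →
          ‖∫ τ : ℝ × ℝ, ((g (τ.1 / R₁) * g (τ.2 / R₂) : ℝ) : ℂ)
              * GSp4.JABA (GSp4.testF f τ.1 τ.2 X₁ X₂ R₁ R₂) A‖
            ≤ K * GSp4.calR R₁ R₂ * (A * R₁ * R₂) ^ ε * (X₁ ^ 4 * X₂ ^ 3) ^ (1 + ε)
                * ((1 + A * √X₂) / R₂) ^ C₁) ∧
        (∀ A : ℝ, 0 < A →
          ‖∫ τ : ℝ × ℝ, ((g (τ.1 / R₁) * g (τ.2 / R₂) : ℝ) : ℂ)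
              * GSp4.JBAB (GSp4.testF f τ.1 τ.2 X₁ X₂ R₁ R₂) A‖
            ≤ K * GSp4.calR R₁ R₂ * A ^ (-(3 / 2 : ℝ) + ε) * (R₁ * R₂) ^ ε
                * (X₁ ^ 4 * X₂ ^ 3) ^ (1 + ε) * ((1 + √A * X₁) / R₂) ^ C₂) ∧
        (∀ A₁ A₂ : ℝ, 0 < A₁ → 0 < A₂ →
          ‖∫ τ : ℝ × ℝ, ((g (τ.1 / R₁) * g (τ.2 / R₂) : ℝ) : ℂ)
              * GSp4.JLong (GSp4.testF f τ.1 τ.2 X₁ X₂ R₁ R₂) A₁ A₂‖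
            ≤ K * GSp4.calR R₁ R₂ * (A₁ * A₂ * R₁ * R₂) ^ ε * (X₁ ^ 4 * X₂ ^ 3) ^ (1 + ε)
                * ((1 + A₁ ^ 2 * A₂ * X₁ * X₂ ^ 2) / R₂) ^ C₁
                * ((1 + A₁ ^ 2 * A₂ ^ 2 * X₁ ^ 2 * X₂) / R₂) ^ C₂) := by
  -- The estimates need only `R₁ ≥ 1`, so `R₀ = 1` serves for all `f` and `g`.
  refine ⟨1, le_rfl, fun C₁ C₂ ε hC₁ hC₂ hε => ?_⟩
  obtain ⟨K₁, hK₁, h₁⟩ := GSp4.exists_bound_ABA hf hf01 hfsupp hg hgc hgpos hC₁ hε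
  obtain ⟨K₂, hK₂, h₂⟩ := GSp4.exists_bound_BAB hf hf01 hfsupp hg hgc hgpos hC₂ hε
  obtain ⟨K₃, hK₃, h₃⟩ := GSp4.exists_bound_Long hf hf01 hfsupp hg hgc hgpos hC₁ hC₂ hε
  refine ⟨K₁ + K₂ + K₃, fun R₁ R₂ X₁ X₂ hR₁ hR₁₂ hX₁ hX₂ =>
    ⟨fun A hA => ?_, fun A hA => ?_, fun A₁ A₂ hA₁ hA₂ => ?_⟩⟩
  all_goals
    have hc := GSp4.calR_nonneg hR₁ hR₁₂
    have hR₁' : 0 < R₁ := by linarith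
    have hR₂' : 0 < R₂ := by linarith
    have hX₁' : 0 < X₁ := by linarith
    have hX₂' : 0 < X₂ := by linarith
  · refine (h₁ R₁ R₂ X₁ X₂ A hR₁ hR₁₂ hX₁ hX₂ hA).trans ?_
    refine (mul_le_mul_of_nonneg_right (show K₁ ≤ K₁ + K₂ + K₃ by linarith)
      (by positivity)).trans (le_of_eq (by ring))
  · refine (h₂ R₁ R₂ X₁ X₂ A hR₁ hR₁₂ hX₁ hX₂ hA).trans ?_
    refine (mul_le_mul_of_nonneg_right (show K₂ ≤ K₁ + K₂ + K₃ by linarith)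
      (by positivity)).trans (le_of_eq (by ring))
  · refine (h₃ R₁ R₂ X₁ X₂ A₁ A₂ hR₁ hR₁₂ hX₁ hX₂ hA₁ hA₂).trans ?_
    refine (mul_le_mul_of_nonneg_right (show K₃ ≤ K₁ + K₂ + K₃ by linarith)
      (by positivity)).trans (le_of_eq (by ring))
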